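/- All Hilbert spaces are finite-dimensional and complex, $\dagger$ is the Hilbert space adjoint, and maps are linear; associativity and unit isomorphisms of tensor products are suppressed. **Frobenius algebras.** A *dagger Frobenius algebra* is a Hilbert space $A$ with an associative multiplication $m:A\otimes A\to A$ and a unit $u:\mathbb C\to A$ such that $(m\otimes 1)(1\otimes m^\dagger)=m^\dagger m=(1\otimes m)(m^\dagger\otimes 1)$. Its cap is $\cap_A=u^\dagger m$ and its cup is $\cup_A=m^\dagger u$. It is *special* if $mm^\dagger=1$ and *symmetric* if $\cap_A$ is invariant under the swap. A map $f:A\to B$ of dagger Frobenius algebras is a *$*$-isomorphism* if $f m_A=m_B(f\otimes f)$, $f u_A=u_B$, $m_B^\dagger f=(f\otimes f)m_A^\dagger$, $u_B^\dagger f=u_A^\dagger$ and $f^\dagger=(1_A\otimes\cap_B)(1_A\otimes f\otimes 1_B)(\cup_A\otimes 1_B)$. For $H\neq 0$ of dimension $n$, the *endomorphism algebra* is $H\otimes H^*$ with $m((x\otimes f)\otimes(y\otimes g))=n^{-1/2}f(y)\,x\otimes g$ and unit $n^{1/2}\sum_i e_i\otimes e_i^*$, where $(e_i)$ is an orthonormal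 basis of $H$. **Quantum graphs.** A *quantum graph* $\Gamma$ is a special symmetric dagger Frobenius algebra $V_\Gamma$ with a self-adjoint map $\Gamma:V_\Gamma\to V_\Gamma$ such that $m(\Gamma\otimes\Gamma)m^\dagger=\Gamma$, $(1\otimes\cap)(1\otimes\Gamma\otimes 1)(\cup\otimes 1)=\Gamma$ and $m(\Gamma\otimes 1)m^\dagger=1$. Quantum graphs $\Gamma,\Gamma'$ are *isomorphic* if there is a $*$-isomorphism $f:V_\Gamma\to V_{\Gamma'}$ with $f\Gamma=\Gamma'f$. **Quantum isomorphisms.** A *quantum isomorphism* $(H,P):\Gamma\to\Gamma'$ is a Hilbert space $H$ with a map $P:H\otimes V_\Gamma\to V_{\Gamma'}\otimes H$ such that, writing $P_2=(1_{V_{\Gamma'}}\otimes P)(P\otimes 1_{V_\Gamma})$ and $m,u$ and $m',u'$ for the structure maps of $V_\Gamma$ and $V_{\Gamma'}$, $$(m'^\dagger\otimes 1)P=P_2(1\otimes m^\dagger),\quad (u'^\dagger\otimes 1)P=1\otimes u^\dagger,\quad P(1\otimes m)=(m'\otimes 1)P_2,\quad P(1\otimes u)=u'\otimes 1,$$ $$P^\dagger=(\cap_{V_{\Gamma'}}\otimes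 1_H\otimes 1_{V_\Gamma})(1_{V_{\Gamma'}}\otimes P\otimes 1_{V_\Gamma})(1_{V_{\Gamma'}}\otimes 1_H\otimes\cup_{V_\Gamma}),\qquad P(1\otimes\Gamma)=(\Gamma'\otimes 1)P .$$ It is *nonzero* if $H\ne0$. An *intertwiner* $(H,P)\to(K,Q)$ is a map $f:H\to K$ with $Q(f\otimes 1)=(1\otimes f)P$. The composite of $(H,P):\Gamma\to\Gamma'$ and $(K,Q):\Gamma'\to\Gamma''$ is $(K\otimes H,\,Q\circ P)$ with $Q\circ P=(Q\otimes 1_H)(1_K\otimes P)$. The dual of $(H,P)$ is $(H^*,\overline P):\Gamma'\to\Gamma$ with $\overline P(f\otimes w)=\sum_i (f\otimes 1)\bigl(P^\dagger(w\otimes e_i)\bigr)\otimes e_i^*$. The monoidal dagger category $\mathrm{QAut}(\Gamma)$ has the quantum isomorphisms $\Gamma\to\Gamma$ as objects, intertwiners as morphisms, the adjoint as dagger, and composition of quantum isomorphisms as tensor product, with unit object $\mathbb C$. **Frobenius monoids and Morita equivalence.** A *simple dagger Frobenius monoid* in $\mathrm{QAut}(\Gamma)$ is an object with multiplication and unit intertwiners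 that make its underlying Hilbert space a dagger Frobenius algebra $*$-isomorphic to the endomorphism algebra of some nonzero Hilbert space. Such monoids are *$*$-isomorphic* if there is a $*$-isomorphism between them which is an intertwiner. For two of them, $A$ and $B$, an *$A$-$B$-dagger bimodule* is an object $M$ with an intertwiner $\rho:A\otimes M\otimes B\to M$ such that $\rho(m_A\otimes 1_M\otimes m_B)=\rho(1_A\otimes\rho\otimes 1_B)$, $\rho(u_A\otimes 1_M\otimes u_B)=1_M$ and $(\cap_A\otimes 1_M\otimes\cap_B)(1_A\otimes\rho^\dagger\otimes 1_B)=\rho$. For bimodules ${}_AM_B$ and ${}_BN_C$, the relative tensor product $M\otimes_BN$ is the dagger splitting $i:M\otimes_BN\to M\otimes N$ (so $i^\dagger i=1$ and $ii^\dagger=p$) of the idempotent $p$ on $M\otimes N$ that inserts $\cup_B$ between $M$ and $N$ and lets its two legs act on $M$ from the right and on $N$ from the left; its $A$-$C$-action is obtained by conjugating with $i$ the actions of $A$ on $M$ and of $C$ on $N$. $A$ and $B$ are *Morita equivalent* if there are dagger bimodules ${}_AM_B$ and ${}_BN_A$ such that $M\otimes_BN\cong A$ and $N\otimes_AM\cong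 B$ by unitary intertwiners of bimodules, $A$ and $B$ being bimodules by multiplication. **Theorem.** Let $\Gamma$ be a quantum graph. Isomorphism is an equivalence relation on the quantum graphs $\Gamma'$ that admit a nonzero quantum isomorphism $\Gamma'\to\Gamma$, Morita equivalence is an equivalence relation on the simple dagger Frobenius monoids in $\mathrm{QAut}(\Gamma)$, and there is a bijection $\Phi$ from the isomorphism classes of the former to the Morita equivalence classes of the latter such that: 1. for every nonzero quantum isomorphism $(H,P):\Gamma'\to\Gamma$, the object $(H\otimes H^*,P\circ\overline P)$ with the endomorphism algebra structure on $H\otimes H^*$ is a simple dagger Frobenius monoid in $\mathrm{QAut}(\Gamma)$, and $\Phi([\Gamma'])=[P\circ\overline P]$; 2. for every simple dagger Frobenius monoid $X$ in $\mathrm{QAut}(\Gamma)$ there are a quantum graph $\Gamma_X$ and a nonzero quantum isomorphism $(H,P):\Gamma_X\to\Gamma$ such that $X$ is $*$-isomorphic to $P\circ\overline P$, and $\Phi([\Gamma_X])=[X]$. -/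

import Mathlib

open scoped TensorProduct

universe u

noncomputable section

namespace QG

/-! ### Finite-dimensional Hilbert spaces and their duals

A finite-dimensional Hilbert space is a type with `NormedAddCommGroup`, `InnerProductSpace ℂ` and
`FiniteDimensional ℂ` instances, tensor products carry Mathlib's inner product
`⟪a ⊗ b, c ⊗ d⟫ = ⟪a, c⟫ * ⟪b, d⟫`, and the dagger of a linear map is `LinearMap.adjoint`. -/

section Dual

variable (H : Type*) [NormedAddCommGroup H] [InnerProductSpace ℂ H] [FiniteDimensional ℂ H]

/-- The dual of a finite-dimensional Hilbert space, with the operator norm, is a Hilbert space: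
`⟪⟪x, ·⟫, ⟪y, ·⟫⟫ = ⟪y, x⟫`. -/
instance dualInnerProductSpace : InnerProductSpace ℂ (StrongDual ℂ H) :=
  letI : CompleteSpace H := FiniteDimensional.complete ℂ H
  { inner := fun f g =>
      inner ℂ ((InnerProductSpace.toDual ℂ H).symm g) ((InnerProductSpace.toDual ℂ H).symm f)
    norm_sq_eq_re_inner := fun f => by
      rw [← norm_sq_eq_re_inner, LinearIsometryEquiv.norm_map]
    conj_inner_symm := fun f g => by
      rw [inner_conj_symm]
    add_left := fun f g h => by
      rw [map_add, inner_add_right]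
    smul_left := fun f g r => by
      rw [map_smulₛₗ, inner_smul_right] }

/-- The vector `∑ i, eᵢ ⊗ eᵢ*` of `H ⊗ H*`, for any orthonormal basis `e` of `H`; it corresponds to
the identity under `H ⊗ H* ≅ End H`. -/
def dualCup : H ⊗[ℂ] StrongDual ℂ H :=
  ∑ i, stdOrthonormalBasis ℂ H i ⊗ₜ[ℂ] innerSL ℂ (stdOrthonormalBasis ℂ H i)

variable {H}

/-- The cap of `H*` with `H`, with a spectator on the right:
`f ⊗ (h ⊗ w) ↦ f h • w`. -/
def dualCap (W : Type*) [AddCommGroup W] [Module ℂ W] :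
    StrongDual ℂ H ⊗[ℂ] (H ⊗[ℂ] W) →ₗ[ℂ] W :=
  (TensorProduct.lid ℂ W).toLinearMap ∘ₗ
    (TensorProduct.lift (ContinuousLinearMap.coeLM ℂ)).rTensor W ∘ₗ
      (TensorProduct.assoc ℂ (StrongDual ℂ H) H W).symm.toLinearMap

variable (H)

/-- The multiplication of the endomorphism algebra on `H ⊗ H*`, where `n = dim H`:
`(x ⊗ f) ⊗ (y ⊗ g) ↦ n^(-1/2) f y • (x ⊗ g)`. -/
def endMul : (H ⊗[ℂ] StrongDual ℂ H) ⊗[ℂ] (H ⊗[ℂ] StrongDual ℂ H) →ₗ[ℂ]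
    H ⊗[ℂ] StrongDual ℂ H :=
  ((Real.sqrt (Module.finrank ℂ H) : ℝ) : ℂ)⁻¹ •
    ((dualCap (StrongDual ℂ H)).lTensor H ∘ₗ
      (TensorProduct.assoc ℂ H (StrongDual ℂ H) (H ⊗[ℂ] StrongDual ℂ H)).toLinearMap)

/-- The unit of the endomorphism algebra on `H ⊗ H*`, where `n = dim H`: `n^(1/2) ∑ i, eᵢ ⊗ eᵢ*`. -/
def endOne : H ⊗[ℂ] StrongDual ℂ H :=
  ((Real.sqrt (Module.finrank ℂ H) : ℝ) : ℂ) • dualCup H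

end Dual

/-! ### Dagger Frobenius algebras

A monoid structure on `A` is given by `m : A ⊗ A → A` and the vector `e : A` (the image of `1` under
the unit morphism `ℂ → A`). The comultiplication is `m†` and the counit is `⟪e, ·⟫`. -/

section Frobenius

variable {A : Type*} [NormedAddCommGroup A] [InnerProductSpace ℂ A] [FiniteDimensional ℂ A]
variable {B : Type*} [NormedAddCommGroup B] [InnerProductSpace ℂ B] [FiniteDimensional ℂ B]

/-- A dagger Frobenius algebra. -/
structure IsDaggerFrobenius (m : A ⊗[ℂ] A →ₗ[ℂ] A) (e : A) : Prop where
  assoc : ∀ a b c : A, m (m (a ⊗ₜ b) ⊗ₜ c) = m (a ⊗ₜ m (b ⊗ₜ c))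
  one_mul : ∀ a : A, m (e ⊗ₜ a) = a
  mul_one : ∀ a : A, m (a ⊗ₜ e) = a
  /-- `(m ⊗ 1)(1 ⊗ m†) = m† m` -/
  frobenius_left :
    m.rTensor A ∘ₗ (TensorProduct.assoc ℂ A A A).symm.toLinearMap ∘ₗ m.adjoint.lTensor A =
      m.adjoint ∘ₗ m
  /-- `(1 ⊗ m)(m† ⊗ 1) = m† m` -/
  frobenius_right :
    m.lTensor A ∘ₗ (TensorProduct.assoc ℂ A A A).toLinearMap ∘ₗ m.adjoint.rTensor A =
      m.adjoint ∘ₗ m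

/-- Specialness: `m m† = 1`. -/
def IsSpecial (m : A ⊗[ℂ] A →ₗ[ℂ] A) : Prop := m ∘ₗ m.adjoint = LinearMap.id

/-- The cap `A ⊗ A → ℂ` of a Frobenius algebra: multiplication followed by the counit. -/
def frobCap (m : A ⊗[ℂ] A →ₗ[ℂ] A) (e : A) : A ⊗[ℂ] A →ₗ[ℂ] ℂ := innerₛₗ ℂ e ∘ₗ m

/-- The cup `ℂ → A ⊗ A` of a Frobenius algebra, as a vector: the comultiplication of the unit. -/
def frobCup (m : A ⊗[ℂ] A →ₗ[ℂ] A) (e : A) : A ⊗[ℂ] A := m.adjoint e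

/-- Symmetry: the cap is invariant under the swap. -/
def IsSymm (m : A ⊗[ℂ] A →ₗ[ℂ] A) (e : A) : Prop :=
  ∀ a b : A, frobCap m e (a ⊗ₜ b) = frobCap m e (b ⊗ₜ a)

/-- The `180°` rotation `(1_A ⊗ cap_B)(1_A ⊗ f ⊗ 1_B)(cup_A ⊗ 1_B) : B → A` of `f : A → B`. -/
def frobTranspose (mA : A ⊗[ℂ] A →ₗ[ℂ] A) (eA : A) (mB : B ⊗[ℂ] B →ₗ[ℂ] B) (eB : B)
    (f : A →ₗ[ℂ] B) : B →ₗ[ℂ] A :=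
  (TensorProduct.rid ℂ A).toLinearMap ∘ₗ
    (frobCap mB eB ∘ₗ f.rTensor B).lTensor A ∘ₗ
      (TensorProduct.assoc ℂ A A B).toLinearMap ∘ₗ
        TensorProduct.mk ℂ (A ⊗[ℂ] A) B (frobCup mA eA)

/-- A `*`-homomorphism: multiplicative, unital, and `f†` is the rotation of `f`. -/
structure IsStarHom (mA : A ⊗[ℂ] A →ₗ[ℂ] A) (eA : A) (mB : B ⊗[ℂ] B →ₗ[ℂ] B) (eB : B)
    (f : A →ₗ[ℂ] B) : Prop where
  map_mul : ∀ a b : A, f (mA (a ⊗ₜ b)) = mB (f a ⊗ₜ f b)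
  map_one : f eA = eB
  adjoint_eq : f.adjoint = frobTranspose mA eA mB eB f

/-- A `*`-cohomomorphism: comultiplicative, counital, and `f†` is the rotation of `f`. -/
structure IsStarCohom (mA : A ⊗[ℂ] A →ₗ[ℂ] A) (eA : A) (mB : B ⊗[ℂ] B →ₗ[ℂ] B) (eB : B)
    (f : A →ₗ[ℂ] B) : Prop where
  map_comul : mB.adjoint ∘ₗ f = TensorProduct.map f f ∘ₗ mA.adjoint
  map_counit : ∀ a : A, inner ℂ eB (f a) = inner ℂ eA a
  adjoint_eq : f.adjoint = frobTranspose mA eA mB eB f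

/-- A `*`-isomorphism is both a `*`-homomorphism and a `*`-cohomomorphism. -/
structure IsStarIso (mA : A ⊗[ℂ] A →ₗ[ℂ] A) (eA : A) (mB : B ⊗[ℂ] B →ₗ[ℂ] B) (eB : B)
    (f : A →ₗ[ℂ] B) : Prop where
  hom : IsStarHom mA eA mB eB f
  cohom : IsStarCohom mA eA mB eB f

end Frobenius

/-! ### Quantum graphs -/

/-- A quantum graph: a special symmetric dagger Frobenius algebra `V` (the quantum set of vertices)
with a self-adjoint quantum adjacency matrix `adj : V → V`. -/
structure QuantumGraph : Type (u + 1) where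
  V : Type u
  [normedAddCommGroup : NormedAddCommGroup V]
  [innerProductSpace : InnerProductSpace ℂ V]
  [finiteDimensional : FiniteDimensional ℂ V]
  mul : V ⊗[ℂ] V →ₗ[ℂ] V
  one : V
  frobenius : IsDaggerFrobenius mul one
  special : IsSpecial mul
  symmetric : IsSymm mul one
  adj : V →ₗ[ℂ] V
  adj_selfAdjoint : adj.adjoint = adj
  /-- `m (Γ ⊗ Γ) m† = Γ` -/
  adj_schur : mul ∘ₗ TensorProduct.map adj adj ∘ₗ mul.adjoint = adj
  /-- `Γ` equals its rotation -/
  adj_transpose : frobTranspose mul one mul one adj = adj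
  /-- `m (Γ ⊗ 1) m† = 1` -/
  adj_refl : mul ∘ₗ adj.rTensor V ∘ₗ mul.adjoint = LinearMap.id

attribute [instance] QuantumGraph.normedAddCommGroup QuantumGraph.innerProductSpace
  QuantumGraph.finiteDimensional

/-- Quantum graphs are isomorphic if there is a `*`-isomorphism of their vertex algebras which
intertwines the adjacency matrices. -/
def QuantumGraph.Iso (Γ Γ' : QuantumGraph.{u}) : Prop :=
  ∃ f : Γ.V →ₗ[ℂ] Γ'.V,
    IsStarIso Γ.mul Γ.one Γ'.mul Γ'.one f ∧ f ∘ₗ Γ.adj = Γ'.adj ∘ₗ f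

/-! ### Quantum isomorphisms -/

section Maps

variable {H K : Type*} [NormedAddCommGroup H] [InnerProductSpace ℂ H] [FiniteDimensional ℂ H]
  [NormedAddCommGroup K] [InnerProductSpace ℂ K] [FiniteDimensional ℂ K]
variable {V W U : Type*} [NormedAddCommGroup V] [InnerProductSpace ℂ V] [FiniteDimensional ℂ V]
  [NormedAddCommGroup W] [InnerProductSpace ℂ W] [FiniteDimensional ℂ W]
  [NormedAddCommGroup U] [InnerProductSpace ℂ U] [FiniteDimensional ℂ U]

/-- The wire `H` crossing two wires: `(1_W ⊗ P)(P ⊗ 1_V) : H ⊗ V ⊗ V → W ⊗ W ⊗ H`. -/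
def crossTwo (P : H ⊗[ℂ] V →ₗ[ℂ] W ⊗[ℂ] H) : H ⊗[ℂ] (V ⊗[ℂ] V) →ₗ[ℂ] (W ⊗[ℂ] W) ⊗[ℂ] H :=
  (TensorProduct.assoc ℂ W W H).symm.toLinearMap ∘ₗ P.lTensor W ∘ₗ
    (TensorProduct.assoc ℂ W H V).toLinearMap ∘ₗ P.rTensor V ∘ₗ
      (TensorProduct.assoc ℂ H V V).symm.toLinearMap

/-- The rotation `(cap_W ⊗ 1_H ⊗ 1_V)(1_W ⊗ P ⊗ 1_V)(1_W ⊗ 1_H ⊗ cup_V) : W ⊗ H → H ⊗ V` of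
`P : H ⊗ V → W ⊗ H`, given the cap of `W` and the cup of `V`. -/
def crossTranspose (cap : W ⊗[ℂ] W →ₗ[ℂ] ℂ) (cup : V ⊗[ℂ] V) (P : H ⊗[ℂ] V →ₗ[ℂ] W ⊗[ℂ] H) :
    W ⊗[ℂ] H →ₗ[ℂ] H ⊗[ℂ] V :=
  ((TensorProduct.lid ℂ H).toLinearMap ∘ₗ cap.rTensor H ∘ₗ
      (TensorProduct.assoc ℂ W W H).symm.toLinearMap ∘ₗ P.lTensor W ∘ₗ
        (TensorProduct.assoc ℂ W H V).toLinearMap).rTensor V ∘ₗ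
    (TensorProduct.assoc ℂ (W ⊗[ℂ] H) V V).symm.toLinearMap ∘ₗ
      (TensorProduct.mk ℂ (W ⊗[ℂ] H) (V ⊗[ℂ] V)).flip cup

/-- The composite `Q ∘ P = (Q ⊗ 1_H)(1_K ⊗ P)` of `P : H ⊗ V → W ⊗ H` and `Q : K ⊗ W → U ⊗ K`. -/
def crossComp (Q : K ⊗[ℂ] W →ₗ[ℂ] U ⊗[ℂ] K) (P : H ⊗[ℂ] V →ₗ[ℂ] W ⊗[ℂ] H) :
    (K ⊗[ℂ] H) ⊗[ℂ] V →ₗ[ℂ] U ⊗[ℂ] (K ⊗[ℂ] H) :=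
  (TensorProduct.assoc ℂ U K H).toLinearMap ∘ₗ Q.rTensor H ∘ₗ
    (TensorProduct.assoc ℂ K W H).symm.toLinearMap ∘ₗ P.lTensor K ∘ₗ
      (TensorProduct.assoc ℂ K H V).toLinearMap

/-- The dual `P̄ : H* ⊗ W → V ⊗ H*` of `P : H ⊗ V → W ⊗ H`, obtained from `P†` by bending the wires
`H`: `P̄ (f ⊗ w) = ∑ i, (f ⊗ 1_V) (P† (w ⊗ eᵢ)) ⊗ eᵢ*` for an orthonormal basis `e` of `H`. -/
def crossDual (P : H ⊗[ℂ] V →ₗ[ℂ] W ⊗[ℂ] H) :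
    StrongDual ℂ H ⊗[ℂ] W →ₗ[ℂ] V ⊗[ℂ] StrongDual ℂ H :=
  (dualCap V ∘ₗ P.adjoint.lTensor (StrongDual ℂ H) ∘ₗ
      (TensorProduct.assoc ℂ (StrongDual ℂ H) W H).toLinearMap).rTensor (StrongDual ℂ H) ∘ₗ
    (TensorProduct.assoc ℂ (StrongDual ℂ H ⊗[ℂ] W) H (StrongDual ℂ H)).symm.toLinearMap ∘ₗ
      (TensorProduct.mk ℂ (StrongDual ℂ H ⊗[ℂ] W) (H ⊗[ℂ] StrongDual ℂ H)).flip (dualCup H)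

/-- `f : H → K` is an intertwiner from `P : H ⊗ V → W ⊗ H` to `Q : K ⊗ V → W ⊗ K`. -/
def Intertwines (P : H ⊗[ℂ] V →ₗ[ℂ] W ⊗[ℂ] H) (Q : K ⊗[ℂ] V →ₗ[ℂ] W ⊗[ℂ] K)
    (f : H →ₗ[ℂ] K) : Prop :=
  Q ∘ₗ f.rTensor V = f.lTensor W ∘ₗ P

end Maps

/-- `P : H ⊗ V_Γ → V_Γ' ⊗ H` satisfies the equations of a quantum isomorphism `Γ → Γ'`. -/
structure IsQuantumIso (Γ Γ' : QuantumGraph.{u}) {H : Type u} [NormedAddCommGroup H]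
    [InnerProductSpace ℂ H] [FiniteDimensional ℂ H] (P : H ⊗[ℂ] Γ.V →ₗ[ℂ] Γ'.V ⊗[ℂ] H) : Prop where
  comul : Γ'.mul.adjoint.rTensor H ∘ₗ P = crossTwo P ∘ₗ Γ.mul.adjoint.lTensor H
  counit : (TensorProduct.lid ℂ H).toLinearMap ∘ₗ (innerₛₗ ℂ Γ'.one).rTensor H ∘ₗ P =
    (TensorProduct.rid ℂ H).toLinearMap ∘ₗ (innerₛₗ ℂ Γ.one).lTensor H
  adjoint_eq : P.adjoint = crossTranspose (frobCap Γ'.mul Γ'.one) (frobCup Γ.mul Γ.one) P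
  mul : P ∘ₗ Γ.mul.lTensor H = Γ'.mul.rTensor H ∘ₗ crossTwo P
  one : ∀ h : H, P (h ⊗ₜ Γ.one) = Γ'.one ⊗ₜ h
  adj : P ∘ₗ Γ.adj.lTensor H = Γ'.adj.rTensor H ∘ₗ P

/-- A quantum isomorphism `(H, P) : Γ → Γ'`. -/
structure QuantumIso (Γ Γ' : QuantumGraph.{u}) : Type (u + 1) where
  H : Type u
  [normedAddCommGroup : NormedAddCommGroup H]
  [innerProductSpace : InnerProductSpace ℂ H]
  [finiteDimensional : FiniteDimensional ℂ H]
  P : H ⊗[ℂ] Γ.V →ₗ[ℂ] Γ'.V ⊗[ℂ] H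
  isQuantumIso : IsQuantumIso Γ Γ' P

attribute [instance] QuantumIso.normedAddCommGroup QuantumIso.innerProductSpace
  QuantumIso.finiteDimensional

/-- There is a quantum isomorphism `Γ → Γ'` on a nonzero Hilbert space. (On `H = 0` the equations
hold vacuously for every pair of quantum graphs.) -/
def QuantumGraph.QuantumIsomorphic (Γ Γ' : QuantumGraph.{u}) : Prop :=
  ∃ P : QuantumIso Γ Γ', Nontrivial P.H

/-! ### Frobenius monoids in `QAut Γ`

`QAut Γ` is the monoidal dagger category whose objects are the quantum isomorphisms `(H, P) : Γ → Γ`,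
whose morphisms `(H, P) → (K, Q)` are the linear maps `f : H → K` with `Intertwines P Q f`, whose
dagger is the Hilbert space adjoint, whose tensor product is the composition
`(K ⊗ H, crossComp Q P)` with the tensor product of linear maps, and whose unit object is `ℂ` with
the canonical identification `ℂ ⊗ V ≅ V ⊗ ℂ`. So a vector `e : H` is a morphism from the unit object
to `(H, P)` if and only if `P (e ⊗ v) = v ⊗ e` for all `v`. -/

/-- The data underlying a monoid in `QAut Γ`: a Hilbert space `H`, a linear map
`P : H ⊗ V → V ⊗ H`, a multiplication and a unit. -/
structure MonoidData (Γ : QuantumGraph.{u}) : Type (u + 1) where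
  H : Type u
  [normedAddCommGroup : NormedAddCommGroup H]
  [innerProductSpace : InnerProductSpace ℂ H]
  [finiteDimensional : FiniteDimensional ℂ H]
  P : H ⊗[ℂ] Γ.V →ₗ[ℂ] Γ.V ⊗[ℂ] H
  mul : H ⊗[ℂ] H →ₗ[ℂ] H
  one : H

attribute [instance] MonoidData.normedAddCommGroup MonoidData.innerProductSpace
  MonoidData.finiteDimensional

/-- A dagger Frobenius monoid in `QAut Γ`. -/
structure MonoidData.IsDaggerFrobeniusMonoid {Γ : QuantumGraph.{u}} (X : MonoidData Γ) : Prop where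
  isQuantumIso : IsQuantumIso Γ Γ X.P
  intertwines_mul : Intertwines (crossComp X.P X.P) X.P X.mul
  intertwines_one : ∀ v : Γ.V, X.P (X.one ⊗ₜ v) = v ⊗ₜ X.one
  frobenius : IsDaggerFrobenius X.mul X.one

/-- A simple dagger Frobenius monoid in `QAut Γ`: its underlying dagger Frobenius algebra is
`*`-isomorphic to the endomorphism algebra on `K ⊗ K*` for some nonzero Hilbert space `K`. -/
structure MonoidData.IsSimple {Γ : QuantumGraph.{u}} (X : MonoidData Γ) : Prop where
  isDaggerFrobeniusMonoid : X.IsDaggerFrobeniusMonoid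
  simple : ∃ (K : Type u) (_ : NormedAddCommGroup K) (_ : InnerProductSpace ℂ K)
    (_ : FiniteDimensional ℂ K), Nontrivial K ∧
      ∃ f : X.H →ₗ[ℂ] K ⊗[ℂ] StrongDual ℂ K, IsStarIso X.mul X.one (endMul K) (endOne K) f

/-- Two monoids in `QAut Γ` are `*`-isomorphic if there is a `*`-isomorphism between them that is an
intertwiner. -/
def MonoidData.StarIso {Γ : QuantumGraph.{u}} (X Y : MonoidData Γ) : Prop :=
  ∃ f : X.H →ₗ[ℂ] Y.H, Intertwines X.P Y.P f ∧ IsStarIso X.mul X.one Y.mul Y.one f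

/-- The underlying data of the monoid `P ∘ P̄` in `QAut Γ` obtained from a quantum isomorphism
`P : Γ' → Γ`: the object `(H ⊗ H*, P ∘ P̄)` with the endomorphism algebra on `H ⊗ H*`. -/
def QuantumIso.monoid {Γ' Γ : QuantumGraph.{u}} (P : QuantumIso Γ' Γ) : MonoidData Γ where
  H := P.H ⊗[ℂ] StrongDual ℂ P.H
  P := crossComp P.P (crossDual P.P)
  mul := endMul P.H
  one := endOne P.H

/-! ### Morita equivalence -/

section Bimodule

variable {A B C M N T : Type*}
  [NormedAddCommGroup A] [InnerProductSpace ℂ A] [FiniteDimensional ℂ A]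
  [NormedAddCommGroup B] [InnerProductSpace ℂ B] [FiniteDimensional ℂ B]
  [NormedAddCommGroup C] [InnerProductSpace ℂ C] [FiniteDimensional ℂ C]
  [NormedAddCommGroup M] [InnerProductSpace ℂ M] [FiniteDimensional ℂ M]
  [NormedAddCommGroup N] [InnerProductSpace ℂ N] [FiniteDimensional ℂ N]
  [NormedAddCommGroup T] [InnerProductSpace ℂ T] [FiniteDimensional ℂ T]

/-- The contraction `a' ⊗ (x ⊗ b') ↦ cap_A (a ⊗ a') cap_B (b' ⊗ b) • x`. -/
def contract (capA : A ⊗[ℂ] A →ₗ[ℂ] ℂ) (capB : B ⊗[ℂ] B →ₗ[ℂ] ℂ) (a : A) (b : B) :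
    A ⊗[ℂ] (M ⊗[ℂ] B) →ₗ[ℂ] M :=
  (TensorProduct.lid ℂ M).toLinearMap ∘ₗ
    TensorProduct.map (capA ∘ₗ TensorProduct.mk ℂ A A a)
      ((TensorProduct.rid ℂ M).toLinearMap ∘ₗ
        (capB ∘ₗ (TensorProduct.mk ℂ B B).flip b).lTensor M)

/-- The equations of an `A`-`B`-dagger bimodule for an action `ρ : A ⊗ M ⊗ B → M`. -/
structure IsDaggerBimodule (mA : A ⊗[ℂ] A →ₗ[ℂ] A) (eA : A) (mB : B ⊗[ℂ] B →ₗ[ℂ] B) (eB : B)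
    (ρ : A ⊗[ℂ] (M ⊗[ℂ] B) →ₗ[ℂ] M) : Prop where
  mul_act : ∀ (a a' : A) (x : M) (b' b : B),
    ρ (mA (a ⊗ₜ a') ⊗ₜ (x ⊗ₜ mB (b' ⊗ₜ b))) = ρ (a ⊗ₜ (ρ (a' ⊗ₜ (x ⊗ₜ b')) ⊗ₜ b))
  one_act : ∀ x : M, ρ (eA ⊗ₜ (x ⊗ₜ eB)) = x
  /-- `(cap_A ⊗ 1 ⊗ cap_B)(1 ⊗ ρ† ⊗ 1) = ρ` -/
  dagger : ∀ (a : A) (x : M) (b : B),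
    contract (frobCap mA eA) (frobCap mB eB) a b (LinearMap.adjoint (𝕜 := ℂ) ρ x) =
      ρ (a ⊗ₜ (x ⊗ₜ b))

/-- The left action `a ↦ x ↦ a · x · 1`. -/
def leftAct (eB : B) (ρ : A ⊗[ℂ] (M ⊗[ℂ] B) →ₗ[ℂ] M) : A →ₗ[ℂ] M →ₗ[ℂ] M :=
  TensorProduct.curry (ρ ∘ₗ ((TensorProduct.mk ℂ M B).flip eB).lTensor A)

/-- The right action `b ↦ x ↦ 1 · x · b`. -/
def rightAct (eA : A) (ρ : A ⊗[ℂ] (M ⊗[ℂ] B) →ₗ[ℂ] M) : B →ₗ[ℂ] M →ₗ[ℂ] M :=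
  (TensorProduct.curry (ρ ∘ₗ TensorProduct.mk ℂ A (M ⊗[ℂ] B) eA)).flip

/-- The dagger idempotent on `M ⊗ N` whose splitting is the relative tensor product over `B`, from a
right action `r` of `B` on `M` and a left action `l` of `B` on `N`: create `cup_B` between `M` and
`N`, and let its left leg act on `M` and its right leg act on `N`. -/
def relIdem (cupB : B ⊗[ℂ] B) (r : B →ₗ[ℂ] M →ₗ[ℂ] M) (l : B →ₗ[ℂ] N →ₗ[ℂ] N) :
    M ⊗[ℂ] N →ₗ[ℂ] M ⊗[ℂ] N :=
  TensorProduct.homTensorHomMap (RingHom.id ℂ) M N M N (TensorProduct.map r l cupB)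

/-- `i` is a dagger splitting of `p`: `i† i = 1` and `i i† = p`. -/
structure IsDaggerSplitting (p : M →ₗ[ℂ] M) (i : T →ₗ[ℂ] M) : Prop where
  adjoint_comp : i.adjoint ∘ₗ i = LinearMap.id
  comp_adjoint : i ∘ₗ i.adjoint = p

/-- The action `i† (a · - ⊗ - · c) i` on a relative tensor product `i : T → M ⊗ N`, from a left action
`l` of `A` on `M` and a right action `r` of `C` on `N`. -/
def relAct (l : A →ₗ[ℂ] M →ₗ[ℂ] M) (r : C →ₗ[ℂ] N →ₗ[ℂ] N) (i : T →ₗ[ℂ] M ⊗[ℂ] N) (a : A) (c : C) :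
    T →ₗ[ℂ] T :=
  i.adjoint ∘ₗ TensorProduct.map (l a) (r c) ∘ₗ i

end Bimodule

/-- An `A`-`B`-dagger bimodule in `QAut Γ`: an object of `QAut Γ` with an action of `A` and `B` that
is a morphism of `QAut Γ`. -/
structure DaggerBimodule {Γ : QuantumGraph.{u}} (A B : MonoidData Γ) : Type (u + 1) where
  obj : QuantumIso Γ Γ
  act : A.H ⊗[ℂ] (obj.H ⊗[ℂ] B.H) →ₗ[ℂ] obj.H
  intertwines : Intertwines (crossComp A.P (crossComp obj.P B.P)) obj.P act
  isDaggerBimodule : IsDaggerBimodule A.mul A.one B.mul B.one act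

namespace DaggerBimodule

variable {Γ : QuantumGraph.{u}} {A B C : MonoidData Γ}

/-- The object `T` of `QAut Γ` with the morphism `i : T → M ⊗ N` is a relative tensor product
`M ⊗_B N`, i.e. a dagger splitting in `QAut Γ` of the idempotent on `M ⊗ N`. -/
structure IsRelTensor (M : DaggerBimodule A B) (N : DaggerBimodule B C) (T : QuantumIso Γ Γ)
    (i : T.H →ₗ[ℂ] M.obj.H ⊗[ℂ] N.obj.H) : Prop where
  intertwines : Intertwines T.P (crossComp M.obj.P N.obj.P) i
  splitting : IsDaggerSplitting
    (relIdem (frobCup B.mul B.one) (rightAct A.one M.act) (leftAct C.one N.act)) i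

/-- The relative tensor product of `_A M_B` and `_B N_A` is isomorphic to the trivial bimodule
`_A A_A`: there is a unitary intertwiner `U : M ⊗_B N → A` that commutes with the actions. -/
def TensorIsTrivial (M : DaggerBimodule A B) (N : DaggerBimodule B A) : Prop :=
  ∃ (T : QuantumIso Γ Γ) (i : T.H →ₗ[ℂ] M.obj.H ⊗[ℂ] N.obj.H), IsRelTensor M N T i ∧
    ∃ U : T.H →ₗ[ℂ] A.H, Intertwines T.P A.P U ∧
      U.adjoint ∘ₗ U = LinearMap.id ∧ U ∘ₗ U.adjoint = LinearMap.id ∧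
        ∀ (a c : A.H) (x : T.H),
          U (relAct (leftAct B.one M.act) (rightAct B.one N.act) i a c x) =
            A.mul (A.mul (a ⊗ₜ U x) ⊗ₜ c)

end DaggerBimodule

/-- Morita equivalence of special dagger Frobenius monoids in `QAut Γ`. -/
def MonoidData.MoritaEquivalent {Γ : QuantumGraph.{u}} (A B : MonoidData Γ) : Prop :=
  ∃ (M : DaggerBimodule A B) (N : DaggerBimodule B A), M.TensorIsTrivial N ∧ N.TensorIsTrivial M

/-! ### The two sets of representatives -/

/-- The quantum graphs `Γ'` which admit a quantum isomorphism `Γ' → Γ`. -/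
def QuantumIsomorphicGraph (Γ : QuantumGraph.{u}) : Type (u + 1) :=
  {Γ' : QuantumGraph.{u} // Γ'.QuantumIsomorphic Γ}

/-- The simple dagger Frobenius monoids in `QAut Γ`. -/
def SimpleFrobeniusMonoid (Γ : QuantumGraph.{u}) : Type (u + 1) :=
  {X : MonoidData Γ // X.IsSimple}

/-- Isomorphism of quantum graphs, on the graphs quantum isomorphic to `Γ`. -/
def graphRel (Γ : QuantumGraph.{u}) (G G' : QuantumIsomorphicGraph Γ) : Prop := G.1.Iso G'.1

/-- Morita equivalence, on the simple dagger Frobenius monoids in `QAut Γ`. -/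
def moritaRel (Γ : QuantumGraph.{u}) (X Y : SimpleFrobeniusMonoid Γ) : Prop :=
  X.1.MoritaEquivalent Y.1

end QG

end

noncomputable section

set_option linter.unusedSectionVars false
set_option linter.unusedSimpArgs false

namespace QG

open scoped InnerProductSpace

/-! A map `P : H ⊗ V → W ⊗ H` is a matrix of operators `coef P w v` on `H`, antilinear in `w` and
linear in `v`. Composition of quantum isomorphisms becomes a matrix product with tensored entries,
and the dual becomes entrywise conjugation. In these coordinates a quantum isomorphism is exactly a
multiplicative unital unitary compatible with the adjacency matrices (`isQuantumIso_iff`); the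
comultiplicative, counital and rotation equations follow from that. In the same way a
`*`-isomorphism is a multiplicative unital unitary (`isStarIso_iff`), and being `*`-isomorphic to an
endomorphism algebra means being `End K` with `dim K` times the trace inner product (`IsMatrixRep`).

Seen this way, the monoid `P ∘ P̄` is `End H` with coefficients `S ↦ ∑ j, c(w, eⱼ) S c(v, eⱼ)†`,
where `c = coef P`. The predicate `Presents X P L` says that `X` has this form. Three facts carry
the theorem.

Existence (`exists_presents`). If `X` is simple, its coefficients on `End K` are a
`*`-representation of `End K` on `V ⊗ K`. Such a representation is a multiple of `K`, so `V ⊗ K ≅ V'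
⊗ K` with `V'` the space of module maps `K → V ⊗ K`. This space is closed under convolution,
involution and the adjacency operator of `Γ`, hence is a quantum graph, and evaluation is a quantum
isomorphism presenting `X`.

Isomorphic graphs give Morita equivalent monoids (`moritaEquivalent_of_iso`). Moving the source
along the isomorphism leaves two quantum isomorphisms `P`, `Q` out of one graph, and then `P ∘ Q̄ =
Hom(K, H)` and `Q ∘ P̄ = Hom(H, K)` are inverse bimodules under composition of operators.

Morita equivalent monoids come from isomorphic graphs (`iso_of_moritaEquivalent`). An invertible
bimodule `M` over matrix algebras has only scalar bimodule endomorphisms. The coefficients of `P̄ ∘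
M ∘ Q` induce such endomorphisms, so this quantum isomorphism has a one-dimensional quotient, and a
one-dimensional quantum isomorphism is an isomorphism of graphs.

Hence, for presented monoids, Morita equivalence is isomorphism of the graphs
(`moritaEquivalent_iff_iso`). This makes it an equivalence relation and makes `Φ` well defined and
injective; existence gives surjectivity. -/

/-- A fixed orthonormal basis. -/
abbrev onb (V : Type*) [NormedAddCommGroup V] [InnerProductSpace ℂ V] [FiniteDimensional ℂ V] :=
  stdOrthonormalBasis ℂ V

/-! ### Matrix coefficients of maps `H ⊗ V → W ⊗ H` -/

section Coef

variable {H K : Type*} [NormedAddCommGroup H] [InnerProductSpace ℂ H] [FiniteDimensional ℂ H]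
  [NormedAddCommGroup K] [InnerProductSpace ℂ K] [FiniteDimensional ℂ K]
variable {V W U : Type*} [NormedAddCommGroup V] [InnerProductSpace ℂ V] [FiniteDimensional ℂ V]
  [NormedAddCommGroup W] [InnerProductSpace ℂ W] [FiniteDimensional ℂ W]
  [NormedAddCommGroup U] [InnerProductSpace ℂ U] [FiniteDimensional ℂ U]

/-- The slice map `w' ⊗ h ↦ ⟪w, w'⟫ • h`. -/
def slice (w : W) : W ⊗[ℂ] H →ₗ[ℂ] H :=
  (TensorProduct.lid ℂ H).toLinearMap ∘ₗ (innerₛₗ ℂ w).rTensor H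

@[simp] lemma slice_tmul (w w' : W) (h : H) : slice w (w' ⊗ₜ[ℂ] h) = ⟪w, w'⟫_ℂ • h := by
  simp [slice]

lemma inner_slice (w : W) (h : H) (z : W ⊗[ℂ] H) : ⟪h, slice w z⟫_ℂ = ⟪w ⊗ₜ[ℂ] h, z⟫_ℂ := by
  induction z using TensorProduct.induction_on with
  | zero => simp
  | tmul a b => simp [inner_smul_right]
  | add x y hx hy => simp [inner_add_right, hx, hy]

lemma sum_tmul_slice (z : W ⊗[ℂ] H) : ∑ i, onb W i ⊗ₜ[ℂ] slice (onb W i) z = z := by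
  induction z using TensorProduct.induction_on with
  | zero => simp
  | tmul a b =>
    simp only [slice_tmul, TensorProduct.tmul_smul, TensorProduct.smul_tmul', ← TensorProduct.sum_tmul]
    rw [(onb W).sum_repr']
  | add x y hx hy => simp [TensorProduct.tmul_add, Finset.sum_add_distrib, hx, hy]

lemma slice_ext {z z' : W ⊗[ℂ] H} (h : ∀ w, slice w z = slice w z') : z = z' := by
  rw [← sum_tmul_slice z, ← sum_tmul_slice z']
  simp [h]

/-- The matrix coefficients `⟨w| P (- ⊗ v) : H → H` of `P : H ⊗ V → W ⊗ H`. -/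
def coef (P : H ⊗[ℂ] V →ₗ[ℂ] W ⊗[ℂ] H) : W →ₗ⋆[ℂ] V →ₗ[ℂ] (H →ₗ[ℂ] H) :=
  LinearMap.mk₂'ₛₗ (starRingEnd ℂ) (RingHom.id ℂ)
    (fun w v => slice w ∘ₗ P ∘ₗ (TensorProduct.mk ℂ H V).flip v)
    (fun w w' v => by ext h; simp [slice])
    (fun c w v => by ext h; simp [slice, LinearMap.rTensor_smul])
    (fun w v v' => by ext h; simp)
    (fun c w v => by ext h; simp)

lemma coef_apply (P : H ⊗[ℂ] V →ₗ[ℂ] W ⊗[ℂ] H) (w : W) (v : V) (h : H) :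
    coef P w v h = slice w (P (h ⊗ₜ v)) := rfl

lemma inner_coef (P : H ⊗[ℂ] V →ₗ[ℂ] W ⊗[ℂ] H) (w : W) (v : V) (h h' : H) :
    ⟪h', coef P w v h⟫_ℂ = ⟪w ⊗ₜ[ℂ] h', P (h ⊗ₜ v)⟫_ℂ := by
  rw [coef_apply, inner_slice]

lemma inner_coef_left (P : H ⊗[ℂ] V →ₗ[ℂ] W ⊗[ℂ] H) (w : W) (v : V) (h h' : H) :
    ⟪P (h ⊗ₜ v), w ⊗ₜ[ℂ] h'⟫_ℂ = ⟪coef P w v h, h'⟫_ℂ := by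
  rw [← inner_conj_symm (coef P w v h), inner_coef]
  exact (inner_conj_symm (𝕜 := ℂ) (P (h ⊗ₜ v)) (w ⊗ₜ[ℂ] h')).symm

lemma apply_tmul_eq_sum (P : H ⊗[ℂ] V →ₗ[ℂ] W ⊗[ℂ] H) (h : H) (v : V) :
    P (h ⊗ₜ v) = ∑ i, onb W i ⊗ₜ[ℂ] coef P (onb W i) v h := by
  simp only [coef_apply, sum_tmul_slice]

/-- The map `H ⊗ V → W ⊗ H` with given matrix coefficients. -/
def ofCoef (c : W →ₗ⋆[ℂ] V →ₗ[ℂ] (H →ₗ[ℂ] H)) : H ⊗[ℂ] V →ₗ[ℂ] W ⊗[ℂ] H :=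
  ∑ i, TensorProduct.mk ℂ W H (onb W i) ∘ₗ TensorProduct.lift (c (onb W i)).flip

lemma sum_inner_smul_left {E : Type*} [AddCommMonoid E] [Module ℂ E] (c : W →ₗ⋆[ℂ] E) (w : W) :
    ∑ i, ⟪w, onb W i⟫_ℂ • c (onb W i) = c w := by
  conv_rhs => rw [← (onb W).sum_repr' w]
  simp

lemma sum_inner_smul_right {E : Type*} [AddCommMonoid E] [Module ℂ E] (c : V →ₗ[ℂ] E) (v : V) :
    ∑ i, ⟪onb V i, v⟫_ℂ • c (onb V i) = c v := by
  conv_rhs => rw [← (onb V).sum_repr' v]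
  simp

lemma coef_ofCoef (c : W →ₗ⋆[ℂ] V →ₗ[ℂ] (H →ₗ[ℂ] H)) : coef (ofCoef c) = c := by
  ext w v h
  simp only [coef_apply, ofCoef, LinearMap.sum_apply, LinearMap.comp_apply, map_sum,
    TensorProduct.lift.tmul, TensorProduct.mk_apply, slice_tmul, LinearMap.flip_apply]
  have := congrArg (fun f => f v h) (sum_inner_smul_left c w)
  simpa using this

lemma intertwines_iff (P : H ⊗[ℂ] V →ₗ[ℂ] W ⊗[ℂ] H) (Q : K ⊗[ℂ] V →ₗ[ℂ] W ⊗[ℂ] K)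
    (f : H →ₗ[ℂ] K) :
    Intertwines P Q f ↔ ∀ w v h, coef Q w v (f h) = f (coef P w v h) := by
  have hf : ∀ (w : W) (z : W ⊗[ℂ] H), slice w (f.lTensor W z) = f (slice w z) := by
    intro w z
    induction z using TensorProduct.induction_on with
    | zero => simp
    | tmul a b => simp
    | add x y hx hy => simp [hx, hy]
  constructor
  · intro h w v x
    have := congrArg (slice w) (LinearMap.congr_fun h (x ⊗ₜ v))
    simpa [coef_apply, hf] using this
  · intro h
    ext x v
    apply slice_ext
    intro w
    simpa [coef_apply, hf] using h w v x

/-- Resolving the identity on the middle wire `W` in an orthonormal basis turns composition into a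
matrix product whose entries are tensored instead of multiplied. -/
lemma coef_crossComp (Q : K ⊗[ℂ] W →ₗ[ℂ] U ⊗[ℂ] K) (P : H ⊗[ℂ] V →ₗ[ℂ] W ⊗[ℂ] H) (u : U) (v : V) :
    coef (crossComp Q P) u v = ∑ j, TensorProduct.map (coef Q u (onb W j)) (coef P (onb W j) v) := by
  ext k h
  simp only [TensorProduct.AlgebraTensorModule.curry_apply, TensorProduct.curry_apply,
    LinearMap.restrictScalars_self, coef_apply, crossComp, LinearMap.comp_apply,
    LinearEquiv.coe_coe, TensorProduct.assoc_tmul, LinearMap.lTensor_tmul, LinearMap.sum_apply,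
    TensorProduct.map_tmul]
  conv_lhs => rw [apply_tmul_eq_sum P]
  simp only [TensorProduct.tmul_sum, map_sum, TensorProduct.assoc_symm_tmul,
    LinearMap.rTensor_tmul]
  refine Finset.sum_congr rfl fun j _ => ?_
  rw [apply_tmul_eq_sum Q]
  simp only [TensorProduct.sum_tmul, map_sum, TensorProduct.assoc_tmul, slice_tmul,
    coef_apply]
  simp only [TensorProduct.smul_tmul', ← TensorProduct.sum_tmul]

/-- The antilinear *-isomorphism `End H → End H*` sending `A` to the transpose of `A†`. -/
def conjEnd : (H →ₗ[ℂ] H) →ₗ⋆[ℂ] (StrongDual ℂ H →ₗ[ℂ] StrongDual ℂ H) where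
  toFun A :=
    { toFun := fun f => f ∘L (LinearMap.adjoint A).toContinuousLinearMap
      map_add' := fun f g => by ext; simp
      map_smul' := fun c f => by ext; simp }
  map_add' A B := by ext; simp
  map_smul' c A := by ext; simp [map_smulₛₗ]

lemma conjEnd_apply (A : H →ₗ[ℂ] H) (f : StrongDual ℂ H) (h : H) :
    conjEnd A f h = f (LinearMap.adjoint A h) := rfl

lemma conjEnd_innerSL (A : H →ₗ[ℂ] H) (h : H) : conjEnd A (innerSL ℂ h) = innerSL ℂ (A h) := by
  ext x
  simp [conjEnd_apply, LinearMap.adjoint_inner_right]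

lemma exists_eq_innerSL (f : StrongDual ℂ H) : ∃ h : H, f = innerSL ℂ h := by
  have : CompleteSpace H := FiniteDimensional.complete ℂ H
  refine ⟨(InnerProductSpace.toDual ℂ H).symm f, ?_⟩
  ext x
  simp

lemma inner_innerSL (g h : H) :
    inner ℂ (innerSL ℂ g : StrongDual ℂ H) (innerSL ℂ h) = ⟪h, g⟫_ℂ := by
  have : CompleteSpace H := FiniteDimensional.complete ℂ H
  have : ∀ x : H, (InnerProductSpace.toDual ℂ H).symm (innerSL ℂ x) = x := fun x => by
    rw [LinearIsometryEquiv.symm_apply_eq]; rfl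
  change ⟪(InnerProductSpace.toDual ℂ H).symm (innerSL ℂ h),
    (InnerProductSpace.toDual ℂ H).symm (innerSL ℂ g)⟫_ℂ = _
  rw [this, this]

lemma conjEnd_mul (A B : H →ₗ[ℂ] H) : conjEnd (A * B) = conjEnd A * conjEnd B := by
  ext f x
  simp [conjEnd_apply, Module.End.mul_eq_comp, LinearMap.adjoint_comp]

lemma conjEnd_one : conjEnd (1 : H →ₗ[ℂ] H) = 1 := by
  ext f x
  simp [conjEnd_apply, Module.End.one_eq_id]

lemma conjEnd_adjoint (A : H →ₗ[ℂ] H) :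
    LinearMap.adjoint (conjEnd A) = conjEnd (LinearMap.adjoint A) := by
  symm
  rw [LinearMap.eq_adjoint_iff]
  intro f g
  obtain ⟨f, rfl⟩ := exists_eq_innerSL f
  obtain ⟨g, rfl⟩ := exists_eq_innerSL g
  rw [conjEnd_innerSL, conjEnd_innerSL, inner_innerSL, inner_innerSL, LinearMap.adjoint_inner_right]

/-- On a functional `⟪g, ·⟫`, evaluation against `P†` gives the pairing with `P (g ⊗ v)`, and the
cup of `H` then reassembles the vector `coef P w v g` inside the dual. -/
lemma coef_crossDual (P : H ⊗[ℂ] V →ₗ[ℂ] W ⊗[ℂ] H) (v : V) (w : W) :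
    coef (crossDual P) v w = conjEnd (coef P w v) := by
  have key : ∀ (g : H) (z : H ⊗[ℂ] V),
      ⟪v, dualCap V (innerSL ℂ g ⊗ₜ[ℂ] z)⟫_ℂ = ⟪g ⊗ₜ[ℂ] v, z⟫_ℂ := by
    intro g z
    induction z using TensorProduct.induction_on with
    | zero => simp
    | tmul a b => simp [dualCap, inner_smul_right]
    | add x y hx hy => simp [TensorProduct.tmul_add, inner_add_right, hx, hy]
  ext f x
  obtain ⟨g, rfl⟩ := exists_eq_innerSL f
  rw [conjEnd_innerSL, coef_apply]
  simp only [crossDual, dualCup, LinearMap.comp_apply, LinearMap.flip_apply,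
    TensorProduct.mk_apply, TensorProduct.tmul_sum, map_sum, LinearMap.sum_apply, LinearEquiv.coe_coe,
    TensorProduct.assoc_symm_tmul, LinearMap.rTensor_tmul, TensorProduct.assoc_tmul,
    LinearMap.lTensor_tmul, slice_tmul, key, LinearMap.adjoint_inner_right]
  rw [sum_apply]
  simp only [smul_apply, innerSL_apply_apply, smul_eq_mul]
  have : ∀ i, ⟪P (g ⊗ₜ[ℂ] v), w ⊗ₜ[ℂ] onb H i⟫_ℂ = ⟪coef P w v g, onb H i⟫_ℂ :=
    fun i => inner_coef_left P w v g _
  simp only [this]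
  exact (onb H).sum_inner_mul_inner _ _

end Coef

/-! ### The involution of a dagger Frobenius algebra -/

section Star

variable {A : Type*} [NormedAddCommGroup A] [InnerProductSpace ℂ A] [FiniteDimensional ℂ A]

/-- The involution of a dagger Frobenius algebra: `⟪x*, y⟫ = ⟪1, x y⟫`. -/
def frobStar (m : A ⊗[ℂ] A →ₗ[ℂ] A) (e : A) : A →ₗ⋆[ℂ] A where
  toFun x := LinearMap.adjoint (TensorProduct.curry m x) e
  map_add' x y := by simp
  map_smul' c x := by simp [map_smulₛₗ]

lemma inner_frobStar (m : A ⊗[ℂ] A →ₗ[ℂ] A) (e x y : A) :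
    ⟪frobStar m e x, y⟫_ℂ = ⟪e, m (x ⊗ₜ y)⟫_ℂ := by
  simp [frobStar, LinearMap.adjoint_inner_left]

lemma frobCap_tmul (m : A ⊗[ℂ] A →ₗ[ℂ] A) (e x y : A) :
    frobCap m e (x ⊗ₜ y) = ⟪frobStar m e x, y⟫_ℂ := by
  rw [inner_frobStar]; rfl

variable {m : A ⊗[ℂ] A →ₗ[ℂ] A} {e : A}

lemma inner_rTensor_mul (m : A ⊗[ℂ] A →ₗ[ℂ] A) (x z w : A) (q : A ⊗[ℂ] A) :
    ⟪z ⊗ₜ[ℂ] w, m.rTensor A ((TensorProduct.assoc ℂ A A A).symm (x ⊗ₜ q))⟫_ℂ =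
      ⟪LinearMap.adjoint (TensorProduct.curry m x) z ⊗ₜ[ℂ] w, q⟫_ℂ := by
  induction q using TensorProduct.induction_on with
  | zero => simp
  | tmul a b => simp [LinearMap.adjoint_inner_left]
  | add a b ha hb => simp only [TensorProduct.tmul_add, map_add, inner_add_right, ha, hb]

lemma inner_lTensor_mul (m : A ⊗[ℂ] A →ₗ[ℂ] A) (y z w : A) (q : A ⊗[ℂ] A) :
    ⟪z ⊗ₜ[ℂ] w, m.lTensor A (TensorProduct.assoc ℂ A A A (q ⊗ₜ y))⟫_ℂ =
      ⟪z ⊗ₜ[ℂ] LinearMap.adjoint ((TensorProduct.curry m).flip y) w, q⟫_ℂ := by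
  induction q using TensorProduct.induction_on with
  | zero => simp
  | tmul a b => simp [LinearMap.adjoint_inner_left]
  | add a b ha hb => simp only [TensorProduct.add_tmul, map_add, inner_add_right, ha, hb]

namespace IsDaggerFrobenius

/-- This is the first Frobenius law paired with `e ⊗ z`: the unit absorbs one leg on the right-hand
side, and on the left-hand side it turns multiplication by `x` into the vector `x*`. -/
lemma inner_mul_left (h : IsDaggerFrobenius m e) (x y z : A) :
    ⟪m (x ⊗ₜ y), z⟫_ℂ = ⟪y, m (frobStar m e x ⊗ₜ z)⟫_ℂ := by
  have h1 := congrArg (fun q => ⟪e ⊗ₜ[ℂ] z, q⟫_ℂ) (LinearMap.congr_fun h.frobenius_left (x ⊗ₜ y))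
  simp only [LinearMap.comp_apply, LinearMap.lTensor_tmul, LinearEquiv.coe_coe,
    inner_rTensor_mul, LinearMap.adjoint_inner_right, h.one_mul] at h1
  have h2 := congrArg (starRingEnd ℂ) h1
  rw [inner_conj_symm, inner_conj_symm] at h2
  exact h2.symm

lemma inner_mul_left' (h : IsDaggerFrobenius m e) (x y z : A) :
    ⟪z, m (x ⊗ₜ y)⟫_ℂ = ⟪m (frobStar m e x ⊗ₜ z), y⟫_ℂ := by
  rw [← inner_conj_symm, h.inner_mul_left, inner_conj_symm]

lemma frobStar_frobStar (h : IsDaggerFrobenius m e) (x : A) :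
    frobStar m e (frobStar m e x) = x := by
  refine ext_inner_right ℂ fun y => ?_
  rw [inner_frobStar, ← h.inner_mul_left, h.mul_one]

lemma inner_mul_one (h : IsDaggerFrobenius m e) (x y : A) :
    ⟪m (x ⊗ₜ y), e⟫_ℂ = ⟪y, frobStar m e x⟫_ℂ := by
  rw [h.inner_mul_left, h.mul_one]

/-- The second Frobenius law paired with `z ⊗ e` yields the vector representing `t ↦ ⟪e, t y⟫`;
symmetry is what identifies it with `y*`, defined through `⟪e, y t⟫`. -/
lemma inner_mul_right (h : IsDaggerFrobenius m e) (hs : IsSymm m e) (x y z : A) :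
    ⟪m (x ⊗ₜ y), z⟫_ℂ = ⟪x, m (z ⊗ₜ frobStar m e y)⟫_ℂ := by
  have h1 := congrArg (fun q => ⟪z ⊗ₜ[ℂ] e, q⟫_ℂ) (LinearMap.congr_fun h.frobenius_right (x ⊗ₜ y))
  have hy : LinearMap.adjoint ((TensorProduct.curry m).flip y) e = frobStar m e y := by
    refine ext_inner_right ℂ fun t => ?_
    rw [LinearMap.adjoint_inner_left, inner_frobStar]
    exact hs t y
  simp only [LinearMap.comp_apply, LinearMap.rTensor_tmul, LinearEquiv.coe_coe,
    inner_lTensor_mul, LinearMap.adjoint_inner_right, h.mul_one, hy] at h1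
  have h2 := congrArg (starRingEnd ℂ) h1
  rw [inner_conj_symm, inner_conj_symm] at h2
  exact h2.symm

lemma inner_frobStar_frobStar (h : IsDaggerFrobenius m e) (hs : IsSymm m e) (x y : A) :
    ⟪frobStar m e x, frobStar m e y⟫_ℂ = ⟪y, x⟫_ℂ := by
  rw [inner_frobStar]
  refine (hs _ _).trans ?_
  rw [frobCap_tmul, h.frobStar_frobStar]

lemma inner_one_mul_comm (hs : IsSymm m e) (x y : A) :
    ⟪e, m (x ⊗ₜ y)⟫_ℂ = ⟪e, m (y ⊗ₜ x)⟫_ℂ := hs x y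

/-- Converse of the two adjunction formulas: once the adjoints of left and right multiplications are
again multiplications, each Frobenius law reduces to associativity. The map `s` is not assumed to be
the involution `frobStar`. -/
lemma of_inner_mul (assoc : ∀ a b c : A, m (m (a ⊗ₜ b) ⊗ₜ c) = m (a ⊗ₜ m (b ⊗ₜ c)))
    (one_mul : ∀ a : A, m (e ⊗ₜ a) = a) (mul_one : ∀ a : A, m (a ⊗ₜ e) = a) (s : A → A)
    (hl : ∀ x y z, ⟪m (x ⊗ₜ y), z⟫_ℂ = ⟪y, m (s x ⊗ₜ z)⟫_ℂ)
    (hr : ∀ x y z, ⟪m (x ⊗ₜ y), z⟫_ℂ = ⟪x, m (z ⊗ₜ s y)⟫_ℂ) : IsDaggerFrobenius m e where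
  assoc := assoc
  one_mul := one_mul
  mul_one := mul_one
  frobenius_left := by
    ext x y
    refine TensorProduct.ext_iff_inner_left.2 fun z w => ?_
    have hx : ∀ z, LinearMap.adjoint (TensorProduct.curry m x) z = m (s x ⊗ₜ z) := fun z =>
      ext_inner_left ℂ fun t => by
        rw [LinearMap.adjoint_inner_right]; exact hl x t z
    simp only [TensorProduct.AlgebraTensorModule.curry_apply, TensorProduct.curry_apply,
      LinearMap.restrictScalars_self, LinearMap.comp_apply, LinearMap.lTensor_tmul,
      LinearEquiv.coe_coe, inner_rTensor_mul, LinearMap.adjoint_inner_right, hx, assoc]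
    rw [← inner_conj_symm, ← hl, inner_conj_symm]
  frobenius_right := by
    ext x y
    refine TensorProduct.ext_iff_inner_left.2 fun z w => ?_
    have hy : ∀ z, LinearMap.adjoint ((TensorProduct.curry m).flip y) z = m (z ⊗ₜ s y) := fun z =>
      ext_inner_left ℂ fun t => by
        rw [LinearMap.adjoint_inner_right]; exact hr t y z
    simp only [TensorProduct.AlgebraTensorModule.curry_apply, TensorProduct.curry_apply,
      LinearMap.restrictScalars_self, LinearMap.comp_apply, LinearMap.rTensor_tmul,
      LinearEquiv.coe_coe, inner_lTensor_mul, LinearMap.adjoint_inner_right, hy, ← assoc]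
    rw [← inner_conj_symm, ← hr, inner_conj_symm]

end IsDaggerFrobenius

end Star

/-! ### Relations between the coefficients of a multiplicative unital unitary -/

section Magic

variable {H : Type*} [NormedAddCommGroup H] [InnerProductSpace ℂ H] [FiniteDimensional ℂ H]
variable {V W : Type*} [NormedAddCommGroup V] [InnerProductSpace ℂ V] [FiniteDimensional ℂ V]
  [NormedAddCommGroup W] [InnerProductSpace ℂ W] [FiniteDimensional ℂ W]

lemma sum_comm_pairs {ι₁ ι₂ ι₃ ι₄ M : Type*} [Fintype ι₁] [Fintype ι₂] [Fintype ι₃] [Fintype ι₄]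
    [AddCommMonoid M] (f : ι₁ → ι₂ → ι₃ → ι₄ → M) :
    ∑ a, ∑ b, ∑ c, ∑ d, f a b c d = ∑ c, ∑ d, ∑ a, ∑ b, f a b c d := by
  calc _ = ∑ a, ∑ c, ∑ b, ∑ d, f a b c d := Finset.sum_congr rfl fun a _ => Finset.sum_comm
    _ = ∑ c, ∑ a, ∑ d, ∑ b, f a b c d := by
        rw [Finset.sum_comm]
        exact Finset.sum_congr rfl fun c _ => Finset.sum_congr rfl fun a _ => Finset.sum_comm
    _ = _ := Finset.sum_congr rfl fun c _ => Finset.sum_comm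

lemma sum_coef_left (c : W →ₗ⋆[ℂ] V →ₗ[ℂ] (H →ₗ[ℂ] H)) (w : W) (v : V) :
    ∑ i, ⟪w, onb W i⟫_ℂ • c (onb W i) v = c w v :=
  sum_inner_smul_left (c.flip v) w

lemma sum_coef_right (c : W →ₗ⋆[ℂ] V →ₗ[ℂ] (H →ₗ[ℂ] H)) (w : W) (v : V) :
    ∑ i, ⟪onb V i, v⟫_ℂ • c w (onb V i) = c w v :=
  sum_inner_smul_right (c w) v

/-- The coefficients `c` satisfy the relations of a multiplicative unital unitary
`H ⊗ V → W ⊗ H`. -/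
structure IsMagic (mV : V ⊗[ℂ] V →ₗ[ℂ] V) (eV : V) (mW : W ⊗[ℂ] W →ₗ[ℂ] W) (eW : W)
    (c : W →ₗ⋆[ℂ] V →ₗ[ℂ] (H →ₗ[ℂ] H)) : Prop where
  adjoint_mul_self : ∀ v v' : V,
    ∑ i, LinearMap.adjoint (c (onb W i) v) * c (onb W i) v' = ⟪v, v'⟫_ℂ • 1
  mul_adjoint_self : ∀ w w' : W,
    ∑ j, c w (onb V j) * LinearMap.adjoint (c w' (onb V j)) = ⟪w, w'⟫_ℂ • 1
  map_mul : ∀ (w : W) (x y : V), c w (mV (x ⊗ₜ y)) =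
    ∑ s, ∑ t, ⟪w, mW (onb W s ⊗ₜ onb W t)⟫_ℂ • (c (onb W t) y * c (onb W s) x)
  map_one : ∀ w : W, c w eV = ⟪w, eW⟫_ℂ • 1

lemma adjoint_mul (f g : H →ₗ[ℂ] H) :
    LinearMap.adjoint (f * g) = LinearMap.adjoint g * LinearMap.adjoint f :=
  LinearMap.adjoint_comp f g

lemma adjoint_one : LinearMap.adjoint (1 : H →ₗ[ℂ] H) = 1 := by
  rw [eq_comm, LinearMap.eq_adjoint_iff]; simp

lemma adjoint_smul (a : ℂ) (f : H →ₗ[ℂ] H) :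
    LinearMap.adjoint (a • f) = (starRingEnd ℂ) a • LinearMap.adjoint f :=
  map_smulₛₗ _ _ _

namespace IsMagic

variable {mV : V ⊗[ℂ] V →ₗ[ℂ] V} {eV : V} {mW : W ⊗[ℂ] W →ₗ[ℂ] W} {eW : W}
  {c : W →ₗ⋆[ℂ] V →ₗ[ℂ] (H →ₗ[ℂ] H)}

/-- The isometry relation for `eV` and `v` has a known column, since unitality makes `c w eV`
scalar; the remaining sum rebuilds `c eW v`. -/
lemma counit (h : IsMagic mV eV mW eW c) (v : V) : c eW v = ⟪eV, v⟫_ℂ • 1 := by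
  rw [← h.adjoint_mul_self, ← sum_coef_left]
  refine Finset.sum_congr rfl fun i _ => ?_
  rw [h.map_one, adjoint_smul, adjoint_one, inner_conj_symm, smul_mul_assoc, one_mul]

/-- Multiplicativity expands the first factor into products nested as `c(t) c(s) c(s)† c(t)†`, so
coisometry collapses the inner index `s` and then the outer index `t`. -/
lemma sum_mul_adjoint_adjoint (h : IsMagic mV eV mW eW c) (w w₁ w₂ : W) :
    ∑ s, ∑ t, c w (mV (onb V s ⊗ₜ onb V t)) *
      (LinearMap.adjoint (c w₁ (onb V s)) * LinearMap.adjoint (c w₂ (onb V t))) =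
        ⟪w, mW (w₁ ⊗ₜ w₂)⟫_ℂ • 1 := by
  have key : ∀ a b, ∑ s, ∑ t, (c (onb W b) (onb V t) * c (onb W a) (onb V s)) *
      (LinearMap.adjoint (c w₁ (onb V s)) * LinearMap.adjoint (c w₂ (onb V t))) =
        (⟪onb W a, w₁⟫_ℂ * ⟪onb W b, w₂⟫_ℂ) • (1 : H →ₗ[ℂ] H) := by
    intro a b
    rw [Finset.sum_comm]
    calc _ = ∑ t, c (onb W b) (onb V t) * (∑ s, c (onb W a) (onb V s) *
          LinearMap.adjoint (c w₁ (onb V s))) * LinearMap.adjoint (c w₂ (onb V t)) := by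
          simp only [Finset.mul_sum, Finset.sum_mul, mul_assoc]
      _ = _ := by
          simp only [h.mul_adjoint_self, mul_smul_comm, smul_mul_assoc, mul_one,
            ← Finset.smul_sum, smul_smul]
  calc _ = ∑ a, ∑ b, ⟪w, mW (onb W a ⊗ₜ onb W b)⟫_ℂ • ∑ s, ∑ t,
        (c (onb W b) (onb V t) * c (onb W a) (onb V s)) *
      (LinearMap.adjoint (c w₁ (onb V s)) * LinearMap.adjoint (c w₂ (onb V t))) := by
        simp only [h.map_mul, Finset.sum_mul, Finset.smul_sum, smul_mul_assoc]
        rw [sum_comm_pairs]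
    _ = _ := by
        simp only [key, smul_smul, ← Finset.sum_smul]
        congr 1
        conv_rhs => rw [← (onb W).sum_repr' w₁, ← (onb W).sum_repr' w₂]
        simp only [TensorProduct.sum_tmul, TensorProduct.tmul_sum, map_sum, inner_sum,
          ← TensorProduct.smul_tmul', TensorProduct.tmul_smul, map_smul, inner_smul_right, Finset.mul_sum]
        rw [Finset.sum_comm]
        refine Finset.sum_congr rfl fun a _ => Finset.sum_congr rfl fun b _ => ?_
        ring

/-- Comultiplicativity is the adjoint of multiplicativity, moved across with unitarity: multiplying
`sum_mul_adjoint_adjoint` by `c(eᵢ, x)†` and summing over `i` cancels the expanded factor, and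
taking adjoints gives the claim. -/
lemma comul (h : IsMagic mV eV mW eW c) (w₁ w₂ : W) (x : V) :
    c (mW (w₁ ⊗ₜ w₂)) x =
      ∑ s, ∑ t, ⟪mV (onb V s ⊗ₜ onb V t), x⟫_ℂ • (c w₂ (onb V t) * c w₁ (onb V s)) := by
  have h1 : ∑ s, ∑ t, ⟪x, mV (onb V s ⊗ₜ onb V t)⟫_ℂ •
      (LinearMap.adjoint (c w₁ (onb V s)) * LinearMap.adjoint (c w₂ (onb V t))) =
      ∑ i, ⟪onb W i, mW (w₁ ⊗ₜ w₂)⟫_ℂ • LinearMap.adjoint (c (onb W i) x) := by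
    calc (_ : H →ₗ[ℂ] H) = ∑ i, LinearMap.adjoint (c (onb W i) x) *
          (∑ s, ∑ t, c (onb W i) (mV (onb V s ⊗ₜ onb V t)) *
            (LinearMap.adjoint (c w₁ (onb V s)) * LinearMap.adjoint (c w₂ (onb V t))) :
              H →ₗ[ℂ] H) := by
          simp only [Finset.mul_sum]
          symm
          rw [Finset.sum_comm]
          refine Finset.sum_congr rfl fun s _ => ?_
          rw [Finset.sum_comm]
          refine Finset.sum_congr rfl fun t _ => ?_
          simp only [← mul_assoc, ← Finset.sum_mul]
          rw [h.adjoint_mul_self, smul_mul_assoc, smul_mul_assoc, one_mul]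
      _ = _ := by
          simp only [h.sum_mul_adjoint_adjoint, mul_smul_comm, mul_one]
  have h2 := congrArg LinearMap.adjoint h1
  simp only [map_sum, adjoint_smul, adjoint_mul, LinearMap.adjoint_adjoint, inner_conj_symm] at h2
  rw [h2, sum_coef_left]

/-- Multiplicativity read in the row `eW`, where the coefficients are scalar, says that the starred
coefficients form a left inverse of the matrix `c`. -/
lemma sum_star_mul (hW : IsDaggerFrobenius mW eW) (hV : IsDaggerFrobenius mV eV)
    (hs : IsSymm mV eV)
    (map_mul : ∀ (w : W) (x y : V), c w (mV (x ⊗ₜ y)) =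
      ∑ s, ∑ t, ⟪w, mW (onb W s ⊗ₜ onb W t)⟫_ℂ • (c (onb W t) y * c (onb W s) x))
    (counit : ∀ v, c eW v = ⟪eV, v⟫_ℂ • 1) (v v' : V) :
    ∑ s, c (frobStar mW eW (onb W s)) (frobStar mV eV v) * c (onb W s) v' = ⟪v, v'⟫_ℂ • 1 := by
  have h1 := map_mul eW v' (frobStar mV eV v)
  rw [counit, IsDaggerFrobenius.inner_one_mul_comm hs, ← inner_frobStar,
    hV.frobStar_frobStar] at h1
  rw [h1]
  refine Finset.sum_congr rfl fun s _ => ?_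
  simp only [← inner_frobStar, ← smul_mul_assoc, ← Finset.sum_mul]
  rw [sum_coef_left]

/-- The starred matrix is a left inverse of `c` by `sum_star_mul`, and `c` is unitary, so the left
inverse must be the adjoint. -/
lemma star (h : IsMagic mV eV mW eW c) (hW : IsDaggerFrobenius mW eW)
    (hV : IsDaggerFrobenius mV eV) (hs : IsSymm mV eV) (w : W) (v : V) :
    c (frobStar mW eW w) (frobStar mV eV v) = LinearMap.adjoint (c w v) := by
  have h1 := fun v' => sum_star_mul (c := c) hW hV hs h.map_mul h.counit v v'
  calc _ = ∑ s, ⟪onb W s, w⟫_ℂ • c (frobStar mW eW (onb W s)) (frobStar mV eV v) := by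
        conv_lhs => rw [← (onb W).sum_repr' w]
        simp
    _ = ∑ j, (∑ s, c (frobStar mW eW (onb W s)) (frobStar mV eV v) * c (onb W s) (onb V j)) *
          LinearMap.adjoint (c w (onb V j)) := by
        simp only [Finset.sum_mul]
        rw [Finset.sum_comm]
        simp only [mul_assoc, ← Finset.mul_sum, h.mul_adjoint_self, mul_smul_comm, mul_one]
    _ = _ := by
        simp only [h1, smul_mul_assoc, one_mul]
        rw [← sum_coef_right c w v]
        simp only [map_sum, adjoint_smul, inner_conj_symm]

end IsMagic

/-- Unitarity of `P` follows from multiplicativity, comultiplicativity and compatibility with the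
involutions. -/
lemma isMagic_of_star {mV : V ⊗[ℂ] V →ₗ[ℂ] V} {eV : V} {mW : W ⊗[ℂ] W →ₗ[ℂ] W} {eW : W}
    {c : W →ₗ⋆[ℂ] V →ₗ[ℂ] (H →ₗ[ℂ] H)} (hW : IsDaggerFrobenius mW eW) (hV : IsDaggerFrobenius mV eV)
    (hs : IsSymm mV eV)
    (map_mul : ∀ (w : W) (x y : V), c w (mV (x ⊗ₜ y)) =
      ∑ s, ∑ t, ⟪w, mW (onb W s ⊗ₜ onb W t)⟫_ℂ • (c (onb W t) y * c (onb W s) x))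
    (map_one : ∀ w : W, c w eV = ⟪w, eW⟫_ℂ • 1)
    (comul : ∀ w₁ w₂ x, c (mW (w₁ ⊗ₜ w₂)) x =
      ∑ s, ∑ t, ⟪mV (onb V s ⊗ₜ onb V t), x⟫_ℂ • (c w₂ (onb V t) * c w₁ (onb V s)))
    (counit : ∀ v, c eW v = ⟪eV, v⟫_ℂ • 1)
    (star : ∀ w v, c (frobStar mW eW w) (frobStar mV eV v) = LinearMap.adjoint (c w v)) :
    IsMagic mV eV mW eW c where
  adjoint_mul_self v v' := by
    rw [← IsMagic.sum_star_mul (c := c) hW hV hs map_mul counit]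
    simp only [star]
  mul_adjoint_self w w' := by
    -- Comultiplicativity in the column of the unit plays the role that multiplicativity in the row
    -- of the counit plays for the isometry relation.
    have h1 := comul (frobStar mW eW w') w eV
    rw [map_one, hW.inner_mul_one, hW.frobStar_frobStar] at h1
    rw [h1, Finset.sum_comm]
    refine Finset.sum_congr rfl fun t _ => ?_
    have h2 : ∀ s, ⟪mV (onb V s ⊗ₜ onb V t), eV⟫_ℂ = ⟪onb V s, frobStar mV eV (onb V t)⟫_ℂ := by
      intro s
      rw [← inner_conj_symm, IsDaggerFrobenius.inner_one_mul_comm hs, inner_conj_symm,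
        hV.inner_mul_one]
    simp only [h2, ← mul_smul_comm, ← Finset.mul_sum]
    rw [sum_coef_right, star]
  map_mul := map_mul
  map_one := map_one

end Magic

/-! ### The wire equations in terms of coefficients -/

section Wires

variable {H : Type*} [NormedAddCommGroup H] [InnerProductSpace ℂ H] [FiniteDimensional ℂ H]
variable {V W : Type*} [NormedAddCommGroup V] [InnerProductSpace ℂ V] [FiniteDimensional ℂ V]
  [NormedAddCommGroup W] [InnerProductSpace ℂ W] [FiniteDimensional ℂ W]

lemma sum_inner_smul_tmul (q : V ⊗[ℂ] W) :
    ∑ s, ∑ t, ⟪onb V s ⊗ₜ[ℂ] onb W t, q⟫_ℂ • (onb V s ⊗ₜ[ℂ] onb W t) = q := by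
  induction q using TensorProduct.induction_on with
  | zero => simp
  | tmul a b =>
    conv_rhs => rw [← (onb V).sum_repr' a, ← (onb W).sum_repr' b]
    simp only [TensorProduct.sum_tmul, TensorProduct.tmul_sum, ← TensorProduct.smul_tmul',
      TensorProduct.tmul_smul, TensorProduct.inner_tmul, smul_smul, Finset.smul_sum]
    rw [Finset.sum_comm]
    simp only [mul_comm]
  | add x y hx hy =>
    simp only [inner_add_right, add_smul, Finset.sum_add_distrib, hx, hy]

lemma slice_rTensor (f : W →ₗ[ℂ] V) (v : V) (z : W ⊗[ℂ] H) :
    slice v (f.rTensor H z) = slice (LinearMap.adjoint f v) z := by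
  induction z using TensorProduct.induction_on with
  | zero => simp
  | tmul a b => simp [LinearMap.adjoint_inner_left]
  | add x y hx hy => simp only [map_add, hx, hy]

lemma slice_crossTwo (P : H ⊗[ℂ] V →ₗ[ℂ] W ⊗[ℂ] H) (w₁ w₂ : W) (x y : V) (h : H) :
    slice (w₁ ⊗ₜ[ℂ] w₂) (crossTwo P (h ⊗ₜ (x ⊗ₜ y))) = coef P w₂ y (coef P w₁ x h) := by
  have h1 : ∀ z : W ⊗[ℂ] H, slice (w₁ ⊗ₜ[ℂ] w₂) ((TensorProduct.assoc ℂ W W H).symm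
      (P.lTensor W (TensorProduct.assoc ℂ W H V (z ⊗ₜ y)))) = coef P w₂ y (slice w₁ z) := by
    intro z
    induction z using TensorProduct.induction_on with
    | zero => simp
    | tmul a b =>
      simp only [TensorProduct.assoc_tmul, LinearMap.lTensor_tmul, slice_tmul, map_smul]
      rw [apply_tmul_eq_sum]
      simp only [TensorProduct.tmul_sum, map_sum, TensorProduct.assoc_symm_tmul, slice_tmul,
        TensorProduct.inner_tmul, mul_smul, ← Finset.smul_sum]
      congr 1
      have := congrArg (fun f => f b) (sum_coef_left (coef P) w₂ y)
      simpa using this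
    | add x y hx hy => simp only [TensorProduct.add_tmul, map_add, hx, hy]
  rw [coef_apply P w₁, ← h1]
  simp [crossTwo]

lemma slice_add_left (w w' : W) (z : W ⊗[ℂ] H) : slice (w + w') z = slice w z + slice w' z := by
  refine ext_inner_left ℂ fun h => ?_
  rw [inner_add_right, inner_slice, inner_slice, inner_slice, TensorProduct.add_tmul]
  exact inner_add_left (𝕜 := ℂ) (w ⊗ₜ[ℂ] h) (w' ⊗ₜ h) z

lemma slice_ext₂ {z z' : (W ⊗[ℂ] W) ⊗[ℂ] H}
    (h : ∀ w₁ w₂, slice (w₁ ⊗ₜ[ℂ] w₂) z = slice (w₁ ⊗ₜ w₂) z') : z = z' := by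
  refine slice_ext fun q => ?_
  induction q using TensorProduct.induction_on with
  | zero => simp [slice]
  | tmul a b => exact h a b
  | add x y hx hy => rw [slice_add_left, slice_add_left, hx, hy]

lemma crossTwo_apply (P : H ⊗[ℂ] V →ₗ[ℂ] W ⊗[ℂ] H) (x y : V) (h : H) :
    crossTwo P (h ⊗ₜ (x ⊗ₜ y)) = ∑ s, ∑ t, (onb W s ⊗ₜ[ℂ] onb W t) ⊗ₜ[ℂ]
      coef P (onb W t) y (coef P (onb W s) x h) := by
  refine slice_ext₂ fun w₁ w₂ => ?_
  rw [slice_crossTwo]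
  simp only [map_sum, slice_tmul, TensorProduct.inner_tmul]
  have h1 : ∀ h, ∑ t, ⟪w₂, onb W t⟫_ℂ • coef P (onb W t) y h = coef P w₂ y h := fun h => by
    have := congrArg (fun f => f h) (sum_coef_left (coef P) w₂ y)
    simpa using this
  have h2 : ∑ t, ⟪w₁, onb W t⟫_ℂ • coef P (onb W t) x h = coef P w₁ x h := by
    have := congrArg (fun f => f h) (sum_coef_left (coef P) w₁ x)
    simpa using this
  simp only [mul_smul, ← Finset.smul_sum, h1]
  rw [← h2, map_sum]
  simp

lemma mul_wire_iff (P : H ⊗[ℂ] V →ₗ[ℂ] W ⊗[ℂ] H) (mV : V ⊗[ℂ] V →ₗ[ℂ] V)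
    (mW : W ⊗[ℂ] W →ₗ[ℂ] W) :
    P ∘ₗ mV.lTensor H = mW.rTensor H ∘ₗ crossTwo P ↔
      ∀ (w : W) (x y : V), coef P w (mV (x ⊗ₜ y)) =
        ∑ s, ∑ t, ⟪w, mW (onb W s ⊗ₜ onb W t)⟫_ℂ •
          (coef P (onb W t) y * coef P (onb W s) x) := by
  have h1 : ∀ (w : W) (x y : V) (h : H), slice w (mW.rTensor H (crossTwo P (h ⊗ₜ (x ⊗ₜ y)))) =
      (∑ s, ∑ t, ⟪w, mW (onb W s ⊗ₜ onb W t)⟫_ℂ •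
          (coef P (onb W t) y * coef P (onb W s) x)) h := by
    intro w x y h
    simp [crossTwo_apply, LinearMap.sum_apply]
  constructor
  · intro h w x y
    ext k
    rw [← h1, coef_apply]
    exact congrArg (slice w) (LinearMap.congr_fun h (k ⊗ₜ (x ⊗ₜ y)))
  · intro h
    ext k x y
    refine slice_ext fun w => ?_
    have := congrArg (fun f => f k) (h w x y)
    simp only [← h1] at this
    exact this

lemma comul_wire_iff (P : H ⊗[ℂ] V →ₗ[ℂ] W ⊗[ℂ] H) (mV : V ⊗[ℂ] V →ₗ[ℂ] V)
    (mW : W ⊗[ℂ] W →ₗ[ℂ] W) :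
    (LinearMap.adjoint mW).rTensor H ∘ₗ P = crossTwo P ∘ₗ (LinearMap.adjoint mV).lTensor H ↔
      ∀ w₁ w₂ x, coef P (mW (w₁ ⊗ₜ w₂)) x =
        ∑ s, ∑ t, ⟪mV (onb V s ⊗ₜ onb V t), x⟫_ℂ •
          (coef P w₂ (onb V t) * coef P w₁ (onb V s)) := by
  have h1 : ∀ w₁ w₂ x h, slice (w₁ ⊗ₜ[ℂ] w₂) (crossTwo P (h ⊗ₜ LinearMap.adjoint mV x)) =
      (∑ s, ∑ t, ⟪mV (onb V s ⊗ₜ onb V t), x⟫_ℂ •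
          (coef P w₂ (onb V t) * coef P w₁ (onb V s))) h := by
    intro w₁ w₂ x h
    rw [← sum_inner_smul_tmul (LinearMap.adjoint mV x)]
    simp only [TensorProduct.tmul_sum, TensorProduct.tmul_smul, map_sum, map_smul, slice_crossTwo,
      LinearMap.adjoint_inner_right, LinearMap.sum_apply, LinearMap.smul_apply,
      Module.End.mul_apply]
  have h2 : ∀ w₁ w₂ z, slice (w₁ ⊗ₜ[ℂ] w₂) ((LinearMap.adjoint mW).rTensor H z) =
      slice (mW (w₁ ⊗ₜ w₂)) z := by
    intro w₁ w₂ z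
    rw [slice_rTensor, LinearMap.adjoint_adjoint]
  constructor
  · intro h w₁ w₂ x
    ext k
    rw [← h1, coef_apply, ← h2]
    exact congrArg (slice _) (LinearMap.congr_fun h (k ⊗ₜ x))
  · intro h
    ext k x
    refine slice_ext₂ fun w₁ w₂ => ?_
    have := congrArg (fun f => f k) (h w₁ w₂ x)
    simp only [← h1, coef_apply, ← h2] at this
    exact this

/-- The cup of `V` is `∑ t, eₜ* ⊗ eₜ` and the cap of `W` pairs with the starred vector, so rotating
`P` stars both indices of a coefficient, while `P†` takes the adjoint of each coefficient. -/
lemma adjoint_wire_iff (P : H ⊗[ℂ] V →ₗ[ℂ] W ⊗[ℂ] H) {mV : V ⊗[ℂ] V →ₗ[ℂ] V} {eV : V}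
    (mW : W ⊗[ℂ] W →ₗ[ℂ] W) (eW : W) (hV : IsDaggerFrobenius mV eV) (hs : IsSymm mV eV) :
    LinearMap.adjoint P = crossTranspose (frobCap mW eW) (frobCup mV eV) P ↔
      ∀ w v, coef P (frobStar mW eW w) (frobStar mV eV v) = LinearMap.adjoint (coef P w v) := by
  have h1 : ∀ (w : W) (z : W ⊗[ℂ] H), TensorProduct.lid ℂ H ((frobCap mW eW).rTensor H
      ((TensorProduct.assoc ℂ W W H).symm (w ⊗ₜ z))) = slice (frobStar mW eW w) z := by
    intro w z
    induction z using TensorProduct.induction_on with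
    | zero => simp
    | tmul a b => simp [frobCap_tmul]
    | add x y hx hy => simp only [TensorProduct.tmul_add, map_add, hx, hy]
  have h2 : ∀ (w : W) (h h' : H) (v : V),
      ⟪h' ⊗ₜ[ℂ] v, crossTranspose (frobCap mW eW) (frobCup mV eV) P (w ⊗ₜ h)⟫_ℂ =
        ⟪h', coef P (frobStar mW eW w) (frobStar mV eV v) h⟫_ℂ := by
    intro w h h' v
    have hcup : frobCup mV eV = ∑ t, frobStar mV eV (onb V t) ⊗ₜ[ℂ] onb V t := by
      rw [frobCup, ← sum_inner_smul_tmul (LinearMap.adjoint mV eV), Finset.sum_comm]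
      refine Finset.sum_congr rfl fun t _ => ?_
      have h2 : ∀ s, ⟪mV (onb V s ⊗ₜ onb V t), eV⟫_ℂ = ⟪onb V s, frobStar mV eV (onb V t)⟫_ℂ := by
        intro s
        rw [← inner_conj_symm, IsDaggerFrobenius.inner_one_mul_comm hs, inner_conj_symm,
          hV.inner_mul_one]
      simp only [LinearMap.adjoint_inner_right, h2, TensorProduct.smul_tmul',
        ← TensorProduct.sum_tmul]
      rw [(onb V).sum_repr']
    rw [hcup]
    simp only [crossTranspose, LinearMap.comp_apply, LinearMap.flip_apply, TensorProduct.mk_apply,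
      TensorProduct.tmul_sum, map_sum, LinearMap.sum_apply, LinearEquiv.coe_coe,
      TensorProduct.assoc_symm_tmul, LinearMap.rTensor_tmul, TensorProduct.assoc_tmul,
      LinearMap.lTensor_tmul, h1, ← coef_apply, inner_sum, TensorProduct.inner_tmul]
    conv_rhs => rw [← (onb V).sum_repr' v]
    simp [inner_sum, inner_smul_right, LinearMap.sum_apply, mul_comm]
  constructor
  · intro h w v
    ext k
    refine ext_inner_left ℂ fun k' => ?_
    rw [← h2, ← h, LinearMap.adjoint_inner_right, LinearMap.adjoint_inner_right, inner_coef_left]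
  · intro h
    refine TensorProduct.ext' fun w k => ?_
    refine TensorProduct.ext_iff_inner_left.2 fun k' v => ?_
    rw [h2, h, LinearMap.adjoint_inner_right, LinearMap.adjoint_inner_right, inner_coef_left]

end Wires

/-! ### Composites and duals of quantum isomorphisms -/

section QuantumIso

variable {Γ Γ' Γ'' : QuantumGraph.{u}} {H K : Type u} [NormedAddCommGroup H]
  [InnerProductSpace ℂ H] [FiniteDimensional ℂ H] [NormedAddCommGroup K]
  [InnerProductSpace ℂ K] [FiniteDimensional ℂ K]

lemma adj_wire_iff (P : H ⊗[ℂ] Γ.V →ₗ[ℂ] Γ'.V ⊗[ℂ] H) :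
    P ∘ₗ Γ.adj.lTensor H = Γ'.adj.rTensor H ∘ₗ P ↔
      ∀ w v, coef P w (Γ.adj v) = coef P (Γ'.adj w) v := by
  have h2 : ∀ w (z : Γ'.V ⊗[ℂ] H), slice w (Γ'.adj.rTensor H z) = slice (Γ'.adj w) z := by
    intro w z
    rw [slice_rTensor, Γ'.adj_selfAdjoint]
  constructor
  · intro h w v
    ext k
    rw [coef_apply, coef_apply, ← h2]
    exact congrArg (slice _) (LinearMap.congr_fun h (k ⊗ₜ v))
  · intro h
    refine TensorProduct.ext' fun k v => ?_
    refine slice_ext fun w => ?_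
    have := congrArg (fun f => f k) (h w v)
    simp only [coef_apply, ← h2] at this
    exact this

/-- The quantum isomorphisms are the multiplicative unital unitaries which intertwine the adjacency
matrices. -/
theorem isQuantumIso_iff (P : H ⊗[ℂ] Γ.V →ₗ[ℂ] Γ'.V ⊗[ℂ] H) :
    IsQuantumIso Γ Γ' P ↔ IsMagic Γ.mul Γ.one Γ'.mul Γ'.one (coef P) ∧
      ∀ w v, coef P w (Γ.adj v) = coef P (Γ'.adj w) v := by
  have hone : (∀ h : H, P (h ⊗ₜ Γ.one) = Γ'.one ⊗ₜ h) ↔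
      ∀ w : Γ'.V, coef P w Γ.one = ⟪w, Γ'.one⟫_ℂ • 1 := by
    constructor
    · intro h w
      ext k
      simp [coef_apply, h]
    · intro h k
      refine slice_ext fun w => ?_
      rw [← coef_apply, h]
      simp
  have hcounit : (TensorProduct.lid ℂ H).toLinearMap ∘ₗ (innerₛₗ ℂ Γ'.one).rTensor H ∘ₗ P =
      (TensorProduct.rid ℂ H).toLinearMap ∘ₗ (innerₛₗ ℂ Γ.one).lTensor H ↔
      ∀ v, coef P Γ'.one v = ⟪Γ.one, v⟫_ℂ • 1 := by
    constructor
    · intro h v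
      ext k
      have := LinearMap.congr_fun h (k ⊗ₜ v)
      simpa [coef_apply, slice] using this
    · intro h
      refine TensorProduct.ext' fun k v => ?_
      have := congrArg (fun f => f k) (h v)
      simpa [coef_apply, slice] using this
  constructor
  · intro h
    exact ⟨isMagic_of_star Γ'.frobenius Γ.frobenius Γ.symmetric ((mul_wire_iff _ _ _).1 h.mul)
      (hone.1 h.one) ((comul_wire_iff _ _ _).1 h.comul) (hcounit.1 h.counit)
      ((adjoint_wire_iff _ _ _ Γ.frobenius Γ.symmetric).1 h.adjoint_eq), (adj_wire_iff _).1 h.adj⟩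
  · rintro ⟨h, hadj⟩
    exact
      { comul := (comul_wire_iff _ _ _).2 h.comul
        counit := hcounit.2 h.counit
        adjoint_eq := (adjoint_wire_iff _ _ _ Γ.frobenius Γ.symmetric).2
          (h.star Γ'.frobenius Γ.frobenius Γ.symmetric)
        mul := (mul_wire_iff _ _ _).2 h.map_mul
        one := hone.2 h.map_one
        adj := (adj_wire_iff _).2 hadj }

theorem IsQuantumIso.isMagic {P : H ⊗[ℂ] Γ.V →ₗ[ℂ] Γ'.V ⊗[ℂ] H} (h : IsQuantumIso Γ Γ' P) :
    IsMagic Γ.mul Γ.one Γ'.mul Γ'.one (coef P) :=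
  ((isQuantumIso_iff P).1 h).1

theorem IsQuantumIso.coef_adj {P : H ⊗[ℂ] Γ.V →ₗ[ℂ] Γ'.V ⊗[ℂ] H} (h : IsQuantumIso Γ Γ' P)
    (w : Γ'.V) (v : Γ.V) : coef P w (Γ.adj v) = coef P (Γ'.adj w) v :=
  ((isQuantumIso_iff P).1 h).2 w v

theorem IsQuantumIso.coef_star {P : H ⊗[ℂ] Γ.V →ₗ[ℂ] Γ'.V ⊗[ℂ] H} (h : IsQuantumIso Γ Γ' P)
    (w : Γ'.V) (v : Γ.V) : coef P (frobStar Γ'.mul Γ'.one w) (frobStar Γ.mul Γ.one v) =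
      LinearMap.adjoint (coef P w v) :=
  h.isMagic.star Γ'.frobenius Γ.frobenius Γ.symmetric w v

lemma map_mul_map (A A' : K →ₗ[ℂ] K) (B B' : H →ₗ[ℂ] H) :
    TensorProduct.map A B * TensorProduct.map A' B' = TensorProduct.map (A * A') (B * B') :=
  (TensorProduct.map_mul _ _ _ _).symm

lemma map_sum_left {ι : Type*} (s : Finset ι) (A : ι → K →ₗ[ℂ] K) (B : H →ₗ[ℂ] H) :
    TensorProduct.map (∑ i ∈ s, A i) B = ∑ i ∈ s, TensorProduct.map (A i) B :=
  map_sum ((TensorProduct.mapBilinear (RingHom.id ℂ) K H K H).flip B) A s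

lemma map_sum_right {ι : Type*} (s : Finset ι) (A : K →ₗ[ℂ] K) (B : ι → H →ₗ[ℂ] H) :
    TensorProduct.map A (∑ i ∈ s, B i) = ∑ i ∈ s, TensorProduct.map A (B i) :=
  map_sum (TensorProduct.mapBilinear (RingHom.id ℂ) K H K H A) B s

lemma map_one_one : TensorProduct.map (1 : K →ₗ[ℂ] K) (1 : H →ₗ[ℂ] H) = 1 :=
  TensorProduct.map_id

/-- Each relation for the matrix product follows by collapsing the sums over one factor first, which
leaves the corresponding relation for the other factor. -/
theorem IsQuantumIso.crossComp {P : H ⊗[ℂ] Γ.V →ₗ[ℂ] Γ'.V ⊗[ℂ] H} (hP : IsQuantumIso Γ Γ' P)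
    {Q : K ⊗[ℂ] Γ'.V →ₗ[ℂ] Γ''.V ⊗[ℂ] K} (hQ : IsQuantumIso Γ' Γ'' Q) :
    IsQuantumIso Γ Γ'' (crossComp Q P) := by
  refine (isQuantumIso_iff _).2 ⟨⟨?_, ?_, ?_, ?_⟩, ?_⟩
  · intro v v'
    simp only [coef_crossComp, map_sum, TensorProduct.adjoint_map, Finset.sum_mul, Finset.mul_sum,
      map_mul_map]
    calc _ = ∑ j, ∑ k, TensorProduct.map
          (∑ i, LinearMap.adjoint (coef Q (onb Γ''.V i) (onb Γ'.V j)) *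
            coef Q (onb Γ''.V i) (onb Γ'.V k))
          (LinearMap.adjoint (coef P (onb Γ'.V j) v) * coef P (onb Γ'.V k) v') := by
          simp only [map_sum_left]
          rw [Finset.sum_comm]
          refine Eq.trans (Finset.sum_congr rfl fun k _ => ?_) Finset.sum_comm
          rw [Finset.sum_comm]
      _ = ∑ j, TensorProduct.map 1
          (LinearMap.adjoint (coef P (onb Γ'.V j) v) * coef P (onb Γ'.V j) v') := by
          refine Finset.sum_congr rfl fun j _ => ?_
          rw [Finset.sum_eq_single j]
          · rw [hQ.isMagic.adjoint_mul_self, OrthonormalBasis.inner_eq_one, one_smul]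
          · intro k _ hk
            rw [hQ.isMagic.adjoint_mul_self, OrthonormalBasis.inner_eq_zero _ hk.symm, zero_smul,
              TensorProduct.map_zero_left]
          · simp
      _ = _ := by
          rw [← map_sum_right, hP.isMagic.adjoint_mul_self, TensorProduct.map_smul_right,
            map_one_one]
  · intro w w'
    simp only [coef_crossComp, map_sum, TensorProduct.adjoint_map, Finset.sum_mul, Finset.mul_sum,
      map_mul_map]
    calc _ = ∑ j, ∑ k, TensorProduct.map
          (coef Q w (onb Γ'.V j) * LinearMap.adjoint (coef Q w' (onb Γ'.V k)))
          (∑ i, coef P (onb Γ'.V j) (onb Γ.V i) *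
            LinearMap.adjoint (coef P (onb Γ'.V k) (onb Γ.V i))) := by
          simp only [map_sum_right]
          rw [Finset.sum_comm]
          refine (Finset.sum_congr rfl fun k _ => Finset.sum_comm).trans Finset.sum_comm
      _ = ∑ j, TensorProduct.map
          (coef Q w (onb Γ'.V j) * LinearMap.adjoint (coef Q w' (onb Γ'.V j))) 1 := by
          refine Finset.sum_congr rfl fun j _ => ?_
          rw [Finset.sum_eq_single j]
          · rw [hP.isMagic.mul_adjoint_self, OrthonormalBasis.inner_eq_one, one_smul]
          · intro k _ hk
            rw [hP.isMagic.mul_adjoint_self, OrthonormalBasis.inner_eq_zero _ hk.symm, zero_smul,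
              TensorProduct.map_zero_right]
          · simp
      _ = _ := by
          rw [← map_sum_left, hQ.isMagic.mul_adjoint_self, TensorProduct.map_smul_left,
            map_one_one]
  · intro w x y
    simp only [coef_crossComp]
    calc _ = ∑ s, ∑ t, TensorProduct.map (coef Q w (Γ'.mul (onb Γ'.V s ⊗ₜ onb Γ'.V t)))
          (coef P (onb Γ'.V t) y * coef P (onb Γ'.V s) x) := by
          simp only [hP.isMagic.map_mul, map_sum_right, TensorProduct.map_smul_right]
          rw [Finset.sum_comm]
          refine Finset.sum_congr rfl fun s _ => ?_
          rw [Finset.sum_comm]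
          refine Finset.sum_congr rfl fun t _ => ?_
          simp only [← TensorProduct.map_smul_left, ← map_sum_left]
          rw [sum_coef_right]
      _ = _ := by
          simp only [hQ.isMagic.map_mul, map_sum_left, TensorProduct.map_smul_left,
            ← map_mul_map, Finset.mul_sum, Finset.sum_mul, Finset.smul_sum]
          rw [sum_comm_pairs]
  · intro w
    simp only [coef_crossComp, hP.isMagic.map_one, TensorProduct.map_smul_right]
    simp only [← TensorProduct.map_smul_left, ← map_sum_left]
    have : ∑ j, ⟪onb Γ'.V j, Γ'.one⟫_ℂ • coef Q w (onb Γ'.V j) = _ := sum_coef_right _ _ _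
    rw [this, hQ.isMagic.map_one, TensorProduct.map_smul_left, map_one_one]
  · intro w v
    simp only [coef_crossComp, hP.coef_adj, ← hQ.coef_adj]
    have h1 : ∀ j, coef P (Γ'.adj (onb Γ'.V j)) v =
        ∑ k, ⟪Γ'.adj (onb Γ'.V j), onb Γ'.V k⟫_ℂ • coef P (onb Γ'.V k) v :=
      fun j => (sum_coef_left _ _ _).symm
    have h2 : ∀ k, coef Q w (Γ'.adj (onb Γ'.V k)) =
        ∑ j, ⟪onb Γ'.V j, Γ'.adj (onb Γ'.V k)⟫_ℂ • coef Q w (onb Γ'.V j) :=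
      fun j => (sum_coef_right _ _ _).symm
    simp only [h1, h2, map_sum_left, map_sum_right, TensorProduct.map_smul_left,
      TensorProduct.map_smul_right]
    rw [Finset.sum_comm]
    refine Finset.sum_congr rfl fun k _ => Finset.sum_congr rfl fun j _ => ?_
    congr 1
    conv_rhs => rw [← Γ'.adj_selfAdjoint, LinearMap.adjoint_inner_right]

/-- The transposed unitarity relations, here and in `sum_mul_adjoint`, are what the dual needs. They
do not follow formally from unitarity: this one is comultiplicativity at the unit, rewritten with
the involution, and the other is multiplicativity at the counit. -/
lemma IsQuantumIso.sum_adjoint_mul {P : H ⊗[ℂ] Γ.V →ₗ[ℂ] Γ'.V ⊗[ℂ] H} (hP : IsQuantumIso Γ Γ' P)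
    (w w' : Γ'.V) :
    ∑ i, LinearMap.adjoint (coef P w (onb Γ.V i)) * coef P w' (onb Γ.V i) = ⟪w', w⟫_ℂ • 1 := by
  have h1 := hP.isMagic.comul w' (frobStar Γ'.mul Γ'.one w) Γ.one
  simp only [Γ.frobenius.inner_mul_one, ← smul_mul_assoc, ← Finset.sum_mul] at h1
  simp only [sum_coef_right, hP.coef_star] at h1
  rw [← h1, hP.isMagic.map_one, Γ'.frobenius.inner_mul_one,
    Γ'.frobenius.inner_frobStar_frobStar Γ'.symmetric]

lemma IsQuantumIso.sum_mul_adjoint {P : H ⊗[ℂ] Γ.V →ₗ[ℂ] Γ'.V ⊗[ℂ] H} (hP : IsQuantumIso Γ Γ' P)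
    (v v' : Γ.V) :
    ∑ i, coef P (onb Γ'.V i) v * LinearMap.adjoint (coef P (onb Γ'.V i) v') = ⟪v', v⟫_ℂ • 1 := by
  have h1 := hP.isMagic.map_mul Γ'.one (frobStar Γ.mul Γ.one v') v
  rw [Finset.sum_comm] at h1
  have h2 : ∀ s t, ⟪Γ'.one, Γ'.mul (onb Γ'.V s ⊗ₜ onb Γ'.V t)⟫_ℂ =
      ⟪frobStar Γ'.mul Γ'.one (onb Γ'.V t), onb Γ'.V s⟫_ℂ := fun s t => by
    rw [IsDaggerFrobenius.inner_one_mul_comm Γ'.symmetric, ← inner_frobStar]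
  simp only [h2] at h1
  simp only [← mul_smul_comm, ← Finset.mul_sum] at h1
  simp only [sum_coef_left, hP.coef_star] at h1
  rw [← h1, hP.isMagic.counit, ← inner_frobStar, Γ.frobenius.frobStar_frobStar]

/-- Dualising exchanges the two indices and applies `conjEnd`, which is antilinear but preserves the
order of products. Multiplicativity and unitality of the dual are therefore comultiplicativity and
counitality of `P`, and its unitarity is the transposed unitarity. -/
theorem IsQuantumIso.crossDual {P : H ⊗[ℂ] Γ.V →ₗ[ℂ] Γ'.V ⊗[ℂ] H} (hP : IsQuantumIso Γ Γ' P) :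
    IsQuantumIso Γ' Γ (crossDual P) := by
  refine (isQuantumIso_iff _).2 ⟨⟨?_, ?_, ?_, ?_⟩, ?_⟩
  · intro w w'
    simp only [coef_crossDual, conjEnd_adjoint, ← conjEnd_mul, ← map_sum, hP.sum_adjoint_mul,
      map_smulₛₗ, conjEnd_one, inner_conj_symm]
  · intro v v'
    simp only [coef_crossDual, conjEnd_adjoint, ← conjEnd_mul, ← map_sum, hP.sum_mul_adjoint,
      map_smulₛₗ, conjEnd_one, inner_conj_symm]
  · intro v x y
    simp only [coef_crossDual, hP.isMagic.comul, map_sum, map_smulₛₗ, conjEnd_mul, inner_conj_symm]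
  · intro v
    simp only [coef_crossDual, hP.isMagic.counit, map_smulₛₗ, conjEnd_one, inner_conj_symm]
  · intro w v
    simp only [coef_crossDual, hP.coef_adj]

end QuantumIso

/-! ### `*`-isomorphisms as multiplicative unital unitaries -/

section StarIso

variable {A B C : Type*} [NormedAddCommGroup A] [InnerProductSpace ℂ A] [FiniteDimensional ℂ A]
  [NormedAddCommGroup B] [InnerProductSpace ℂ B] [FiniteDimensional ℂ B]
  [NormedAddCommGroup C] [InnerProductSpace ℂ C] [FiniteDimensional ℂ C]
variable {mA : A ⊗[ℂ] A →ₗ[ℂ] A} {eA : A} {mB : B ⊗[ℂ] B →ₗ[ℂ] B} {eB : B}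

lemma IsDaggerFrobenius.frobCup_eq_sum (hA : IsDaggerFrobenius mA eA) :
    frobCup mA eA = ∑ s, onb A s ⊗ₜ[ℂ] frobStar mA eA (onb A s) := by
  rw [frobCup, ← sum_inner_smul_tmul (LinearMap.adjoint mA eA)]
  refine Finset.sum_congr rfl fun s _ => ?_
  simp only [LinearMap.adjoint_inner_right, hA.inner_mul_one, ← TensorProduct.tmul_smul,
    ← TensorProduct.tmul_sum]
  rw [(onb A).sum_repr']

lemma inner_frobTranspose (hA : IsDaggerFrobenius mA eA) (f : A →ₗ[ℂ] B) (a : A) (b : B) :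
    ⟪a, frobTranspose mA eA mB eB f b⟫_ℂ = ⟪frobStar mB eB (f (frobStar mA eA a)), b⟫_ℂ := by
  simp only [frobTranspose, hA.frobCup_eq_sum, map_sum, LinearMap.comp_apply,
    TensorProduct.mk_apply, LinearMap.sum_apply, LinearEquiv.coe_coe, TensorProduct.assoc_tmul,
    LinearMap.lTensor_tmul, LinearMap.rTensor_tmul, TensorProduct.rid_tmul, frobCap_tmul,
    inner_sum, inner_smul_right]
  conv_rhs => rw [← (onb A).sum_repr' a]
  simp [sum_inner, inner_smul_left, mul_comm]

/-- The cup and the cap used in the rotation each insert one involution, so the rotation is the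
adjoint of `a ↦ (f (a*))*`. -/
lemma adjoint_eq_frobTranspose_iff (hA : IsDaggerFrobenius mA eA) (hB : IsDaggerFrobenius mB eB)
    (f : A →ₗ[ℂ] B) : LinearMap.adjoint f = frobTranspose mA eA mB eB f ↔
      ∀ a, f (frobStar mA eA a) = frobStar mB eB (f a) := by
  constructor
  · intro h a
    rw [← hB.frobStar_frobStar (f (frobStar mA eA a))]
    congr 1
    refine ext_inner_right ℂ fun b => ?_
    rw [← inner_frobTranspose hA, ← h, LinearMap.adjoint_inner_right]
  · intro h
    ext b
    refine ext_inner_left ℂ fun a => ?_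
    rw [inner_frobTranspose hA, h, hB.frobStar_frobStar, LinearMap.adjoint_inner_right]

/-- A `*`-isomorphism is the same as a multiplicative unital unitary. -/
theorem isStarIso_iff (hA : IsDaggerFrobenius mA eA) (hB : IsDaggerFrobenius mB eB)
    (f : A →ₗ[ℂ] B) : IsStarIso mA eA mB eB f ↔
      (∀ a a', ⟪f a, f a'⟫_ℂ = ⟪a, a'⟫_ℂ) ∧ Function.Surjective f ∧
        (∀ a b : A, f (mA (a ⊗ₜ b)) = mB (f a ⊗ₜ f b)) ∧ f eA = eB := by
  constructor
  · rintro ⟨⟨hm, h1, ha⟩, ⟨hc, hc1, -⟩⟩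
    have hstar := (adjoint_eq_frobTranspose_iff hA hB f).1 ha
    refine ⟨fun a a' => ?_, ?_, hm, h1⟩
    -- Preservation of the counit on `a* a'` is preservation of `⟪a, a'⟫`.
    · have := hc1 (mA (frobStar mA eA a ⊗ₜ a'))
      rwa [hm, hstar, ← inner_frobStar, ← inner_frobStar, hB.frobStar_frobStar,
        hA.frobStar_frobStar] at this
    · rw [← LinearMap.range_eq_top, ← Submodule.orthogonal_eq_bot_iff, LinearMap.orthogonal_range,
        LinearMap.ker_eq_bot']
      intro b hb
      -- The adjoint of comultiplicativity makes `f†` multiplicative, so `f† b = 0` forces `f† (b*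
      -- b) = 0`; pairing with the unit gives `⟪b, b⟫ = 0`.
      have h2 := LinearMap.congr_fun (congrArg LinearMap.adjoint hc) (frobStar mB eB b ⊗ₜ b)
      rw [LinearMap.adjoint_comp, LinearMap.adjoint_comp, LinearMap.adjoint_adjoint,
        LinearMap.adjoint_adjoint, TensorProduct.adjoint_map, LinearMap.comp_apply,
        LinearMap.comp_apply, TensorProduct.map_tmul, hb, TensorProduct.tmul_zero, map_zero] at h2
      have h3 : ⟪frobStar mB eB (frobStar mB eB b), b⟫_ℂ = 0 := by
        rw [inner_frobStar]
        conv_lhs => rw [← h1]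
        rw [← LinearMap.adjoint_inner_right, h1, h2, inner_zero_right]
      rwa [hB.frobStar_frobStar, inner_self_eq_zero] at h3
  · rintro ⟨hi, hsurj, hm, h1⟩
    have hstar : ∀ a, f (frobStar mA eA a) = frobStar mB eB (f a) := by
      intro a
      refine ext_inner_right ℂ fun b => ?_
      obtain ⟨b, rfl⟩ := hsurj b
      rw [hi, inner_frobStar, inner_frobStar, ← h1, ← hm, hi]
    have ha := (adjoint_eq_frobTranspose_iff hA hB f).2 hstar
    refine ⟨⟨hm, h1, ha⟩, ⟨?_, fun a => by rw [← h1, hi], ha⟩⟩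
    ext a
    refine TensorProduct.ext_iff_inner_left.2 fun b b' => ?_
    obtain ⟨b, rfl⟩ := hsurj b
    obtain ⟨b', rfl⟩ := hsurj b'
    simp only [LinearMap.comp_apply]
    rw [LinearMap.adjoint_inner_right, ← hm, hi, ← LinearMap.adjoint_inner_right]
    generalize LinearMap.adjoint mA a = q
    induction q using TensorProduct.induction_on with
    | zero => simp
    | tmul x y => simp [hi]
    | add x y hx hy => simp only [map_add, inner_add_right, hx, hy]

end StarIso

/-! ### Endomorphism algebras as matrix algebras -/

section Rep

variable {H K L : Type*} [NormedAddCommGroup H] [InnerProductSpace ℂ H] [FiniteDimensional ℂ H]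
  [NormedAddCommGroup K] [InnerProductSpace ℂ K] [FiniteDimensional ℂ K]
  [NormedAddCommGroup L] [InnerProductSpace ℂ L] [FiniteDimensional ℂ L]

/-- The identification `H ⊗ K* ≅ Hom(K, H)`. -/
def homEquiv (H K : Type*) [NormedAddCommGroup H] [InnerProductSpace ℂ H] [FiniteDimensional ℂ H]
    [NormedAddCommGroup K] [InnerProductSpace ℂ K] [FiniteDimensional ℂ K] :
    H ⊗[ℂ] StrongDual ℂ K ≃ₗ[ℂ] (K →ₗ[ℂ] H) :=
  LinearEquiv.ofLinear
    (TensorProduct.lift (LinearMap.mk₂ ℂ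
      (fun (x : H) (f : StrongDual ℂ K) => (f : K →ₗ[ℂ] ℂ).smulRight x)
      (fun x y f => by ext; simp) (fun c x f => by ext k; exact smul_comm _ _ _)
      (fun x f g => by ext; simp [add_smul]) (fun c x f => by ext; simp [mul_smul])))
    (∑ i, (TensorProduct.mk ℂ H (StrongDual ℂ K)).flip (innerSL ℂ (onb K i)) ∘ₗ
      LinearMap.applyₗ (onb K i))
    (by
      ext S k
      simp only [LinearMap.comp_apply, LinearMap.sum_apply, map_sum, LinearMap.flip_apply,
        TensorProduct.mk_apply, LinearMap.applyₗ_apply_apply, TensorProduct.lift.tmul,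
        LinearMap.mk₂_apply, LinearMap.smulRight_apply, LinearMap.id_apply]
      conv_rhs => rw [← (onb K).sum_repr' k]
      simp)
    (by
      refine TensorProduct.ext' fun x f => ?_
      obtain ⟨k, rfl⟩ := exists_eq_innerSL f
      simp only [LinearMap.comp_apply, LinearMap.sum_apply, map_sum, LinearMap.flip_apply,
        TensorProduct.mk_apply, LinearMap.applyₗ_apply_apply, TensorProduct.lift.tmul,
        LinearMap.mk₂_apply, LinearMap.smulRight_apply, LinearMap.id_apply,
        ContinuousLinearMap.coe_coe, innerSL_apply_apply]
      rw [Finset.sum_congr rfl fun i _ => TensorProduct.smul_tmul _ _ _, ← TensorProduct.tmul_sum]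
      congr 1
      conv_rhs => rw [← (onb K).sum_repr' k]
      simp only [map_sum, map_smulₛₗ, inner_conj_symm])

@[simp] lemma homEquiv_tmul (x : H) (f : StrongDual ℂ K) (k : K) :
    homEquiv H K (x ⊗ₜ f) k = f k • x := rfl

lemma inner_eq_trace (a b : H ⊗[ℂ] StrongDual ℂ K) :
    ⟪a, b⟫_ℂ = LinearMap.trace ℂ K (LinearMap.adjoint (homEquiv H K a) ∘ₗ homEquiv H K b) := by
  rw [LinearMap.trace_eq_sum_inner _ (onb K)]
  simp only [LinearMap.comp_apply, LinearMap.adjoint_inner_right]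
  induction a using TensorProduct.induction_on with
  | zero => exact (inner_zero_left (𝕜 := ℂ) b).trans (by simp)
  | add x y hx hy =>
    simp only [map_add, LinearMap.add_apply, inner_add_left, Finset.sum_add_distrib, ← hx, ← hy]
    exact inner_add_left (𝕜 := ℂ) x y b
  | tmul x f =>
    induction b using TensorProduct.induction_on with
    | zero => exact (inner_zero_right (𝕜 := ℂ) (x ⊗ₜ[ℂ] f)).trans (by simp)
    | add y z hx hy =>
      simp only [map_add, LinearMap.add_apply, inner_add_right, Finset.sum_add_distrib, ← hx, ← hy]
      exact inner_add_right (𝕜 := ℂ) (x ⊗ₜ[ℂ] f) y z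
    | tmul y g =>
      obtain ⟨k, rfl⟩ := exists_eq_innerSL f
      obtain ⟨l, rfl⟩ := exists_eq_innerSL g
      simp only [TensorProduct.inner_tmul, inner_innerSL, homEquiv_tmul, innerSL_apply_apply,
        inner_smul_left, inner_smul_right, inner_conj_symm]
      rw [← (onb K).sum_inner_mul_inner l k, Finset.mul_sum]
      refine Finset.sum_congr rfl fun i _ => ?_
      ring

lemma homEquiv_map (A : H →ₗ[ℂ] H) (B : K →ₗ[ℂ] K) (a : H ⊗[ℂ] StrongDual ℂ K) :
    homEquiv H K (TensorProduct.map A (conjEnd B) a) =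
      A ∘ₗ homEquiv H K a ∘ₗ LinearMap.adjoint B := by
  induction a using TensorProduct.induction_on with
  | zero => simp
  | add x y hx hy => simp only [map_add, hx, hy, LinearMap.add_comp, LinearMap.comp_add]
  | tmul x f => ext k; simp [conjEnd_apply]

lemma homEquiv_endMul (a b : H ⊗[ℂ] StrongDual ℂ H) :
    homEquiv H H (endMul H (a ⊗ₜ b)) = ((Real.sqrt (Module.finrank ℂ H) : ℝ) : ℂ)⁻¹ •
      (homEquiv H H a * homEquiv H H b) := by
  induction a using TensorProduct.induction_on with
  | zero => simp
  | add x y hx hy => simp only [TensorProduct.add_tmul, map_add, hx, hy, add_mul, smul_add]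
  | tmul x f =>
    induction b using TensorProduct.induction_on with
    | zero => simp
    | add x y hx hy => simp only [TensorProduct.tmul_add, map_add, hx, hy, mul_add, smul_add]
    | tmul y g =>
      ext k
      simp only [endMul, dualCap, LinearMap.smul_apply, LinearMap.comp_apply, LinearEquiv.coe_coe,
        TensorProduct.assoc_tmul, LinearMap.lTensor_tmul, TensorProduct.assoc_symm_tmul,
        LinearMap.rTensor_tmul, TensorProduct.lift.tmul, TensorProduct.lid_tmul, map_smul,
        homEquiv_tmul, TensorProduct.tmul_smul, Module.End.mul_apply, smul_smul]
      congr 1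
      simp only [RingHom.id_apply, ContinuousLinearMap.coeLM_apply, ContinuousLinearMap.coe_coe]
      ring

lemma homEquiv_endOne : homEquiv H H (endOne H) =
    ((Real.sqrt (Module.finrank ℂ H) : ℝ) : ℂ) • 1 := by
  ext k
  simp only [endOne, dualCup, map_smul, map_sum, LinearMap.smul_apply, LinearMap.sum_apply,
    homEquiv_tmul, innerSL_apply_apply, Module.End.one_apply]
  rw [(onb H).sum_repr']

variable {A : Type*} [NormedAddCommGroup A] [InnerProductSpace ℂ A] [FiniteDimensional ℂ A]

/-- `L : A ≃ End K` is an isomorphism of algebras under which the inner product of `A` becomes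
`dim K` times the trace inner product. -/
structure IsMatrixRep (m : A ⊗[ℂ] A →ₗ[ℂ] A) (e : A) (L : A ≃ₗ[ℂ] (K →ₗ[ℂ] K)) : Prop where
  map_mul : ∀ a b, L (m (a ⊗ₜ b)) = L a * L b
  map_one : L e = 1
  inner_eq : ∀ a b, ⟪a, b⟫_ℂ =
    Module.finrank ℂ K * LinearMap.trace ℂ K (LinearMap.adjoint (L a) * L b)

namespace IsMatrixRep

variable {m : A ⊗[ℂ] A →ₗ[ℂ] A} {e : A} {L : A ≃ₗ[ℂ] (K →ₗ[ℂ] K)}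

lemma map_frobStar (h : IsMatrixRep m e L) (a : A) :
    L (frobStar m e a) = LinearMap.adjoint (L a) := by
  rw [← L.apply_symm_apply (LinearMap.adjoint (L a))]
  congr 1
  refine ext_inner_right ℂ fun y => ?_
  rw [inner_frobStar, h.inner_eq, h.inner_eq, h.map_one, h.map_mul, adjoint_one, one_mul,
    L.apply_symm_apply, LinearMap.adjoint_adjoint]

lemma isDaggerFrobenius (h : IsMatrixRep m e L) : IsDaggerFrobenius m e := by
  refine IsDaggerFrobenius.of_inner_mul ?_ ?_ ?_ (fun a => L.symm (LinearMap.adjoint (L a))) ?_ ?_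
  · intro a b c
    apply L.injective
    simp only [h.map_mul, mul_assoc]
  · intro a
    apply L.injective
    simp only [h.map_mul, h.map_one, one_mul]
  · intro a
    apply L.injective
    simp only [h.map_mul, h.map_one, mul_one]
  · intro x y z
    simp only [h.inner_eq, h.map_mul, L.apply_symm_apply, adjoint_mul, mul_assoc]
  · intro x y z
    simp only [h.inner_eq, h.map_mul, L.apply_symm_apply, adjoint_mul]
    rw [mul_assoc (LinearMap.adjoint (L y)), LinearMap.trace_mul_comm, mul_assoc]

lemma isSymm (h : IsMatrixRep m e L) : IsSymm m e := by
  intro a b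
  rw [frobCap_tmul, frobCap_tmul, h.inner_eq, h.inner_eq, h.map_frobStar, h.map_frobStar,
    LinearMap.adjoint_adjoint, LinearMap.adjoint_adjoint, LinearMap.trace_mul_comm]

/-- Parseval in `A`: each trace is an inner product divided by `dim K`, and converting the resulting
inner product back to a trace restores one of the two factors. This is the trace form of the cup of
`A`. -/
lemma sum_trace_mul_trace (h : IsMatrixRep m e L) [Nontrivial K] (S R : K →ₗ[ℂ] K) :
    ∑ s, LinearMap.trace ℂ K (S * L (onb A s)) *
      LinearMap.trace ℂ K (R * L (frobStar m e (onb A s))) =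
        (Module.finrank ℂ K : ℂ)⁻¹ * LinearMap.trace ℂ K (S * R) := by
  have hn : (Module.finrank ℂ K : ℂ) ≠ 0 := Nat.cast_ne_zero.2 Module.finrank_pos.ne'
  have h1 : ∀ b, LinearMap.trace ℂ K (S * L b) =
      (Module.finrank ℂ K : ℂ)⁻¹ * ⟪L.symm (LinearMap.adjoint S), b⟫_ℂ := fun b => by
    rw [h.inner_eq, L.apply_symm_apply, LinearMap.adjoint_adjoint, inv_mul_cancel_left₀ hn]
  have h2 : ∀ b, LinearMap.trace ℂ K (R * L (frobStar m e b)) =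
      (Module.finrank ℂ K : ℂ)⁻¹ * ⟪b, L.symm R⟫_ℂ := fun b => by
    rw [h.inner_eq, L.apply_symm_apply, inv_mul_cancel_left₀ hn, h.map_frobStar,
      LinearMap.trace_mul_comm]
  calc _ = (Module.finrank ℂ K : ℂ)⁻¹ * (Module.finrank ℂ K : ℂ)⁻¹ *
        ∑ s, ⟪L.symm (LinearMap.adjoint S), onb A s⟫_ℂ * ⟪onb A s, L.symm R⟫_ℂ := by
        rw [Finset.mul_sum]
        refine Finset.sum_congr rfl fun s _ => ?_
        rw [h1, h2]
        ring
    _ = _ := by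
        rw [(onb A).sum_inner_mul_inner, h.inner_eq, L.apply_symm_apply, L.apply_symm_apply,
          LinearMap.adjoint_adjoint, mul_assoc, inv_mul_cancel_left₀ hn]

end IsMatrixRep

/-- The endomorphism algebra on `K ⊗ K*` as a matrix algebra. -/
def endRep (K : Type*) [NormedAddCommGroup K] [InnerProductSpace ℂ K] [FiniteDimensional ℂ K]
    [Nontrivial K] : K ⊗[ℂ] StrongDual ℂ K ≃ₗ[ℂ] (K →ₗ[ℂ] K) :=
  (homEquiv K K).trans (LinearEquiv.smulOfNeZero ℂ _
    (((Real.sqrt (Module.finrank ℂ K) : ℝ) : ℂ)⁻¹)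
    (inv_ne_zero (Complex.ofReal_ne_zero.2
      (Real.sqrt_pos.2 (Nat.cast_pos.2 Module.finrank_pos)).ne')))

lemma endRep_apply [Nontrivial K] (a : K ⊗[ℂ] StrongDual ℂ K) :
    endRep K a = (((Real.sqrt (Module.finrank ℂ K) : ℝ) : ℂ)⁻¹) • homEquiv K K a := rfl

lemma sqrt_finrank_ne_zero [Nontrivial K] : ((Real.sqrt (Module.finrank ℂ K) : ℝ) : ℂ) ≠ 0 :=
  Complex.ofReal_ne_zero.2 (Real.sqrt_pos.2 (Nat.cast_pos.2 Module.finrank_pos)).ne'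

lemma sqrt_finrank_mul_self : ((Real.sqrt (Module.finrank ℂ K) : ℝ) : ℂ) *
    ((Real.sqrt (Module.finrank ℂ K) : ℝ) : ℂ) = Module.finrank ℂ K := by
  rw [← Complex.ofReal_mul, Real.mul_self_sqrt (Nat.cast_nonneg _)]
  simp

lemma isMatrixRep_endRep [Nontrivial K] : IsMatrixRep (endMul K) (endOne K) (endRep K) where
  map_mul a b := by
    simp only [endRep_apply, homEquiv_endMul, smul_mul_smul_comm, smul_smul]
  map_one := by
    rw [endRep_apply, homEquiv_endOne, smul_smul, inv_mul_cancel₀ sqrt_finrank_ne_zero, one_smul]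
  inner_eq a b := by
    rw [inner_eq_trace, endRep_apply, endRep_apply, adjoint_smul, smul_mul_smul_comm, map_smul,
      ← sqrt_finrank_mul_self (K := K)]
    have : (starRingEnd ℂ) ((Real.sqrt (Module.finrank ℂ K) : ℝ) : ℂ)⁻¹ =
        ((Real.sqrt (Module.finrank ℂ K) : ℝ) : ℂ)⁻¹ := by
      rw [← Complex.ofReal_inv, Complex.conj_ofReal]
    have h0 := sqrt_finrank_ne_zero (K := K)
    rw [this, smul_eq_mul, Module.End.mul_eq_comp]
    field_simp

/-- Replaces the `*`-isomorphism in the definition of simplicity by an identification with `End K`,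
in which products and adjoints are those of operators. -/
lemma isStarIso_endMul_iff [Nontrivial K] {m : A ⊗[ℂ] A →ₗ[ℂ] A} {e : A}
    (hm : IsDaggerFrobenius m e) (f : A →ₗ[ℂ] K ⊗[ℂ] StrongDual ℂ K) :
    IsStarIso m e (endMul K) (endOne K) f ↔
      ∃ L : A ≃ₗ[ℂ] (K →ₗ[ℂ] K), IsMatrixRep m e L ∧ ∀ a, endRep K (f a) = L a := by
  have hK := isMatrixRep_endRep (K := K)
  rw [isStarIso_iff hm hK.isDaggerFrobenius]
  constructor
  · rintro ⟨hi, hsurj, hmul, hone⟩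
    have hinj : Function.Injective f := by
      rw [← LinearMap.ker_eq_bot, LinearMap.ker_eq_bot']
      intro a ha
      rw [← inner_self_eq_zero (𝕜 := ℂ), ← hi, ha]
      exact inner_zero_left (𝕜 := ℂ) (0 : K ⊗[ℂ] StrongDual ℂ K)
    refine ⟨(LinearEquiv.ofBijective f ⟨hinj, hsurj⟩).trans (endRep K), ⟨?_, ?_, ?_⟩, fun a => rfl⟩
    · intro a b
      exact (congrArg (endRep K) (hmul a b)).trans (hK.map_mul _ _)
    · exact (congrArg (endRep K) hone).trans hK.map_one
    · intro a b
      exact (hi a b).symm.trans (hK.inner_eq _ _)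
  · rintro ⟨L, hL, hf⟩
    refine ⟨fun a b => by rw [hK.inner_eq, hf, hf, ← hL.inner_eq], fun b => ?_, fun a b => ?_, ?_⟩
    · refine ⟨L.symm (endRep K b), (endRep K).injective ?_⟩
      rw [hf, L.apply_symm_apply]
    · apply (endRep K).injective
      rw [hf, hK.map_mul, hf, hf, hL.map_mul]
    · apply (endRep K).injective
      rw [hf, hK.map_one, hL.map_one]

end Rep

/-! ### Intertwiners in terms of coefficients -/

section Intertwiners

variable {Γ Γ' : QuantumGraph.{u}} {H K A B M : Type u} [NormedAddCommGroup H]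
  [InnerProductSpace ℂ H] [FiniteDimensional ℂ H] [NormedAddCommGroup K]
  [InnerProductSpace ℂ K] [FiniteDimensional ℂ K]
  [NormedAddCommGroup A] [InnerProductSpace ℂ A] [FiniteDimensional ℂ A]
  [NormedAddCommGroup B] [InnerProductSpace ℂ B] [FiniteDimensional ℂ B]
  [NormedAddCommGroup M] [InnerProductSpace ℂ M] [FiniteDimensional ℂ M]

/-- The adjoint of a coefficient is again a coefficient, with starred indices, so the intertwining
relation at the starred indices can be dualised. -/
lemma Intertwines.adjoint {P : H ⊗[ℂ] Γ.V →ₗ[ℂ] Γ'.V ⊗[ℂ] H} {Q : K ⊗[ℂ] Γ.V →ₗ[ℂ] Γ'.V ⊗[ℂ] K}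
    (hP : IsQuantumIso Γ Γ' P) (hQ : IsQuantumIso Γ Γ' Q) {f : H →ₗ[ℂ] K}
    (hf : Intertwines P Q f) : Intertwines Q P (LinearMap.adjoint f) := by
  rw [intertwines_iff] at hf ⊢
  intro w v k
  refine ext_inner_left ℂ fun h => ?_
  have h1 := hf (frobStar Γ'.mul Γ'.one w) (frobStar Γ.mul Γ.one v) h
  rw [hP.coef_star, hQ.coef_star] at h1
  rw [← LinearMap.adjoint_inner_left, LinearMap.adjoint_inner_right, ← h1,
    LinearMap.adjoint_inner_left, LinearMap.adjoint_inner_right]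

lemma coef_crossComp_tmul {V W U : Type*} [NormedAddCommGroup V] [InnerProductSpace ℂ V]
    [FiniteDimensional ℂ V] [NormedAddCommGroup W] [InnerProductSpace ℂ W] [FiniteDimensional ℂ W]
    [NormedAddCommGroup U] [InnerProductSpace ℂ U] [FiniteDimensional ℂ U]
    (Q : K ⊗[ℂ] W →ₗ[ℂ] U ⊗[ℂ] K) (P : H ⊗[ℂ] V →ₗ[ℂ] W ⊗[ℂ] H) (u : U) (v : V) (k : K) (h : H) :
    coef (crossComp Q P) u v (k ⊗ₜ h) =
      ∑ j, coef Q u (onb W j) k ⊗ₜ coef P (onb W j) v h := by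
  simp [coef_crossComp, LinearMap.sum_apply]

lemma intertwines_crossComp_iff {V W U : Type*} [NormedAddCommGroup V] [InnerProductSpace ℂ V]
    [FiniteDimensional ℂ V] [NormedAddCommGroup W] [InnerProductSpace ℂ W] [FiniteDimensional ℂ W]
    [NormedAddCommGroup U] [InnerProductSpace ℂ U] [FiniteDimensional ℂ U]
    (Q : K ⊗[ℂ] W →ₗ[ℂ] U ⊗[ℂ] K) (P : H ⊗[ℂ] V →ₗ[ℂ] W ⊗[ℂ] H) (R : M ⊗[ℂ] V →ₗ[ℂ] U ⊗[ℂ] M)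
    (f : K ⊗[ℂ] H →ₗ[ℂ] M) : Intertwines (crossComp Q P) R f ↔
      ∀ u v k h, coef R u v (f (k ⊗ₜ h)) =
        ∑ j, f (coef Q u (onb W j) k ⊗ₜ coef P (onb W j) v h) := by
  rw [intertwines_iff]
  constructor
  · intro hf u v k h
    rw [hf, coef_crossComp_tmul, map_sum]
  · intro hf u v z
    induction z using TensorProduct.induction_on with
    | zero => simp
    | tmul k h => rw [hf, coef_crossComp_tmul, map_sum]
    | add x y hx hy => simp only [map_add, hx, hy]

lemma intertwines_crossComp₃_iff (PA : A ⊗[ℂ] Γ.V →ₗ[ℂ] Γ.V ⊗[ℂ] A)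
    (PM : M ⊗[ℂ] Γ.V →ₗ[ℂ] Γ.V ⊗[ℂ] M) (PB : B ⊗[ℂ] Γ.V →ₗ[ℂ] Γ.V ⊗[ℂ] B)
    (f : A ⊗[ℂ] (M ⊗[ℂ] B) →ₗ[ℂ] M) : Intertwines (crossComp PA (crossComp PM PB)) PM f ↔
      ∀ w v a x b, coef PM w v (f (a ⊗ₜ (x ⊗ₜ b))) = ∑ j, ∑ k,
        f (coef PA w (onb Γ.V j) a ⊗ₜ (coef PM (onb Γ.V j) (onb Γ.V k) x ⊗ₜ
          coef PB (onb Γ.V k) v b)) := by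
  rw [intertwines_crossComp_iff]
  constructor
  · intro hf w v a x b
    simp only [hf, coef_crossComp_tmul, TensorProduct.tmul_sum, map_sum]
  · intro hf w v a z
    induction z using TensorProduct.induction_on with
    | zero => simp
    | tmul x b => simp only [hf, coef_crossComp_tmul, TensorProduct.tmul_sum, map_sum]
    | add x y hx hy =>
      simp only [map_add, TensorProduct.tmul_add, hx, hy, Finset.sum_add_distrib]

lemma homEquiv_coef (P : H ⊗[ℂ] Γ'.V →ₗ[ℂ] Γ.V ⊗[ℂ] H) (Q : K ⊗[ℂ] Γ'.V →ₗ[ℂ] Γ.V ⊗[ℂ] K)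
    (w v : Γ.V) (x : H ⊗[ℂ] StrongDual ℂ K) :
    homEquiv H K (coef (crossComp P (crossDual Q)) w v x) =
      ∑ j, coef P w (onb Γ'.V j) ∘ₗ homEquiv H K x ∘ₗ
        LinearMap.adjoint (coef Q v (onb Γ'.V j)) := by
  simp only [coef_crossComp, coef_crossDual, LinearMap.sum_apply, map_sum, homEquiv_map]

end Intertwiners

/-! ### Monoids presented by a quantum isomorphism -/

section Presents

variable {Γ Γ' : QuantumGraph.{u}}

/-- `L` presents the monoid `X` as the algebra `End H` with the conjugation action of
`(H, P) : Γ' → Γ`. -/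
structure Presents (X : MonoidData Γ) (P : QuantumIso Γ' Γ) (L : X.H ≃ₗ[ℂ] (P.H →ₗ[ℂ] P.H)) :
    Prop where
  rep : IsMatrixRep X.mul X.one L
  conj : ∀ w v a, L (coef X.P w v a) = ∑ j, coef P.P w (onb Γ'.V j) * L a *
    LinearMap.adjoint (coef P.P v (onb Γ'.V j))

lemma endRep_coef (P : QuantumIso Γ' Γ) [Nontrivial P.H] (w v : Γ.V)
    (a : P.H ⊗[ℂ] StrongDual ℂ P.H) :
    endRep P.H (coef (crossComp P.P (crossDual P.P)) w v a) = ∑ j, coef P.P w (onb Γ'.V j) *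
      endRep P.H a * LinearMap.adjoint (coef P.P v (onb Γ'.V j)) := by
  simp only [endRep_apply, homEquiv_coef, Finset.smul_sum, mul_smul_comm, smul_mul_assoc,
    Module.End.mul_eq_comp, LinearMap.comp_assoc]

lemma presents_monoid (P : QuantumIso Γ' Γ) [Nontrivial P.H] :
    Presents P.monoid P (endRep P.H) where
  rep := isMatrixRep_endRep
  conj w v a := endRep_coef P w v a

/-- A presentation is a `*`-isomorphism onto `P ∘ P̄` read through `endRep`; the proofs below use
only this form. -/
lemma starIso_monoid_iff {X : MonoidData Γ} (hX : IsDaggerFrobenius X.mul X.one)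
    (P : QuantumIso Γ' Γ) [Nontrivial P.H] :
    X.StarIso P.monoid ↔ ∃ L, Presents X P L := by
  have hP := presents_monoid P
  constructor
  · rintro ⟨f, hf, hs⟩
    obtain ⟨L, hL, hLf⟩ := (isStarIso_endMul_iff hX f).1 hs
    refine ⟨L, hL, fun w v a => ?_⟩
    have h1 : coef P.monoid.P w v (f a) = f (coef X.P w v a) := (intertwines_iff _ _ _).1 hf w v a
    exact (hLf _).symm.trans ((congrArg (endRep P.H) h1.symm).trans ((hP.conj w v (f a)).trans
      (congrArg (fun T => ∑ j, coef P.P w (onb Γ'.V j) * T *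
        LinearMap.adjoint (coef P.P v (onb Γ'.V j))) (hLf a))))
  · rintro ⟨L, hL⟩
    have hf : ∀ a, endRep P.H ((endRep P.H).symm (L a)) = L a :=
      fun a => (endRep P.H).apply_symm_apply _
    refine ⟨(endRep P.H).symm.toLinearMap ∘ₗ L.toLinearMap, ?_,
      (isStarIso_endMul_iff hX _).2 ⟨L, hL.rep, hf⟩⟩
    refine (intertwines_iff _ _ _).2 fun w v a => ?_
    apply (endRep P.H).injective
    exact (hP.conj _ _ _).trans ((congrArg (fun T => ∑ j, coef P.P w (onb Γ'.V j) * T *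
      LinearMap.adjoint (coef P.P v (onb Γ'.V j))) (hf a)).trans
        ((hL.conj w v a).symm.trans (hf _).symm))

/-- Since the action is conjugation by the unitary `P`, an operator can be moved past `P` at the
price of being acted on; the isometry relation removes `P† P`. -/
lemma Presents.conj_mul {X : MonoidData Γ} {P : QuantumIso Γ' Γ} {L : X.H ≃ₗ[ℂ] (P.H →ₗ[ℂ] P.H)}
    (h : Presents X P L) (w : Γ.V) (v : Γ'.V) (a : X.H) :
    ∑ j, L (coef X.P w (onb Γ.V j) a) * coef P.P (onb Γ.V j) v = coef P.P w v * L a := by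
  simp only [h.conj, Finset.sum_mul, mul_assoc]
  rw [Finset.sum_comm]
  simp only [← Finset.mul_sum, P.isQuantumIso.isMagic.adjoint_mul_self, mul_smul_comm, mul_one]
  simp only [← smul_mul_assoc, ← Finset.sum_mul]
  rw [sum_coef_right]

lemma comp_sum {E F G ι : Type*} [AddCommGroup E] [Module ℂ E] [AddCommGroup F] [Module ℂ F]
    [AddCommGroup G] [Module ℂ G] (s : Finset ι) (f : F →ₗ[ℂ] G) (g : ι → E →ₗ[ℂ] F) :
    f ∘ₗ (∑ i ∈ s, g i) = ∑ i ∈ s, f ∘ₗ g i := by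
  ext; simp [LinearMap.sum_apply]

lemma sum_comp {E F G ι : Type*} [AddCommGroup E] [Module ℂ E] [AddCommGroup F] [Module ℂ F]
    [AddCommGroup G] [Module ℂ G] (s : Finset ι) (f : ι → F →ₗ[ℂ] G) (g : E →ₗ[ℂ] F) :
    (∑ i ∈ s, f i) ∘ₗ g = ∑ i ∈ s, f i ∘ₗ g := by
  ext; simp [LinearMap.sum_apply]

/-- Composition of operators is equivariant: the factors `Q† Q` meeting in the middle collapse by
the isometry relation. The multiplication of a presented monoid, the bimodule actions and the
composition pairing are all intertwiners for this reason. -/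
lemma sum_conj_mul {H₁ H₂ H₃ : Type u} [NormedAddCommGroup H₁] [InnerProductSpace ℂ H₁]
    [FiniteDimensional ℂ H₁] [NormedAddCommGroup H₂] [InnerProductSpace ℂ H₂]
    [FiniteDimensional ℂ H₂] [NormedAddCommGroup H₃] [InnerProductSpace ℂ H₃]
    [FiniteDimensional ℂ H₃] {P : H₁ ⊗[ℂ] Γ'.V →ₗ[ℂ] Γ.V ⊗[ℂ] H₁}
    {Q : H₂ ⊗[ℂ] Γ'.V →ₗ[ℂ] Γ.V ⊗[ℂ] H₂} {R : H₃ ⊗[ℂ] Γ'.V →ₗ[ℂ] Γ.V ⊗[ℂ] H₃}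
    (hQ : IsQuantumIso Γ' Γ Q) (w v : Γ.V) (S : H₂ →ₗ[ℂ] H₁) (T : H₃ →ₗ[ℂ] H₂) :
    ∑ k, (∑ j, coef P w (onb Γ'.V j) ∘ₗ S ∘ₗ LinearMap.adjoint (coef Q (onb Γ.V k) (onb Γ'.V j))) ∘ₗ
      (∑ j, coef Q (onb Γ.V k) (onb Γ'.V j) ∘ₗ T ∘ₗ LinearMap.adjoint (coef R v (onb Γ'.V j))) =
    ∑ j, coef P w (onb Γ'.V j) ∘ₗ (S ∘ₗ T) ∘ₗ LinearMap.adjoint (coef R v (onb Γ'.V j)) := by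
  have key : ∀ i j, ∑ k, LinearMap.adjoint (coef Q (onb Γ.V k) (onb Γ'.V i)) ∘ₗ
      coef Q (onb Γ.V k) (onb Γ'.V j) = ⟪onb Γ'.V i, onb Γ'.V j⟫_ℂ • LinearMap.id :=
    fun i j => hQ.isMagic.adjoint_mul_self _ _
  calc _ = ∑ i, ∑ j, coef P w (onb Γ'.V i) ∘ₗ S ∘ₗ
        (∑ k, LinearMap.adjoint (coef Q (onb Γ.V k) (onb Γ'.V i)) ∘ₗ
          coef Q (onb Γ.V k) (onb Γ'.V j)) ∘ₗ T ∘ₗ LinearMap.adjoint (coef R v (onb Γ'.V j)) := by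
        simp only [sum_comp, comp_sum, LinearMap.comp_assoc]
        rw [Finset.sum_comm]
        refine Eq.trans (Finset.sum_congr rfl fun i _ => ?_) Finset.sum_comm
        rw [Finset.sum_comm]
    _ = _ := by
        refine Finset.sum_congr rfl fun i _ => ?_
        rw [Finset.sum_eq_single i]
        · rw [key, OrthonormalBasis.inner_eq_one, one_smul, LinearMap.id_comp, LinearMap.comp_assoc]
        · intro j _ hj
          rw [key, OrthonormalBasis.inner_eq_zero _ hj.symm, zero_smul, LinearMap.zero_comp,
            LinearMap.comp_zero, LinearMap.comp_zero]
        · simp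

lemma Presents.isDaggerFrobeniusMonoid {X : MonoidData Γ} {P : QuantumIso Γ' Γ}
    {L : X.H ≃ₗ[ℂ] (P.H →ₗ[ℂ] P.H)} (h : Presents X P L) (hX : IsQuantumIso Γ Γ X.P) :
    X.IsDaggerFrobeniusMonoid where
  isQuantumIso := hX
  intertwines_mul := by
    refine (intertwines_crossComp_iff _ _ _ _).2 fun w v a b => ?_
    apply L.injective
    have := sum_conj_mul (P := P.P) (R := P.P) P.isQuantumIso w v (L a) (L b)
    simp only [map_sum, h.rep.map_mul, h.conj, Module.End.mul_eq_comp, LinearMap.comp_assoc]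
    simp only [LinearMap.comp_assoc] at this
    exact this.symm
  intertwines_one := fun v => by
    refine slice_ext fun w => ?_
    rw [← coef_apply, slice_tmul]
    apply L.injective
    simp only [h.conj, h.rep.map_one, mul_one, P.isQuantumIso.isMagic.mul_adjoint_self, map_smul]
  frobenius := h.rep.isDaggerFrobenius

/-- The object `(H ⊗ K*, P ∘ Q̄)` of `QAut Γ`. -/
def homObj (P Q : QuantumIso Γ' Γ) : QuantumIso Γ Γ where
  H := P.H ⊗[ℂ] StrongDual ℂ Q.H
  P := crossComp P.P (crossDual Q.P)
  isQuantumIso := Q.isQuantumIso.crossDual.crossComp P.isQuantumIso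

theorem monoid_isSimple (P : QuantumIso Γ' Γ) [hP : Nontrivial P.H] : P.monoid.IsSimple where
  isDaggerFrobeniusMonoid := (presents_monoid P).isDaggerFrobeniusMonoid (homObj P P).isQuantumIso
  simple := ⟨P.H, inferInstance, inferInstance, inferInstance, hP, LinearMap.id,
    (isStarIso_endMul_iff (presents_monoid P).rep.isDaggerFrobenius _).2
      ⟨endRep P.H, isMatrixRep_endRep, fun _ => rfl⟩⟩

end Presents

/-! ### Bimodule actions and the relative tensor idempotent -/

section Actions

variable {A B M N : Type*}
  [NormedAddCommGroup A] [InnerProductSpace ℂ A] [FiniteDimensional ℂ A]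
  [NormedAddCommGroup B] [InnerProductSpace ℂ B] [FiniteDimensional ℂ B]
  [NormedAddCommGroup M] [InnerProductSpace ℂ M] [FiniteDimensional ℂ M]
  [NormedAddCommGroup N] [InnerProductSpace ℂ N] [FiniteDimensional ℂ N]
  {mA : A ⊗[ℂ] A →ₗ[ℂ] A} {eA : A} {mB : B ⊗[ℂ] B →ₗ[ℂ] B} {eB : B}

lemma inner_contract (hs : IsSymm mB eB) (a : A) (b : B) (y : M) (z : A ⊗[ℂ] (M ⊗[ℂ] B)) :
    ⟪y, contract (frobCap mA eA) (frobCap mB eB) a b z⟫_ℂ =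
      ⟪frobStar mA eA a ⊗ₜ[ℂ] (y ⊗ₜ[ℂ] frobStar mB eB b), z⟫_ℂ := by
  induction z using TensorProduct.induction_on with
  | zero =>
    rw [map_zero, inner_zero_right]
    exact (inner_zero_right (𝕜 := ℂ) (frobStar mA eA a ⊗ₜ[ℂ] (y ⊗ₜ[ℂ] frobStar mB eB b))).symm
  | add z z' h h' =>
    simp only [map_add, inner_add_right, h, h']
    exact (inner_add_right (𝕜 := ℂ) (frobStar mA eA a ⊗ₜ[ℂ] (y ⊗ₜ[ℂ] frobStar mB eB b)) z z').symm
  | tmul a' q =>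
    induction q using TensorProduct.induction_on with
    | zero =>
      rw [TensorProduct.tmul_zero, map_zero, inner_zero_right]
      exact (inner_zero_right (𝕜 := ℂ) (frobStar mA eA a ⊗ₜ[ℂ] (y ⊗ₜ[ℂ] frobStar mB eB b))).symm
    | add z z' h h' =>
      simp only [TensorProduct.tmul_add, map_add, inner_add_right, h, h']
      exact (inner_add_right (𝕜 := ℂ) (frobStar mA eA a ⊗ₜ[ℂ] (y ⊗ₜ[ℂ] frobStar mB eB b))
        (a' ⊗ₜ z) (a' ⊗ₜ z')).symm
    | tmul x b' =>
      simp only [contract, LinearMap.comp_apply, TensorProduct.map_tmul, TensorProduct.mk_apply,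
        LinearMap.lTensor_tmul, LinearMap.flip_apply, LinearEquiv.coe_coe, TensorProduct.rid_tmul,
        TensorProduct.lid_tmul, inner_smul_right, TensorProduct.inner_tmul, hs b' b, frobCap_tmul]
      ring

/-- Contracting with the caps stars the acting elements, so the dagger condition says that `a*` and
`b*` together act as the adjoint of `a` and `b`. Symmetry of `B` makes up for the order of the
arguments in its cap. -/
lemma dagger_iff (hs : IsSymm mB eB) (ρ : A ⊗[ℂ] (M ⊗[ℂ] B) →ₗ[ℂ] M) :
    (∀ a x b, contract (frobCap mA eA) (frobCap mB eB) a b (LinearMap.adjoint (𝕜 := ℂ) ρ x) =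
      ρ (a ⊗ₜ (x ⊗ₜ b))) ↔ ∀ a x b y, ⟪ρ (frobStar mA eA a ⊗ₜ (y ⊗ₜ frobStar mB eB b)), x⟫_ℂ =
        ⟪y, ρ (a ⊗ₜ (x ⊗ₜ b))⟫_ℂ := by
  have h1 : ∀ a x b y,
      ⟪y, contract (frobCap mA eA) (frobCap mB eB) a b (LinearMap.adjoint (𝕜 := ℂ) ρ x)⟫_ℂ =
      ⟪ρ (frobStar mA eA a ⊗ₜ (y ⊗ₜ frobStar mB eB b)), x⟫_ℂ := fun a x b y => by
    rw [inner_contract hs, LinearMap.adjoint_inner_right]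
  constructor
  · intro h a x b y
    rw [← h1, h]
  · intro h a x b
    refine ext_inner_left ℂ fun y => ?_
    rw [h1, h]

@[simp] lemma leftAct_apply (ρ : A ⊗[ℂ] (M ⊗[ℂ] B) →ₗ[ℂ] M) (a : A) (x : M) :
    leftAct eB ρ a x = ρ (a ⊗ₜ (x ⊗ₜ eB)) := rfl

@[simp] lemma rightAct_apply (ρ : A ⊗[ℂ] (M ⊗[ℂ] B) →ₗ[ℂ] M) (b : B) (x : M) :
    rightAct eA ρ b x = ρ (eA ⊗ₜ (x ⊗ₜ b)) := rfl

lemma relIdem_tmul (hB : IsDaggerFrobenius mB eB) (r : B →ₗ[ℂ] M →ₗ[ℂ] M) (l : B →ₗ[ℂ] N →ₗ[ℂ] N)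
    (x : M) (y : N) : relIdem (frobCup mB eB) r l (x ⊗ₜ y) =
      ∑ s, r (onb B s) x ⊗ₜ l (frobStar mB eB (onb B s)) y := by
  simp [relIdem, hB.frobCup_eq_sum, LinearMap.sum_apply]

end Actions

/-! ### The cup of a matrix algebra -/

section MatrixRep

variable {H K A B : Type*} [NormedAddCommGroup H] [InnerProductSpace ℂ H] [FiniteDimensional ℂ H]
  [NormedAddCommGroup K] [InnerProductSpace ℂ K] [FiniteDimensional ℂ K]
  [NormedAddCommGroup A] [InnerProductSpace ℂ A] [FiniteDimensional ℂ A]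
  [NormedAddCommGroup B] [InnerProductSpace ℂ B] [FiniteDimensional ℂ B]

/-- The operator `z ↦ ⟪y, z⟫ • x`. -/
def ketBra (x : H) (y : K) : K →ₗ[ℂ] H := (innerₛₗ ℂ y).smulRight x

@[simp] lemma ketBra_apply (x : H) (y z : K) : ketBra x y z = ⟪y, z⟫_ℂ • x := rfl

lemma trace_comp_ketBra (T : H →ₗ[ℂ] K) (x : H) (y : K) :
    LinearMap.trace ℂ K (T ∘ₗ ketBra x y) = ⟪y, T x⟫_ℂ := by
  have : T ∘ₗ ketBra x y = ketBra (T x) y := by ext; simp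
  rw [this, ketBra, LinearMap.trace_smulRight]
  simp

lemma adjoint_ketBra (x : H) (y : K) : LinearMap.adjoint (ketBra x y) = ketBra y x := by
  symm
  rw [LinearMap.eq_adjoint_iff]
  intro a b
  simp [inner_smul_left, inner_smul_right, mul_comm]

namespace IsMatrixRep

variable {m : A ⊗[ℂ] A →ₗ[ℂ] A} {e : A} {L : A ≃ₗ[ℂ] (K →ₗ[ℂ] K)}

lemma sum_inner_mul_inner (h : IsMatrixRep m e L) [Nontrivial K] (x x' y y' : K) :
    ∑ s, ⟪x, L (onb A s) y⟫_ℂ * ⟪x', L (frobStar m e (onb A s)) y'⟫_ℂ =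
      (Module.finrank ℂ K : ℂ)⁻¹ * (⟪x, y'⟫_ℂ * ⟪x', y⟫_ℂ) := by
  have h1 := h.sum_trace_mul_trace (ketBra y x) (ketBra y' x')
  have h2 : ∀ (x y : K) (T : K →ₗ[ℂ] K), LinearMap.trace ℂ K (ketBra y x * T) = ⟪x, T y⟫_ℂ := by
    intro x y T
    rw [LinearMap.trace_mul_comm, Module.End.mul_eq_comp, trace_comp_ketBra]
  simp only [h2] at h1
  rw [h1, ketBra_apply, inner_smul_right, mul_comm ⟪x', y⟫_ℂ]

/-- Multiplying the two legs of the cup gives the unit. Testing on matrix units produces `dim K`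
equal terms, which cancel the factor `(dim K)⁻¹` from `sum_inner_mul_inner`. -/
lemma sum_mul_frobStar (h : IsMatrixRep m e L) [Nontrivial K] :
    ∑ s, L (onb A s) * L (frobStar m e (onb A s)) = 1 := by
  have hn : (Module.finrank ℂ K : ℂ) ≠ 0 := Nat.cast_ne_zero.2 Module.finrank_pos.ne'
  ext k
  refine ext_inner_left ℂ fun k' => ?_
  simp only [LinearMap.sum_apply, inner_sum, Module.End.mul_apply, Module.End.one_apply]
  calc _ = ∑ s, ∑ i, ⟪k', L (onb A s) (onb K i)⟫_ℂ *
        ⟪onb K i, L (frobStar m e (onb A s)) k⟫_ℂ := by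
        refine Finset.sum_congr rfl fun s _ => ?_
        conv_lhs => rw [← (onb K).sum_repr' (L (frobStar m e (onb A s)) k)]
        simp [inner_sum, inner_smul_right, mul_comm]
    _ = _ := by
        rw [Finset.sum_comm]
        simp only [h.sum_inner_mul_inner, OrthonormalBasis.inner_eq_one]
        simp [hn]

end IsMatrixRep

end MatrixRep

/-! ### The bimodule `Hom(K, H)` and its composition pairing -/

section HomBimodule

variable {A B H K M N : Type*} [NormedAddCommGroup H] [InnerProductSpace ℂ H]
  [FiniteDimensional ℂ H] [NormedAddCommGroup K] [InnerProductSpace ℂ K] [FiniteDimensional ℂ K]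
  [NormedAddCommGroup A] [InnerProductSpace ℂ A] [FiniteDimensional ℂ A]
  [NormedAddCommGroup B] [InnerProductSpace ℂ B] [FiniteDimensional ℂ B]
  [NormedAddCommGroup M] [InnerProductSpace ℂ M] [FiniteDimensional ℂ M]
  [NormedAddCommGroup N] [InnerProductSpace ℂ N] [FiniteDimensional ℂ N]
  {mA : A ⊗[ℂ] A →ₗ[ℂ] A} {eA : A} {mB : B ⊗[ℂ] B →ₗ[ℂ] B} {eB : B}
  {L : A ≃ₗ[ℂ] (H →ₗ[ℂ] H)} {R : B ≃ₗ[ℂ] (K →ₗ[ℂ] K)}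

/-- `θ` identifies `M` with `Hom(K, H)` and its trace inner product. -/
def IsHomRep (θ : M ≃ₗ[ℂ] (K →ₗ[ℂ] H)) : Prop :=
  ∀ a b, ⟪a, b⟫_ℂ = LinearMap.trace ℂ K (LinearMap.adjoint (θ a) ∘ₗ θ b)

/-- The action of `End H` and `End K` on `Hom(K, H)` by composition. -/
def homAct (L : A ≃ₗ[ℂ] (H →ₗ[ℂ] H)) (R : B ≃ₗ[ℂ] (K →ₗ[ℂ] K)) (θ : M ≃ₗ[ℂ] (K →ₗ[ℂ] H)) :
    A ⊗[ℂ] (M ⊗[ℂ] B) →ₗ[ℂ] M :=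
  θ.symm.toLinearMap ∘ₗ TensorProduct.lift
    (((LinearMap.llcomp ℂ (M ⊗[ℂ] B) (K →ₗ[ℂ] H) (K →ₗ[ℂ] H)).flip
      (TensorProduct.lift ((LinearMap.llcomp ℂ K K H).compl₁₂ θ.toLinearMap R.toLinearMap))) ∘ₗ
      LinearMap.llcomp ℂ K H H ∘ₗ L.toLinearMap)

lemma map_homAct (θ : M ≃ₗ[ℂ] (K →ₗ[ℂ] H)) (a : A) (x : M) (b : B) :
    θ (homAct L R θ (a ⊗ₜ (x ⊗ₜ b))) = L a ∘ₗ θ x ∘ₗ R b := by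
  simp only [homAct, LinearMap.comp_apply, LinearEquiv.coe_coe, LinearEquiv.apply_symm_apply]
  rfl

lemma isDaggerBimodule_homAct (hL : IsMatrixRep mA eA L) (hR : IsMatrixRep mB eB R)
    {θ : M ≃ₗ[ℂ] (K →ₗ[ℂ] H)} (hθ : IsHomRep θ) :
    IsDaggerBimodule mA eA mB eB (homAct L R θ) where
  mul_act a a' x b' b := by
    apply θ.injective
    rw [map_homAct, map_homAct, map_homAct, hL.map_mul, hR.map_mul]
    rfl
  one_act x := by
    apply θ.injective
    rw [map_homAct, hL.map_one, hR.map_one]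
    rfl
  dagger := by
    refine (dagger_iff hR.isSymm _).2 fun a x b y => ?_
    rw [hθ, hθ, map_homAct, map_homAct, hL.map_frobStar,
      hR.map_frobStar, LinearMap.adjoint_comp, LinearMap.adjoint_comp, LinearMap.adjoint_adjoint,
      LinearMap.adjoint_adjoint]
    exact LinearMap.trace_mul_comm ℂ (R b) (LinearMap.adjoint (θ y) ∘ₗ L a ∘ₗ θ x)

/-- The composition `Hom(K, H) ⊗ Hom(H, K) → End H`, normalised to be a coisometry. -/
def homComp (L : A ≃ₗ[ℂ] (H →ₗ[ℂ] H)) (θ : M ≃ₗ[ℂ] (K →ₗ[ℂ] H)) (η : N ≃ₗ[ℂ] (H →ₗ[ℂ] K)) :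
    M ⊗[ℂ] N →ₗ[ℂ] A :=
  (((Real.sqrt (Module.finrank ℂ H) : ℝ) : ℂ)⁻¹ * ((Real.sqrt (Module.finrank ℂ K) : ℝ) : ℂ)⁻¹) •
    (L.symm.toLinearMap ∘ₗ TensorProduct.lift ((LinearMap.llcomp ℂ H K H).compl₁₂
        θ.toLinearMap η.toLinearMap))

variable {θ : M ≃ₗ[ℂ] (K →ₗ[ℂ] H)} {η : N ≃ₗ[ℂ] (H →ₗ[ℂ] K)}

lemma map_homComp (x : M) (y : N) :
    L (homComp L θ η (x ⊗ₜ y)) = (((Real.sqrt (Module.finrank ℂ H) : ℝ) : ℂ)⁻¹ *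
      ((Real.sqrt (Module.finrank ℂ K) : ℝ) : ℂ)⁻¹) • (θ x ∘ₗ η y) := by
  simp only [homComp, LinearMap.smul_apply, map_smul, LinearMap.comp_apply, LinearEquiv.coe_coe,
    LinearEquiv.apply_symm_apply]
  rfl

lemma homComp_surjective [Nontrivial H] [Nontrivial K] :
    Function.Surjective (homComp L θ η) := by
  intro a
  obtain ⟨k, hk⟩ := exists_norm_eq K zero_le_one
  have hk' : ⟪k, k⟫_ℂ = 1 := by rw [inner_self_eq_norm_sq_to_K, hk]; simp
  refine ⟨(((Real.sqrt (Module.finrank ℂ H) : ℝ) : ℂ) *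
      ((Real.sqrt (Module.finrank ℂ K) : ℝ) : ℂ)) • ∑ i, θ.symm (ketBra (L a (onb H i)) k) ⊗ₜ
        η.symm (ketBra k (onb H i)), ?_⟩
  apply L.injective
  have h1 := sqrt_finrank_ne_zero (K := H)
  have h2 := sqrt_finrank_ne_zero (K := K)
  simp only [map_smul, map_sum, map_homComp, ← Finset.smul_sum, smul_smul]
  rw [show (((Real.sqrt (Module.finrank ℂ H) : ℝ) : ℂ) *
    ((Real.sqrt (Module.finrank ℂ K) : ℝ) : ℂ)) * (((Real.sqrt (Module.finrank ℂ H) : ℝ) : ℂ)⁻¹ *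
      ((Real.sqrt (Module.finrank ℂ K) : ℝ) : ℂ)⁻¹) = 1 by field_simp, one_smul]
  ext x
  simp only [LinearMap.sum_apply, LinearMap.comp_apply, LinearEquiv.apply_symm_apply, ketBra_apply,
    map_smul, hk', one_smul]
  conv_rhs => rw [← (onb H).sum_repr' x]
  simp

/-- The inner product of `A` contributes `dim H` and the normalisation `(dim H · dim K)⁻¹`. The
surviving `(dim K)⁻¹` is the constant of `sum_trace_mul_trace` for `B`, which fixes the choice of
normalisation. -/
lemma inner_homComp (hL : IsMatrixRep mA eA L) [Nontrivial H] (x x' : M) (y y' : N) :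
    ⟪homComp L θ η (x ⊗ₜ y), homComp L θ η (x' ⊗ₜ y')⟫_ℂ =
      (Module.finrank ℂ K : ℂ)⁻¹ * LinearMap.trace ℂ K
        ((LinearMap.adjoint (θ x) ∘ₗ θ x') * (η y' ∘ₗ LinearMap.adjoint (η y))) := by
  have hn := sqrt_finrank_ne_zero (K := H)
  have hc : (starRingEnd ℂ) (((Real.sqrt (Module.finrank ℂ H) : ℝ) : ℂ)⁻¹ *
      ((Real.sqrt (Module.finrank ℂ K) : ℝ) : ℂ)⁻¹) =
      ((Real.sqrt (Module.finrank ℂ H) : ℝ) : ℂ)⁻¹ *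
      ((Real.sqrt (Module.finrank ℂ K) : ℝ) : ℂ)⁻¹ := by
    rw [← Complex.ofReal_inv, ← Complex.ofReal_inv, ← Complex.ofReal_mul, Complex.conj_ofReal]
  rw [hL.inner_eq, map_homComp, map_homComp, adjoint_smul, smul_mul_smul_comm, map_smul, hc,
    ← sqrt_finrank_mul_self (K := H), ← sqrt_finrank_mul_self (K := K), LinearMap.adjoint_comp]
  have ht : LinearMap.trace ℂ H ((LinearMap.adjoint (η y) ∘ₗ LinearMap.adjoint (θ x)) *
      (θ x' ∘ₗ η y')) = LinearMap.trace ℂ K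
        ((LinearMap.adjoint (θ x) ∘ₗ θ x') * (η y' ∘ₗ LinearMap.adjoint (η y))) :=
    LinearMap.trace_comp_comm' (LinearMap.adjoint (θ x) ∘ₗ (θ x' ∘ₗ η y'))
      (LinearMap.adjoint (η y))
  rw [ht, smul_eq_mul]
  field_simp

/-- Cyclicity of the trace puts both sides in terms of traces over `K`, and `sum_trace_mul_trace`
for `B` splits the single trace into the sum over the cup. -/
lemma homComp_adjoint_comp (hL : IsMatrixRep mA eA L) (hR : IsMatrixRep mB eB R)
    (hθ : IsHomRep θ) (hη : IsHomRep η) [Nontrivial H] [Nontrivial K] :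
    LinearMap.adjoint (homComp L θ η) ∘ₗ homComp L θ η = relIdem (frobCup mB eB)
      (rightAct eA (homAct L R θ)) (leftAct eA (homAct R L η)) := by
  refine TensorProduct.ext' fun x y => ?_
  refine TensorProduct.ext_iff_inner_left.2 fun x' y' => ?_
  rw [LinearMap.comp_apply, LinearMap.adjoint_inner_right, inner_homComp hL,
    relIdem_tmul hR.isDaggerFrobenius, ← hR.sum_trace_mul_trace]
  refine Eq.trans ?_ (inner_sum (𝕜 := ℂ) _ _ _).symm
  refine Finset.sum_congr rfl fun s _ => ?_
  rw [TensorProduct.inner_tmul, hθ, hη, rightAct_apply, leftAct_apply,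
    map_homAct, map_homAct, hL.map_one]
  congr 1
  exact LinearMap.trace_comp_comm' (LinearMap.adjoint (η y') ∘ₗ R (frobStar mB eB (onb B s))) (η y)

lemma homComp_comp_relIdem (hL : IsMatrixRep mA eA L) (hR : IsMatrixRep mB eB R) [Nontrivial K] :
    homComp L θ η ∘ₗ relIdem (frobCup mB eB)
      (rightAct eA (homAct L R θ)) (leftAct eA (homAct R L η)) = homComp L θ η := by
  refine TensorProduct.ext' fun x y => L.injective ?_
  rw [LinearMap.comp_apply, relIdem_tmul hR.isDaggerFrobenius, map_sum, map_sum, map_homComp]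
  simp only [map_homComp, rightAct_apply, leftAct_apply, map_homAct, hL.map_one]
  rw [← Finset.smul_sum]
  congr 1
  have h3 := congrArg (fun T => θ x ∘ₗ T ∘ₗ η y) hR.sum_mul_frobStar
  simp only [sum_comp, comp_sum] at h3
  exact h3

/-- Composition is unchanged by the idempotent `homComp† homComp`, and it is surjective, so `homComp
homComp†` fixes every element of `A`. -/
lemma homComp_comp_adjoint (hL : IsMatrixRep mA eA L) (hR : IsMatrixRep mB eB R)
    (hθ : IsHomRep θ) (hη : IsHomRep η) [Nontrivial H] [Nontrivial K] :
    homComp L θ η ∘ₗ LinearMap.adjoint (homComp L θ η) = LinearMap.id := by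
  ext a
  obtain ⟨z, rfl⟩ := homComp_surjective (L := L) (θ := θ) (η := η) a
  have h1 := LinearMap.congr_fun (homComp_comp_relIdem (θ := θ) (η := η) hL hR) z
  rw [← homComp_adjoint_comp hL hR hθ hη] at h1
  exact h1

lemma homComp_map (hL : IsMatrixRep mA eA L) (hR : IsMatrixRep mB eB R) (a c : A) :
    homComp L θ η ∘ₗ TensorProduct.map (leftAct eB (homAct L R θ) a)
      (rightAct eB (homAct R L η) c) =
    mA ∘ₗ (TensorProduct.mk ℂ A A).flip c ∘ₗ mA ∘ₗ TensorProduct.mk ℂ A A a ∘ₗ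
      homComp L θ η := by
  refine TensorProduct.ext' fun x y => L.injective ?_
  simp only [LinearMap.comp_apply, TensorProduct.map_tmul, LinearMap.flip_apply,
    TensorProduct.mk_apply, hL.map_mul, map_homComp, leftAct_apply, rightAct_apply, map_homAct,
    hR.map_one, smul_mul_assoc, mul_smul_comm]
  rfl

end HomBimodule

/-! ### Quantum isomorphisms out of one graph give Morita equivalent monoids -/

section Bimodules

variable {Γ Γ' : QuantumGraph.{u}} {X Y : MonoidData Γ} {P Q : QuantumIso Γ' Γ}
  {L : X.H ≃ₗ[ℂ] (P.H →ₗ[ℂ] P.H)} {R : Y.H ≃ₗ[ℂ] (Q.H →ₗ[ℂ] Q.H)}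

/-- `θ` presents the object `M` as `P ∘ Q̄` on `Hom(K, H)`. -/
structure PresentsHom (M : QuantumIso Γ Γ) (P Q : QuantumIso Γ' Γ)
    (θ : M.H ≃ₗ[ℂ] (Q.H →ₗ[ℂ] P.H)) : Prop where
  rep : IsHomRep θ
  conj : ∀ w v x, θ (coef M.P w v x) = ∑ j, coef P.P w (onb Γ'.V j) ∘ₗ θ x ∘ₗ
    LinearMap.adjoint (coef Q.P v (onb Γ'.V j))

lemma presentsHom_homObj (P Q : QuantumIso Γ' Γ) :
    PresentsHom (homObj P Q) P Q (homEquiv P.H Q.H) where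
  rep := inner_eq_trace
  conj := homEquiv_coef P.P Q.P

variable {M N : QuantumIso Γ Γ} {θ : M.H ≃ₗ[ℂ] (Q.H →ₗ[ℂ] P.H)} {η : N.H ≃ₗ[ℂ] (P.H →ₗ[ℂ] Q.H)}

lemma homAct_intertwines (hX : Presents X P L) (hY : Presents Y Q R) (hM : PresentsHom M P Q θ) :
    Intertwines (crossComp X.P (crossComp M.P Y.P)) M.P (homAct L R θ) := by
  refine (intertwines_crossComp₃_iff _ _ _ _).2 fun w v a x b => ?_
  apply θ.injective
  have h1 := fun k => sum_conj_mul (P := P.P) (R := Q.P) P.isQuantumIso w k (L a) (θ x)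
  have h2 := sum_conj_mul (P := P.P) (R := Q.P) Q.isQuantumIso w v (L a ∘ₗ θ x) (R b)
  simp only [map_sum, map_homAct, hM.conj, hX.conj, hY.conj, Module.End.mul_eq_comp]
  rw [Finset.sum_comm]
  simp only [← LinearMap.comp_assoc, ← sum_comp]
  simp only [LinearMap.comp_assoc] at h1 h2 ⊢
  simp only [h1, h2]

/-- The bimodule `Hom(K, H)` between the monoids presented by `(H, P)` and `(K, Q)`. -/
def homBimodule (hX : Presents X P L) (hY : Presents Y Q R) (hM : PresentsHom M P Q θ) :
    DaggerBimodule X Y where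
  obj := M
  act := homAct L R θ
  intertwines := homAct_intertwines hX hY hM
  isDaggerBimodule := isDaggerBimodule_homAct hX.rep hY.rep hM.rep

lemma homComp_intertwines (hX : Presents X P L) (hM : PresentsHom M P Q θ)
    (hN : PresentsHom N Q P η) :
    Intertwines (crossComp M.P N.P) X.P (homComp L θ η) := by
  refine (intertwines_crossComp_iff _ _ _ _).2 fun w v x y => ?_
  apply L.injective
  have h1 := sum_conj_mul (P := P.P) (R := P.P) Q.isQuantumIso w v (θ x) (η y)
  simp only [map_sum, map_homComp, hM.conj, hN.conj, hX.conj, ← Finset.smul_sum, h1]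
  simp only [Module.End.mul_eq_comp, LinearMap.smul_comp, LinearMap.comp_smul,
    LinearMap.comp_assoc, Finset.smul_sum]

lemma homBimodule_tensorIsTrivial (hX : Presents X P L) (hY : Presents Y Q R)
    (hM : PresentsHom M P Q θ) (hN : PresentsHom N Q P η) [Nontrivial P.H]
    [Nontrivial Q.H] (hXq : IsQuantumIso Γ Γ X.P) :
    (homBimodule hX hY hM).TensorIsTrivial (homBimodule hY hX hN) := by
  -- The monoid itself serves as the relative tensor product, embedded by the adjoint of the
  -- normalised composition, so that the unitary onto it is the identity.
  refine ⟨⟨X.H, X.P, hXq⟩, LinearMap.adjoint (homComp L θ η), ⟨?_, ⟨?_, ?_⟩⟩,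
    LinearMap.id, ?_, ?_, ?_, ?_⟩
  · exact (homComp_intertwines hX hM hN).adjoint (N.isQuantumIso.crossComp M.isQuantumIso) hXq
  · exact (congrArg (fun f => f ∘ₗ LinearMap.adjoint (homComp L θ η))
      (LinearMap.adjoint_adjoint (homComp L θ η))).trans
        (homComp_comp_adjoint hX.rep hY.rep hM.rep hN.rep)
  · exact (congrArg (fun f => LinearMap.adjoint (homComp L θ η) ∘ₗ f)
      (LinearMap.adjoint_adjoint (homComp L θ η))).trans
        (homComp_adjoint_comp hX.rep hY.rep hM.rep hN.rep)
  · exact (intertwines_iff _ _ _).2 fun w v h => rfl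
  · exact (LinearMap.comp_id _).trans adjoint_one
  · exact (LinearMap.id_comp _).trans adjoint_one
  · intro a c x
    have h1 := LinearMap.congr_fun (homComp_map (θ := θ) (η := η) hX.rep hY.rep a c)
      (LinearMap.adjoint (homComp L θ η) x)
    have h2 := LinearMap.congr_fun (homComp_comp_adjoint hX.rep hY.rep hM.rep hN.rep) x
    refine (LinearMap.congr_fun (LinearMap.adjoint_adjoint (homComp L θ η)) _).trans
      (h1.trans ?_)
    exact congrArg (fun y => X.mul (X.mul (a ⊗ₜ y) ⊗ₜ c)) h2

theorem moritaEquivalent_of_presents (hX : Presents X P L) (hY : Presents Y Q R) [Nontrivial P.H]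
    [Nontrivial Q.H] (hXq : IsQuantumIso Γ Γ X.P) (hYq : IsQuantumIso Γ Γ Y.P) :
    X.MoritaEquivalent Y :=
  ⟨homBimodule hX hY (presentsHom_homObj P Q), homBimodule hY hX (presentsHom_homObj Q P),
    homBimodule_tensorIsTrivial _ _ _ _ hXq, homBimodule_tensorIsTrivial _ _ _ _ hYq⟩

end Bimodules

/-! ### Isomorphisms of quantum graphs -/

section GraphIso

variable {Γ Γ' Γ'' : QuantumGraph.{u}}

/-- `g` is a multiplicative unital unitary compatible with the adjacency matrices. -/
structure IsGraphIso (Γ Γ' : QuantumGraph.{u}) (g : Γ.V ≃ₗᵢ[ℂ] Γ'.V) : Prop where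
  map_mul : ∀ a b, g (Γ.mul (a ⊗ₜ b)) = Γ'.mul (g a ⊗ₜ g b)
  map_one : g Γ.one = Γ'.one
  map_adj : ∀ a, g (Γ.adj a) = Γ'.adj (g a)

lemma iso_iff : Γ.Iso Γ' ↔ ∃ g, IsGraphIso Γ Γ' g := by
  constructor
  · rintro ⟨f, hf, ha⟩
    obtain ⟨hi, hs, hm, h1⟩ := (isStarIso_iff Γ.frobenius Γ'.frobenius f).1 hf
    let g : Γ.V →ₗᵢ[ℂ] Γ'.V := f.isometryOfInner hi
    exact ⟨LinearIsometryEquiv.ofSurjective g hs, hm, h1, fun a => LinearMap.congr_fun ha a⟩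
  · rintro ⟨g, hg⟩
    refine ⟨g.toLinearEquiv.toLinearMap, (isStarIso_iff Γ.frobenius Γ'.frobenius _).2
      ⟨fun a b => g.inner_map_map a b, g.surjective, hg.map_mul, hg.map_one⟩, ?_⟩
    ext a
    exact hg.map_adj a

lemma IsGraphIso.refl : IsGraphIso Γ Γ (LinearIsometryEquiv.refl ℂ Γ.V) :=
  ⟨fun _ _ => rfl, rfl, fun _ => rfl⟩

lemma IsGraphIso.symm {g : Γ.V ≃ₗᵢ[ℂ] Γ'.V} (h : IsGraphIso Γ Γ' g) :
    IsGraphIso Γ' Γ g.symm where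
  map_mul a b := g.injective (by simp [h.map_mul])
  map_one := g.injective (by simp [h.map_one])
  map_adj a := g.injective (by simp [h.map_adj])

lemma IsGraphIso.trans {g : Γ.V ≃ₗᵢ[ℂ] Γ'.V} {g' : Γ'.V ≃ₗᵢ[ℂ] Γ''.V} (h : IsGraphIso Γ Γ' g)
    (h' : IsGraphIso Γ' Γ'' g') : IsGraphIso Γ Γ'' (g.trans g') where
  map_mul a b := by simp [h.map_mul, h'.map_mul]
  map_one := by simp [h.map_one, h'.map_one]
  map_adj a := by simp [h.map_adj, h'.map_adj]

theorem iso_equivalence : Equivalence QuantumGraph.Iso.{u} where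
  refl _ := iso_iff.2 ⟨_, IsGraphIso.refl⟩
  symm h := let ⟨_, hg⟩ := iso_iff.1 h; iso_iff.2 ⟨_, hg.symm⟩
  trans h h' := let ⟨_, hg⟩ := iso_iff.1 h; let ⟨_, hg'⟩ := iso_iff.1 h'; iso_iff.2 ⟨_, hg.trans hg'⟩

/-- The sum of `c(v) A c'(v)†` over an orthonormal basis does not depend on the basis, and `g` maps
one orthonormal basis to another. -/
lemma sum_conj_isometry {H V V' : Type*} [NormedAddCommGroup H] [InnerProductSpace ℂ H]
    [FiniteDimensional ℂ H] [NormedAddCommGroup V] [InnerProductSpace ℂ V] [FiniteDimensional ℂ V]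
    [NormedAddCommGroup V'] [InnerProductSpace ℂ V'] [FiniteDimensional ℂ V']
    (c c' : V →ₗ[ℂ] (H →ₗ[ℂ] H)) (g : V' ≃ₗᵢ[ℂ] V) (A : H →ₗ[ℂ] H) :
    ∑ j, c (g (onb V' j)) * A * LinearMap.adjoint (c' (g (onb V' j))) =
      ∑ k, c (onb V k) * A * LinearMap.adjoint (c' (onb V k)) := by
  have h1 : ∀ j, LinearMap.adjoint (c' (g (onb V' j))) =
      ∑ k, ⟪g (onb V' j), onb V k⟫_ℂ • LinearMap.adjoint (c' (onb V k)) := fun j => by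
    rw [← sum_inner_smul_right c' (g (onb V' j))]
    simp only [map_sum, adjoint_smul, inner_conj_symm]
  have h2 : ∀ k, c (onb V k) = ∑ j, ⟪g (onb V' j), onb V k⟫_ℂ • c (g (onb V' j)) := fun k => by
    have := ((onb V').map g).sum_repr' (onb V k)
    conv_lhs => rw [← this]
    simp only [map_sum, map_smul, OrthonormalBasis.map_apply]
  simp only [h1]
  conv_rhs => simp only [h2, Finset.sum_mul]
  rw [Finset.sum_comm]
  simp only [Finset.mul_sum, mul_smul_comm, smul_mul_assoc]

/-- The composite of a quantum isomorphism with an isomorphism of quantum graphs. -/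
def QuantumIso.precomp (Q : QuantumIso Γ'' Γ) {g : Γ'.V ≃ₗᵢ[ℂ] Γ''.V} (hg : IsGraphIso Γ' Γ'' g) :
    QuantumIso Γ' Γ where
  H := Q.H
  P := Q.P ∘ₗ g.toLinearEquiv.toLinearMap.lTensor Q.H
  isQuantumIso := by
    have hc : ∀ w v, coef (Q.P ∘ₗ g.toLinearEquiv.toLinearMap.lTensor Q.H) w v =
        coef Q.P w (g v) := fun w v => rfl
    refine (isQuantumIso_iff _).2 ⟨⟨fun v v' => ?_, fun w w' => ?_, fun w x y => ?_, fun w => ?_⟩,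
      fun w v => ?_⟩
    · simp only [hc, Q.isQuantumIso.isMagic.adjoint_mul_self, g.inner_map_map]
    · have := sum_conj_isometry (coef Q.P w) (coef Q.P w') g 1
      simp only [mul_one] at this
      simp only [hc, this, Q.isQuantumIso.isMagic.mul_adjoint_self]
    · simp only [hc, hg.map_mul, Q.isQuantumIso.isMagic.map_mul]
    · simp only [hc, hg.map_one, Q.isQuantumIso.isMagic.map_one]
    · simp only [hc, hg.map_adj, Q.isQuantumIso.coef_adj]

lemma Presents.precomp {Y : MonoidData Γ} {Q : QuantumIso Γ'' Γ} {R : Y.H ≃ₗ[ℂ] (Q.H →ₗ[ℂ] Q.H)}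
    (h : Presents Y Q R) {g : Γ'.V ≃ₗᵢ[ℂ] Γ''.V} (hg : IsGraphIso Γ' Γ'' g) :
    Presents Y (Q.precomp hg) R where
  rep := h.rep
  conj w v a := (h.conj w v a).trans (sum_conj_isometry (coef Q.P w) (coef Q.P v) g (R a)).symm

theorem moritaEquivalent_of_iso {X Y : MonoidData Γ} {P : QuantumIso Γ' Γ} {Q : QuantumIso Γ'' Γ}
    {L : X.H ≃ₗ[ℂ] (P.H →ₗ[ℂ] P.H)} {R : Y.H ≃ₗ[ℂ] (Q.H →ₗ[ℂ] Q.H)} (hX : Presents X P L)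
    (hY : Presents Y Q R) [Nontrivial P.H] [hQ : Nontrivial Q.H] (hXq : IsQuantumIso Γ Γ X.P)
    (hYq : IsQuantumIso Γ Γ Y.P) (h : Γ'.Iso Γ'') : X.MoritaEquivalent Y := by
  obtain ⟨g, hg⟩ := iso_iff.1 h
  have : Nontrivial (Q.precomp hg).H := hQ
  exact moritaEquivalent_of_presents hX (hY.precomp hg) hXq hYq

end GraphIso

/-! ### The Hilbert space of operator-valued coefficients -/

section CoefSpace

variable {V K : Type*} [NormedAddCommGroup V] [InnerProductSpace ℂ V] [FiniteDimensional ℂ V]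
  [NormedAddCommGroup K] [InnerProductSpace ℂ K] [FiniteDimensional ℂ K] [Nontrivial K]

lemma finrank_ne_zero : (Module.finrank ℂ K : ℂ) ≠ 0 := Nat.cast_ne_zero.2 Module.finrank_pos.ne'

/-- The normalised Hilbert–Schmidt inner product on operator-valued antilinear maps. -/
def coefCore (V K : Type*) [NormedAddCommGroup V] [InnerProductSpace ℂ V] [FiniteDimensional ℂ V]
    [NormedAddCommGroup K] [InnerProductSpace ℂ K] [FiniteDimensional ℂ K] [Nontrivial K] :
    InnerProductSpace.Core ℂ (V →ₗ⋆[ℂ] (K →ₗ[ℂ] K)) where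
  inner c d := (Module.finrank ℂ K : ℂ)⁻¹ *
    ∑ i, ∑ k, ⟪c (onb V i) (onb K k), d (onb V i) (onb K k)⟫_ℂ
  conj_inner_symm c d := by simp
  re_inner_nonneg c := by
    rw [← Complex.ofReal_natCast, ← Complex.ofReal_inv, RCLike.re_eq_complex_re,
      Complex.re_ofReal_mul]
    refine mul_nonneg (by positivity) ?_
    simp only [Complex.re_sum]
    exact Finset.sum_nonneg fun i _ => Finset.sum_nonneg fun k _ => inner_self_nonneg (𝕜 := ℂ)
  add_left c d e := by simp [inner_add_left, Finset.sum_add_distrib, mul_add]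
  smul_left c d r := by
    simp only [LinearMap.smul_apply, inner_smul_left, ← Finset.mul_sum]
    ring
  definite c hc := by
    rw [mul_eq_zero, or_iff_right (inv_ne_zero finrank_ne_zero)] at hc
    have h0 : ∑ i, ∑ k, ‖c (onb V i) (onb K k)‖ ^ 2 = 0 := by
      have h := congrArg Complex.re hc
      simp only [Complex.re_sum, Complex.zero_re] at h
      rw [← h]
      exact Finset.sum_congr rfl fun i _ => Finset.sum_congr rfl fun k _ =>
        norm_sq_eq_re_inner (𝕜 := ℂ) _
    have h1 : ∀ i k, c (onb V i) (onb K k) = 0 := fun i k => by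
      have h2 := (Finset.sum_eq_zero_iff_of_nonneg (fun _ _ => by positivity)).1 h0 i
        (Finset.mem_univ i)
      have h3 := (Finset.sum_eq_zero_iff_of_nonneg (fun _ _ => by positivity)).1 h2 k
        (Finset.mem_univ k)
      simpa using h3
    ext w k
    rw [← sum_inner_smul_left c w, LinearMap.sum_apply]
    refine (Finset.sum_eq_zero fun i _ => ?_)
    rw [LinearMap.smul_apply, ← sum_inner_smul_right (c (onb V i)) k]
    simp [h1]

instance : NormedAddCommGroup (V →ₗ⋆[ℂ] (K →ₗ[ℂ] K)) := (coefCore V K).toNormedAddCommGroup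

instance : InnerProductSpace ℂ (V →ₗ⋆[ℂ] (K →ₗ[ℂ] K)) :=
  InnerProductSpace.ofCore (coefCore V K).toCore

/-- The factor `(dim K)⁻¹` is chosen so that, when `∑ i, c(eᵢ)† d(eᵢ)` is a scalar operator, that
scalar is `⟪c, d⟫`. -/
lemma inner_eq_sum_trace (c d : V →ₗ⋆[ℂ] (K →ₗ[ℂ] K)) : ⟪c, d⟫_ℂ = (Module.finrank ℂ K : ℂ)⁻¹ *
    LinearMap.trace ℂ K (∑ i, LinearMap.adjoint (c (onb V i)) * d (onb V i)) := by
  rw [map_sum]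
  simp only [LinearMap.trace_eq_sum_inner _ (onb K), Module.End.mul_apply,
    LinearMap.adjoint_inner_right]
  rfl

instance : FiniteDimensional ℂ (V →ₗ⋆[ℂ] (K →ₗ[ℂ] K)) := by
  let f : (V →ₗ⋆[ℂ] (K →ₗ[ℂ] K)) →ₗ[ℂ] (Fin (Module.finrank ℂ V) → (K →ₗ[ℂ] K)) :=
    { toFun := fun c i => c (onb V i)
      map_add' := fun _ _ => rfl
      map_smul' := fun _ _ => rfl }
  refine FiniteDimensional.of_injective f fun c d h => ?_
  ext1 w
  rw [← sum_inner_smul_left c w, ← sum_inner_smul_left d w]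
  exact Finset.sum_congr rfl fun i _ => congrArg _ (congrFun h i)

end CoefSpace

/-! ### Convolution: the algebra `V ⊗ End(K)ᵒᵖ` -/

section Convolution

variable {V K : Type*} [NormedAddCommGroup V] [InnerProductSpace ℂ V] [FiniteDimensional ℂ V]
  [NormedAddCommGroup K] [InnerProductSpace ℂ K] [FiniteDimensional ℂ K]
  {m : V ⊗[ℂ] V →ₗ[ℂ] V} {e : V}

lemma sum_mul_adjoint_apply (A : V →ₗ[ℂ] (K →ₗ[ℂ] K)) (T : K →ₗ[ℂ] K)
    (B : V →ₗ⋆[ℂ] (K →ₗ[ℂ] K)) (f : V →ₗ[ℂ] V) :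
    ∑ i, A (f (onb V i)) * T * B (onb V i) =
      ∑ i, A (onb V i) * T * B (LinearMap.adjoint f (onb V i)) := by
  have h1 : ∀ i, A (f (onb V i)) = ∑ j, ⟪onb V j, f (onb V i)⟫_ℂ • A (onb V j) := fun i =>
    (sum_inner_smul_right A _).symm
  have h2 : ∀ j, B (LinearMap.adjoint f (onb V j)) =
      ∑ i, ⟪onb V j, f (onb V i)⟫_ℂ • B (onb V i) := fun j => by
    rw [← sum_inner_smul_left B]
    simp only [LinearMap.adjoint_inner_left]
  simp only [h1, h2, Finset.sum_mul, Finset.mul_sum, smul_mul_assoc, mul_smul_comm]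
  exact Finset.sum_comm

/-- By symmetry the involution is antiunitary, so the starred basis is again orthonormal, and such a
sum does not depend on the basis. -/
lemma sum_mul_frobStar_apply (hV : IsDaggerFrobenius m e) (hs : IsSymm m e)
    (A : V →ₗ[ℂ] (K →ₗ[ℂ] K)) (T : K →ₗ[ℂ] K) (B : V →ₗ⋆[ℂ] (K →ₗ[ℂ] K)) :
    ∑ i, A (frobStar m e (onb V i)) * T * B (frobStar m e (onb V i)) =
      ∑ i, A (onb V i) * T * B (onb V i) := by
  have h1 : ∀ i, A (frobStar m e (onb V i)) =
      ∑ j, ⟪onb V i, frobStar m e (onb V j)⟫_ℂ • A (onb V j) := fun i => by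
    rw [← sum_inner_smul_right A]
    refine Finset.sum_congr rfl fun j _ => ?_
    rw [← hV.inner_frobStar_frobStar hs, hV.frobStar_frobStar]
  have h2 : ∀ j, B (onb V j) =
      ∑ i, ⟪onb V i, frobStar m e (onb V j)⟫_ℂ • B (frobStar m e (onb V i)) := fun j => by
    have := sum_inner_smul_right (B.comp (frobStar m e)) (frobStar m e (onb V j))
    simp only [LinearMap.comp_apply, hV.frobStar_frobStar] at this
    exact this.symm
  conv_rhs => simp only [h2]
  simp only [h1, Finset.sum_mul, Finset.mul_sum, smul_mul_assoc, mul_smul_comm]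
  exact Finset.sum_comm

/-- The convolution of operator-valued antilinear maps on an algebra. -/
def conv (m : V ⊗[ℂ] V →ₗ[ℂ] V) :
    (V →ₗ⋆[ℂ] (K →ₗ[ℂ] K)) →ₗ[ℂ] (V →ₗ⋆[ℂ] (K →ₗ[ℂ] K)) →ₗ[ℂ] (V →ₗ⋆[ℂ] (K →ₗ[ℂ] K)) :=
  LinearMap.mk₂ ℂ
    (fun c d =>
      { toFun := fun w => ∑ s, ∑ t, ⟪w, m (onb V s ⊗ₜ onb V t)⟫_ℂ • (d (onb V t) * c (onb V s))
        map_add' := fun w w' => by simp [inner_add_left, add_smul, Finset.sum_add_distrib]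
        map_smul' := fun r w => by
          simp [inner_smul_left, mul_smul, Finset.smul_sum, smul_comm _ ((starRingEnd ℂ) r)] })
    (fun c c' d => by ext; simp [mul_add, Finset.sum_add_distrib, LinearMap.sum_apply])
    (fun r c d => by ext; simp [Finset.smul_sum, LinearMap.sum_apply, smul_comm r])
    (fun c d d' => by ext; simp [add_mul, Finset.sum_add_distrib, LinearMap.sum_apply])
    (fun r c d => by ext; simp [Finset.smul_sum, LinearMap.sum_apply, smul_comm r])

lemma conv_apply (c d : V →ₗ⋆[ℂ] (K →ₗ[ℂ] K)) (w : V) : conv m c d w =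
    ∑ s, ∑ t, ⟪w, m (onb V s ⊗ₜ onb V t)⟫_ℂ • (d (onb V t) * c (onb V s)) := rfl

/-- Moving `eₛ` across the inner product leaves one sum instead of two; `conv_apply_right` does the
same with `eₜ`. Using one form for each factor makes associativity of convolution an exchange of
sums. -/
lemma conv_apply_left (hV : IsDaggerFrobenius m e) (c d : V →ₗ⋆[ℂ] (K →ₗ[ℂ] K)) (w : V) :
    conv m c d w = ∑ s, d (m (frobStar m e (onb V s) ⊗ₜ w)) * c (onb V s) := by
  rw [conv_apply]
  refine Finset.sum_congr rfl fun s _ => ?_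
  rw [← sum_inner_smul_left d, Finset.sum_mul]
  refine Finset.sum_congr rfl fun t _ => ?_
  rw [hV.inner_mul_left', smul_mul_assoc]

lemma inner_mul_right' (hV : IsDaggerFrobenius m e) (hs : IsSymm m e) (x y z : V) :
    ⟪z, m (x ⊗ₜ y)⟫_ℂ = ⟪m (z ⊗ₜ frobStar m e y), x⟫_ℂ := by
  rw [← inner_conj_symm, hV.inner_mul_right hs, inner_conj_symm]

lemma conv_apply_right (hV : IsDaggerFrobenius m e) (hs : IsSymm m e)
    (c d : V →ₗ⋆[ℂ] (K →ₗ[ℂ] K)) (w : V) :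
    conv m c d w = ∑ t, d (onb V t) * c (m (w ⊗ₜ frobStar m e (onb V t))) := by
  rw [conv_apply, Finset.sum_comm]
  refine Finset.sum_congr rfl fun t _ => ?_
  rw [← sum_inner_smul_left c, Finset.mul_sum]
  refine Finset.sum_congr rfl fun s _ => ?_
  rw [inner_mul_right' hV hs, mul_smul_comm]

lemma conv_assoc (hV : IsDaggerFrobenius m e) (hs : IsSymm m e)
    (c d f : V →ₗ⋆[ℂ] (K →ₗ[ℂ] K)) : conv m (conv m c d) f = conv m c (conv m d f) := by
  ext1 w
  rw [conv_apply_right hV hs, conv_apply_left hV]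
  simp only [conv_apply_left hV c, conv_apply_right hV hs d, Finset.mul_sum, Finset.sum_mul,
    hV.assoc, mul_assoc]
  exact Finset.sum_comm

/-- The unit of convolution. -/
def convOne (K : Type*) [NormedAddCommGroup K] [InnerProductSpace ℂ K] (e : V) :
    V →ₗ⋆[ℂ] (K →ₗ[ℂ] K) where
  toFun w := ⟪w, e⟫_ℂ • 1
  map_add' w w' := by simp [inner_add_left, add_smul]
  map_smul' r w := by simp [inner_smul_left, mul_smul, smul_comm _ ((starRingEnd ℂ) r)]

lemma convOne_apply (w : V) : convOne K e w = ⟪w, e⟫_ℂ • 1 := rfl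

lemma one_conv (hV : IsDaggerFrobenius m e) (hs : IsSymm m e) (d : V →ₗ⋆[ℂ] (K →ₗ[ℂ] K)) :
    conv m (convOne K e) d = d := by
  ext1 w
  rw [conv_apply_right hV hs, ← sum_inner_smul_left d]
  refine Finset.sum_congr rfl fun t _ => ?_
  rw [convOne_apply, ← inner_mul_right' hV hs, hV.one_mul, mul_smul_comm, mul_one]

lemma conv_one (hV : IsDaggerFrobenius m e) (c : V →ₗ⋆[ℂ] (K →ₗ[ℂ] K)) :
    conv m c (convOne K e) = c := by
  ext1 w
  rw [conv_apply_left hV, ← sum_inner_smul_left c]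
  refine Finset.sum_congr rfl fun t _ => ?_
  rw [convOne_apply, ← hV.inner_mul_left', hV.mul_one, smul_mul_assoc, one_mul]

/-- The involution `c*(w) = c(w*)†`. -/
def convStar (m : V ⊗[ℂ] V →ₗ[ℂ] V) (e : V) (c : V →ₗ⋆[ℂ] (K →ₗ[ℂ] K)) :
    V →ₗ⋆[ℂ] (K →ₗ[ℂ] K) where
  toFun w := LinearMap.adjoint (c (frobStar m e w))
  map_add' w w' := by simp
  map_smul' r w := by simp [adjoint_smul]

lemma convStar_apply (c : V →ₗ⋆[ℂ] (K →ₗ[ℂ] K)) (w : V) :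
    convStar m e c w = LinearMap.adjoint (c (frobStar m e w)) := rfl

/-- The linear map `w ↦ c(w)†`. -/
def adjCoef (c : V →ₗ⋆[ℂ] (K →ₗ[ℂ] K)) : V →ₗ[ℂ] (K →ₗ[ℂ] K) where
  toFun w := LinearMap.adjoint (c w)
  map_add' w w' := by simp
  map_smul' r w := by simp [adjoint_smul]

lemma adjCoef_apply (c : V →ₗ⋆[ℂ] (K →ₗ[ℂ] K)) (w : V) : adjCoef c w = LinearMap.adjoint (c w) :=
  rfl

lemma adjoint_mulRight (hV : IsDaggerFrobenius m e) (hs : IsSymm m e) (y x : V) :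
    LinearMap.adjoint ((TensorProduct.curry m).flip y) x = m (x ⊗ₜ frobStar m e y) := by
  refine ext_inner_right ℂ fun z => ?_
  rw [LinearMap.adjoint_inner_left, ← inner_mul_right' hV hs]
  rfl

variable [Nontrivial K]

lemma frobStar_mul (hV : IsDaggerFrobenius m e) (x y : V) :
    frobStar m e (m (x ⊗ₜ y)) = m (frobStar m e y ⊗ₜ frobStar m e x) := by
  refine ext_inner_right ℂ fun z => ?_
  rw [inner_frobStar, hV.assoc, ← inner_frobStar, hV.inner_mul_left']

/-- Expanding both convolutions on the right makes the two sums agree term by term, after exchanging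
indices and using cyclicity of the trace. -/
lemma inner_conv_left (hV : IsDaggerFrobenius m e) (hs : IsSymm m e)
    (c d f : V →ₗ⋆[ℂ] (K →ₗ[ℂ] K)) : ⟪conv m c d, f⟫_ℂ = ⟪d, conv m (convStar m e c) f⟫_ℂ := by
  rw [inner_eq_sum_trace, inner_eq_sum_trace]
  congr 1
  have h1 : ∀ i, conv m (convStar m e c) f (onb V i) = ∑ t, f (onb V t) *
      LinearMap.adjoint (c (m (onb V t ⊗ₜ frobStar m e (onb V i)))) := fun i => by
    rw [conv_apply_right hV hs]
    refine Finset.sum_congr rfl fun t _ => ?_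
    rw [convStar_apply]
    rw [frobStar_mul hV, hV.frobStar_frobStar]
  simp only [h1, conv_apply_right hV hs c d, map_sum, adjoint_mul, Finset.mul_sum, Finset.sum_mul]
  rw [Finset.sum_comm]
  refine Finset.sum_congr rfl fun i _ => Finset.sum_congr rfl fun t _ => ?_
  rw [mul_assoc, LinearMap.trace_mul_comm, mul_assoc]

/-- Two changes of basis are needed: right multiplication by `eₜ*` is moved to the other factor as
its adjoint, and then the basis `eₜ` is replaced by `eₜ*`. -/
lemma inner_conv_right (hV : IsDaggerFrobenius m e) (hs : IsSymm m e)
    (c d f : V →ₗ⋆[ℂ] (K →ₗ[ℂ] K)) : ⟪conv m c d, f⟫_ℂ = ⟪c, conv m f (convStar m e d)⟫_ℂ := by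
  rw [inner_eq_sum_trace, inner_eq_sum_trace]
  congr 2
  simp only [conv_apply_right hV hs, map_sum, adjoint_mul, Finset.mul_sum, Finset.sum_mul,
    convStar_apply]
  rw [Finset.sum_comm]
  have h1 : ∀ t, ∑ i, LinearMap.adjoint (c (m (onb V i ⊗ₜ frobStar m e (onb V t)))) *
      LinearMap.adjoint (d (onb V t)) * f (onb V i) = ∑ i, LinearMap.adjoint (c (onb V i)) *
      LinearMap.adjoint (d (onb V t)) * f (m (onb V i ⊗ₜ onb V t)) := fun t => by
    have := sum_mul_adjoint_apply (adjCoef c) (LinearMap.adjoint (d (onb V t))) f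
      ((TensorProduct.curry m).flip (frobStar m e (onb V t)))
    simp only [adjoint_mulRight hV hs, hV.frobStar_frobStar] at this
    exact this
  rw [Finset.sum_congr rfl fun t _ => h1 t, Finset.sum_comm]
  refine Finset.sum_congr rfl fun i _ => ?_
  have := sum_mul_frobStar_apply hV hs (adjCoef d) 1 (f.comp (TensorProduct.curry m (onb V i)))
  simp only [mul_one] at this
  simp only [mul_assoc, ← Finset.mul_sum]
  exact congrArg _ this.symm

lemma inner_convStar (hV : IsDaggerFrobenius m e) (hs : IsSymm m e)
    (c d : V →ₗ⋆[ℂ] (K →ₗ[ℂ] K)) : ⟪convStar m e c, d⟫_ℂ = ⟪convStar m e d, c⟫_ℂ := by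
  rw [inner_eq_sum_trace, inner_eq_sum_trace]
  congr 1
  have := sum_mul_frobStar_apply hV hs (c.comp (frobStar m e)) 1 d
  simp only [LinearMap.comp_apply, hV.frobStar_frobStar, mul_one] at this
  simp only [convStar_apply, LinearMap.adjoint_adjoint, ← this, map_sum]
  exact Finset.sum_congr rfl fun i _ => LinearMap.trace_mul_comm _ _ _

end Convolution

/-! ### Transport of graph identities along a magic unitary -/

section Transport

variable {H : Type*} [NormedAddCommGroup H] [InnerProductSpace ℂ H] [FiniteDimensional ℂ H]
  {V W : Type*} [NormedAddCommGroup V] [InnerProductSpace ℂ V] [FiniteDimensional ℂ V]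
  [NormedAddCommGroup W] [InnerProductSpace ℂ W] [FiniteDimensional ℂ W]
  {mV : V ⊗[ℂ] V →ₗ[ℂ] V} {eV : V} {mW : W ⊗[ℂ] W →ₗ[ℂ] W} {eW : W}
  {c : W →ₗ⋆[ℂ] V →ₗ[ℂ] (H →ₗ[ℂ] H)}

/-- Multiplicativity on the side of `V` and comultiplicativity on the side of `W` expand both sides
into the same fourfold sum. -/
lemma IsMagic.mul_map_comul (h : IsMagic mV eV mW eW c) {f g : W →ₗ[ℂ] W} {f' g' : V →ₗ[ℂ] V}
    (hf : ∀ w v, c w (f' v) = c (f w) v) (hg : ∀ w v, c w (g' v) = c (g w) v) (w : W) (v : V) :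
    c w (mV (TensorProduct.map f' g' (LinearMap.adjoint mV v))) =
      c (mW (TensorProduct.map f g (LinearMap.adjoint mW w))) v := by
  rw [← sum_inner_smul_tmul (LinearMap.adjoint mV v), ← sum_inner_smul_tmul (LinearMap.adjoint mW w)]
  simp only [map_sum, map_smul, map_smulₛₗ, TensorProduct.map_tmul, LinearMap.adjoint_inner_right,
    LinearMap.sum_apply, LinearMap.smul_apply, h.map_mul, h.comul, hf, hg, inner_conj_symm,
    Finset.smul_sum]
  rw [sum_comm_pairs]
  simp only [smul_comm (⟪_, w⟫_ℂ), smul_comm (⟪w, _⟫_ℂ)]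

/-- When the coefficients separate the points of `V`, an identity `m (f ⊗ g) m† = h` passes from `W`
to `V`. Specialness and two of the adjacency axioms have this shape. -/
lemma IsMagic.mul_comp_map_comp_comul (hc : IsMagic mV eV mW eW c)
    (inj : ∀ v v', (∀ w, c w v = c w v') → v = v') {f g h : W →ₗ[ℂ] W} {f' g' h' : V →ₗ[ℂ] V}
    (hf : ∀ w v, c w (f' v) = c (f w) v) (hg : ∀ w v, c w (g' v) = c (g w) v)
    (hh : ∀ w v, c w (h' v) = c (h w) v)
    (H : mW ∘ₗ TensorProduct.map f g ∘ₗ LinearMap.adjoint mW = h) :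
    mV ∘ₗ TensorProduct.map f' g' ∘ₗ LinearMap.adjoint mV = h' := by
  refine LinearMap.ext fun v => inj _ _ fun w => ?_
  rw [hh, ← H]
  exact hc.mul_map_comul hf hg w v

lemma IsMagic.isSpecial (hc : IsMagic mV eV mW eW c)
    (inj : ∀ v v', (∀ w, c w v = c w v') → v = v') (H : IsSpecial mW) : IsSpecial mV := by
  have := hc.mul_comp_map_comp_comul inj (f := LinearMap.id) (g := LinearMap.id)
    (h := LinearMap.id) (f' := LinearMap.id) (g' := LinearMap.id) (h' := LinearMap.id)
    (fun _ _ => rfl) (fun _ _ => rfl) (fun _ _ => rfl)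
    (by rw [TensorProduct.map_id, LinearMap.id_comp]; exact H)
  rwa [TensorProduct.map_id, LinearMap.id_comp] at this

end Transport

/-! ### Splitting `V ⊗ K` as a multiple of the module `K` -/

section Splitting

variable {Γ : QuantumGraph.{u}} {K : Type u} [NormedAddCommGroup K] [InnerProductSpace ℂ K]
  [FiniteDimensional ℂ K]
  {α : Γ.V →ₗ⋆[ℂ] Γ.V →ₗ[ℂ] ((K →ₗ[ℂ] K) →ₗ[ℂ] (K →ₗ[ℂ] K))}

/-- `α` is the family of coefficients of a quantum automorphism of `Γ` on `End K` for which the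
algebra structure of `End K` is equivariant. -/
structure IsEndAction (α : Γ.V →ₗ⋆[ℂ] Γ.V →ₗ[ℂ] ((K →ₗ[ℂ] K) →ₗ[ℂ] (K →ₗ[ℂ] K))) : Prop where
  apply_mul : ∀ w v S T, α w v (S * T) = ∑ j, α w (onb Γ.V j) S * α (onb Γ.V j) v T
  apply_one : ∀ w v, α w v 1 = ⟪w, v⟫_ℂ • 1
  apply_adjoint : ∀ w v S, α v w (LinearMap.adjoint S) = LinearMap.adjoint (α w v S)
  map_one : ∀ w S, α w Γ.one S = ⟪w, Γ.one⟫_ℂ • S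
  map_mul : ∀ w x y S, α w (Γ.mul (x ⊗ₜ y)) S =
    ∑ s, ∑ t, ⟪w, Γ.mul (onb Γ.V s ⊗ₜ onb Γ.V t)⟫_ℂ • α (onb Γ.V t) y (α (onb Γ.V s) x S)
  map_adj : ∀ w v S, α w (Γ.adj v) S = α (Γ.adj w) v S
  sum_star : ∀ v v' S, ∑ s, α (frobStar Γ.mul Γ.one (onb Γ.V s)) (frobStar Γ.mul Γ.one v)
    (α (onb Γ.V s) v' S) = ⟪v, v'⟫_ℂ • S

/-- The coefficients of the `End K`-module maps `K → V ⊗ K`. -/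
def covariant (α : Γ.V →ₗ⋆[ℂ] Γ.V →ₗ[ℂ] ((K →ₗ[ℂ] K) →ₗ[ℂ] (K →ₗ[ℂ] K))) :
    Submodule ℂ (Γ.V →ₗ⋆[ℂ] (K →ₗ[ℂ] K)) where
  carrier := {c | ∀ w S, ∑ j, α w (onb Γ.V j) S * c (onb Γ.V j) = c w * S}
  add_mem' := fun {c d} hc hd w S => by
    simp only [LinearMap.add_apply, mul_add, add_mul, Finset.sum_add_distrib, hc w S, hd w S]
  zero_mem' := fun w S => by simp
  smul_mem' := fun r c hc w S => by
    simp only [LinearMap.smul_apply, mul_smul_comm, smul_mul_assoc, ← Finset.smul_sum, hc w S]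

lemma sum_inner_smul_apply (w x : Γ.V) (S : K →ₗ[ℂ] K) :
    ∑ j, ⟪onb Γ.V j, x⟫_ℂ • α w (onb Γ.V j) S = α w x S := by
  rw [← sum_inner_smul_right (α w) x]
  simp [LinearMap.sum_apply]

namespace IsEndAction

variable (hα : IsEndAction α)
include hα

lemma convOne_mem : convOne K Γ.one ∈ covariant α := fun w S => by
  simp only [convOne_apply, mul_smul_comm, mul_one, sum_inner_smul_apply, hα.map_one,
    smul_mul_assoc, one_mul]

/-- An operator on the right of `d(eₜ) c(eₛ)` is passed first through `c` and then through `d`; the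
two resulting actions combine because `α` is multiplicative in its vertex index. -/
lemma conv_mem {c d : Γ.V →ₗ⋆[ℂ] (K →ₗ[ℂ] K)} (hc : c ∈ covariant α) (hd : d ∈ covariant α) :
    conv Γ.mul c d ∈ covariant α := fun w S => by
  have h1 : ∀ s t, (d (onb Γ.V t) * c (onb Γ.V s)) * S = ∑ j, ∑ k,
      α (onb Γ.V t) (onb Γ.V k) (α (onb Γ.V s) (onb Γ.V j) S) *
        (d (onb Γ.V k) * c (onb Γ.V j)) := fun s t => by
    rw [mul_assoc, ← hc, Finset.mul_sum]
    refine Finset.sum_congr rfl fun j _ => ?_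
    rw [← mul_assoc, ← hd, Finset.sum_mul]
    simp only [mul_assoc]
  calc _ = ∑ j, ∑ k, α w (Γ.mul (onb Γ.V j ⊗ₜ onb Γ.V k)) S *
        (d (onb Γ.V k) * c (onb Γ.V j)) := by
        simp only [conv_apply, Finset.mul_sum, mul_smul_comm]
        rw [Finset.sum_comm]
        refine Finset.sum_congr rfl fun j _ => ?_
        rw [Finset.sum_comm]
        refine Finset.sum_congr rfl fun k _ => ?_
        rw [← sum_inner_smul_apply, Finset.sum_mul]
        simp only [smul_mul_assoc]
    _ = _ := by
        simp only [conv_apply, Finset.sum_mul, smul_mul_assoc, h1, hα.map_mul, Finset.smul_sum]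
        rw [sum_comm_pairs]

lemma comp_adj_mem {c : Γ.V →ₗ⋆[ℂ] (K →ₗ[ℂ] K)} (hc : c ∈ covariant α) :
    c.comp Γ.adj ∈ covariant α := fun w S => by
  have h := sum_mul_adjoint_apply ((LinearMap.applyₗ S).comp (α w)) 1 c Γ.adj
  simp only [Γ.adj_selfAdjoint, LinearMap.comp_apply, LinearMap.applyₗ_apply_apply, mul_one] at h
  rw [LinearMap.comp_apply, ← hc]
  simp only [← hα.map_adj]
  exact h.symm

/-- Closure under the involution needs `α` to be invertible: `sum_star` supplies the inverse, which
moves the action to the other side of `c`, and taking adjoints restores the original form. -/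
lemma convStar_mem {c : Γ.V →ₗ⋆[ℂ] (K →ₗ[ℂ] K)} (hc : c ∈ covariant α) :
    convStar Γ.mul Γ.one c ∈ covariant α := fun w S => by
  have h1 : ∑ j, c (frobStar Γ.mul Γ.one (onb Γ.V j)) * α (onb Γ.V j) w (LinearMap.adjoint S) =
      LinearMap.adjoint S * c (frobStar Γ.mul Γ.one w) := by
    simp only [← hc _ (α _ _ _)]
    rw [Finset.sum_comm]
    simp only [← Finset.sum_mul]
    have h2 : ∀ k, ∑ j, α (frobStar Γ.mul Γ.one (onb Γ.V j)) (onb Γ.V k)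
        (α (onb Γ.V j) w (LinearMap.adjoint S)) =
          ⟪frobStar Γ.mul Γ.one w, onb Γ.V k⟫_ℂ • LinearMap.adjoint S := fun k => by
      have := hα.sum_star (frobStar Γ.mul Γ.one (onb Γ.V k)) w (LinearMap.adjoint S)
      rw [Γ.frobenius.frobStar_frobStar] at this
      rw [this, ← Γ.frobenius.inner_frobStar_frobStar Γ.symmetric, Γ.frobenius.frobStar_frobStar]
    simp only [h2, smul_mul_assoc]
    rw [← sum_inner_smul_left c, Finset.mul_sum]
    simp only [mul_smul_comm]
  have h3 := congrArg LinearMap.adjoint h1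
  simp only [map_sum, adjoint_mul, ← hα.apply_adjoint, LinearMap.adjoint_adjoint] at h3
  exact h3

/-- Schur's lemma: `c† d` is an endomorphism of the module `K`, so it lies in the centre of `End K`
and is scalar. The trace identifies the scalar. -/
lemma sum_adjoint_mul [Nontrivial K] {c d : Γ.V →ₗ⋆[ℂ] (K →ₗ[ℂ] K)} (hc : c ∈ covariant α)
    (hd : d ∈ covariant α) :
    ∑ i, LinearMap.adjoint (c (onb Γ.V i)) * d (onb Γ.V i) = ⟪c, d⟫_ℂ • 1 := by
  have hcomm : ∀ S : K →ₗ[ℂ] K, (∑ i, LinearMap.adjoint (c (onb Γ.V i)) * d (onb Γ.V i)) * S =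
      S * ∑ i, LinearMap.adjoint (c (onb Γ.V i)) * d (onb Γ.V i) := fun S => by
    have h1 : ∀ j, S * LinearMap.adjoint (c (onb Γ.V j)) = ∑ i, LinearMap.adjoint (c (onb Γ.V i)) *
        α (onb Γ.V i) (onb Γ.V j) S := fun j => by
      have := congrArg LinearMap.adjoint (hc (onb Γ.V j) (LinearMap.adjoint S))
      simp only [map_sum, adjoint_mul, ← hα.apply_adjoint, LinearMap.adjoint_adjoint] at this
      exact this.symm
    simp only [Finset.sum_mul, Finset.mul_sum, ← mul_assoc, h1]
    rw [Finset.sum_comm]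
    refine Finset.sum_congr rfl fun i _ => ?_
    rw [mul_assoc, ← hd, Finset.mul_sum]
    simp only [mul_assoc]
  have hmem := (Algebra.IsCentral.center_eq_bot ℂ (Module.End ℂ K)).le
    (Subalgebra.mem_center_iff.2 fun S => (hcomm S).symm)
  obtain ⟨r, hr⟩ := Algebra.mem_bot.1 hmem
  have hr' : ∑ i, LinearMap.adjoint (c (onb Γ.V i)) * d (onb Γ.V i) = r • 1 := by
    rw [← hr]; rfl
  rw [inner_eq_sum_trace, hr', map_smul, LinearMap.trace_one, smul_eq_mul, mul_comm r,
    inv_mul_cancel_left₀ finrank_ne_zero]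

/-- The covariant map `w ↦ (k ↦ α(w, v)(|k⟩⟨y|) x)`. -/
def basicCovariant (α : Γ.V →ₗ⋆[ℂ] Γ.V →ₗ[ℂ] ((K →ₗ[ℂ] K) →ₗ[ℂ] (K →ₗ[ℂ] K))) (v : Γ.V) (x y : K) :
    Γ.V →ₗ⋆[ℂ] (K →ₗ[ℂ] K) where
  toFun w := LinearMap.applyₗ x ∘ₗ α w v ∘ₗ
    { toFun := fun k => ketBra k y
      map_add' := fun _ _ => by ext; simp
      map_smul' := fun r _ => by ext; exact smul_comm _ r _ }
  map_add' _ _ := by ext; simp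
  map_smul' _ _ := by ext; simp

omit hα in
lemma basicCovariant_apply (v w : Γ.V) (x y k : K) :
    basicCovariant α v x y w k = α w v (ketBra k y) x := rfl

/-- Since `S |k⟩⟨y| = |S k⟩⟨y|`, multiplicativity of `α` gives the module property. These maps
supply enough covariant maps to span `V ⊗ K`. -/
lemma basicCovariant_mem (v : Γ.V) (x y : K) : basicCovariant α v x y ∈ covariant α :=
  fun w S => by
    ext k
    have h1 : S * ketBra k y = ketBra (S k) y := by ext; simp
    simp only [LinearMap.sum_apply, Module.End.mul_apply, basicCovariant_apply, ← h1, hα.apply_mul]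

lemma sum_basicCovariant (v w : Γ.V) (x : K) :
    ∑ i, basicCovariant α v x (onb K i) w (onb K i) = ⟪w, v⟫_ℂ • x := by
  have h1 : ∑ i, ketBra (onb K i) (onb K i) = (1 : K →ₗ[ℂ] K) := by
    ext k
    simp only [LinearMap.sum_apply, ketBra_apply, (onb K).sum_repr', Module.End.one_apply]
  have h2 : α w v 1 x = ⟪w, v⟫_ℂ • x := by rw [hα.apply_one]; rfl
  rw [← h2, ← h1, map_sum, LinearMap.sum_apply]
  rfl

variable [Nontrivial K]

/-- Completeness of the module maps `K → V ⊗ K`. The maps `Dᵢ` attached to `w'` and `k` satisfy `∑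
i, Dᵢ(w) eᵢ = ⟪w, w'⟫ k`, and by Schur's lemma their coordinates in the orthonormal basis of
covariant maps are the coordinates of the vectors `c(w')† k`. -/
lemma sum_mul_adjoint (w w' : Γ.V) : ∑ j, (onb (covariant α) j).1 w *
    LinearMap.adjoint ((onb (covariant α) j).1 w') = ⟪w, w'⟫_ℂ • 1 := by
  ext k
  let D : ∀ i, covariant α := fun i => ⟨basicCovariant α w' k (onb K i), hα.basicCovariant_mem _ _ _⟩
  have h1 : ∀ c : covariant α, LinearMap.adjoint (c.1 w') k = ∑ i, ⟪c, D i⟫_ℂ • onb K i := by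
    intro c
    have h2 : ∀ i, ⟪c, D i⟫_ℂ • onb K i =
        ∑ l, LinearMap.adjoint (c.1 (onb Γ.V l)) ((D i).1 (onb Γ.V l) (onb K i)) := fun i => by
      have := congrArg (fun T => T (onb K i)) (hα.sum_adjoint_mul c.2 (D i).2)
      simpa [LinearMap.sum_apply] using this.symm
    simp only [h2]
    rw [Finset.sum_comm]
    have h3 : ∀ l, ∑ i, (D i).1 (onb Γ.V l) (onb K i) = ⟪onb Γ.V l, w'⟫_ℂ • k :=
      fun l => hα.sum_basicCovariant _ _ _
    simp only [← map_sum, h3, map_smul]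
    have h4 := congrArg (fun T => T k) (sum_inner_smul_right (adjCoef c.1) w')
    simpa [LinearMap.sum_apply, adjCoef_apply] using h4.symm
  simp only [LinearMap.sum_apply, Module.End.mul_apply, h1, map_sum, map_smul,
    LinearMap.smul_apply, Module.End.one_apply]
  rw [Finset.sum_comm, ← hα.sum_basicCovariant w' w k]
  refine Finset.sum_congr rfl fun i _ => ?_
  have h5 := congrArg (fun c : covariant α => c.1 w (onb K i)) ((onb (covariant α)).sum_repr' (D i))
  simpa [LinearMap.sum_apply] using h5

end IsEndAction

end Splitting

/-! ### The quantum graph of covariant maps -/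

section SplitGraph

variable {Γ : QuantumGraph.{u}} {K : Type u} [NormedAddCommGroup K] [InnerProductSpace ℂ K]
  [FiniteDimensional ℂ K] [Nontrivial K]
  {α : Γ.V →ₗ⋆[ℂ] Γ.V →ₗ[ℂ] ((K →ₗ[ℂ] K) →ₗ[ℂ] (K →ₗ[ℂ] K))}

/-- Evaluation of covariant maps. -/
def covariantCoef (α : Γ.V →ₗ⋆[ℂ] Γ.V →ₗ[ℂ] ((K →ₗ[ℂ] K) →ₗ[ℂ] (K →ₗ[ℂ] K))) :
    Γ.V →ₗ⋆[ℂ] covariant α →ₗ[ℂ] (K →ₗ[ℂ] K) :=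
  LinearMap.mk₂'ₛₗ (starRingEnd ℂ) (RingHom.id ℂ) (fun w c => c.1 w)
    (fun w w' c => map_add c.1 w w') (fun r w c => map_smulₛₗ c.1 r w)
    (fun _ _ _ => rfl) (fun _ _ _ => rfl)

namespace IsEndAction

/-- The multiplication of covariant maps. -/
def splitMul (hα : IsEndAction α) : covariant α ⊗[ℂ] covariant α →ₗ[ℂ] covariant α :=
  TensorProduct.lift (LinearMap.mk₂ ℂ
    (fun c d => ⟨conv Γ.mul c.1 d.1, hα.conv_mem c.2 d.2⟩)
    (fun c c' d => Subtype.ext (by simp)) (fun r c d => Subtype.ext (by simp))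
    (fun c d d' => Subtype.ext (by simp)) (fun r c d => Subtype.ext (by simp)))

/-- The unit covariant map. -/
def splitOne (hα : IsEndAction α) : covariant α := ⟨convOne K Γ.one, hα.convOne_mem⟩

/-- The involution of covariant maps. -/
def splitStar (hα : IsEndAction α) (c : covariant α) : covariant α :=
  ⟨convStar Γ.mul Γ.one c.1, hα.convStar_mem c.2⟩

/-- The adjacency operator on covariant maps. -/
def splitAdj (hα : IsEndAction α) : covariant α →ₗ[ℂ] covariant α where
  toFun c := ⟨c.1.comp Γ.adj, hα.comp_adj_mem c.2⟩
  map_add' _ _ := rfl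
  map_smul' _ _ := rfl

variable (hα : IsEndAction α)
include hα

lemma isMagic_covariantCoef :
    IsMagic hα.splitMul hα.splitOne Γ.mul Γ.one (covariantCoef α) where
  adjoint_mul_self c d := hα.sum_adjoint_mul c.2 d.2
  mul_adjoint_self w w' := hα.sum_mul_adjoint w w'
  map_mul _ _ _ := rfl
  map_one _ := rfl

lemma split_isDaggerFrobenius : IsDaggerFrobenius hα.splitMul hα.splitOne :=
  .of_inner_mul
    (fun a b c => Subtype.ext (conv_assoc Γ.frobenius Γ.symmetric a.1 b.1 c.1))
    (fun a => Subtype.ext (one_conv Γ.frobenius Γ.symmetric a.1))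
    (fun a => Subtype.ext (conv_one Γ.frobenius a.1)) hα.splitStar
    (fun a b c => inner_conv_left Γ.frobenius Γ.symmetric a.1 b.1 c.1)
    (fun a b c => inner_conv_right Γ.frobenius Γ.symmetric a.1 b.1 c.1)

lemma frobStar_split (c : covariant α) :
    frobStar hα.splitMul hα.splitOne c = hα.splitStar c := by
  refine ext_inner_left ℂ fun d => ?_
  rw [← hα.split_isDaggerFrobenius.inner_mul_one]
  refine (inner_conv_left Γ.frobenius Γ.symmetric c.1 d.1 (convOne K Γ.one)).trans ?_
  rw [conv_one Γ.frobenius]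
  rfl

lemma split_isSymm : IsSymm hα.splitMul hα.splitOne := fun c d => by
  rw [frobCap_tmul, frobCap_tmul, frobStar_split, frobStar_split]
  exact inner_convStar Γ.frobenius Γ.symmetric c.1 d.1

omit hα in
lemma covariant_ext {c d : covariant α} (h : ∀ w, covariantCoef α w c = covariantCoef α w d) :
    c = d := Subtype.ext (LinearMap.ext h)

lemma splitAdj_selfAdjoint : LinearMap.adjoint hα.splitAdj = hα.splitAdj := by
  symm
  rw [LinearMap.eq_adjoint_iff]
  intro c d
  refine (inner_eq_sum_trace (c.1.comp Γ.adj) d.1).trans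
    (Eq.trans ?_ (inner_eq_sum_trace c.1 (d.1.comp Γ.adj)).symm)
  have := sum_mul_adjoint_apply (adjCoef c.1) 1 d.1 Γ.adj
  simp only [mul_one, Γ.adj_selfAdjoint] at this
  congr 2

/-- The quantum graph of covariant maps. -/
def splitGraph : QuantumGraph.{u} where
  V := covariant α
  mul := hα.splitMul
  one := hα.splitOne
  frobenius := hα.split_isDaggerFrobenius
  special := hα.isMagic_covariantCoef.isSpecial (fun _ _ => covariant_ext) Γ.special
  symmetric := hα.split_isSymm
  adj := hα.splitAdj
  adj_selfAdjoint := hα.splitAdj_selfAdjoint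
  adj_schur := hα.isMagic_covariantCoef.mul_comp_map_comp_comul (fun _ _ => covariant_ext)
    (fun _ _ => rfl) (fun _ _ => rfl) (fun _ _ => rfl) Γ.adj_schur
  adj_transpose := by
    have h1 := (adjoint_eq_frobTranspose_iff Γ.frobenius Γ.frobenius Γ.adj).1
      (Γ.adj_selfAdjoint.trans Γ.adj_transpose.symm)
    rw [← (adjoint_eq_frobTranspose_iff hα.split_isDaggerFrobenius hα.split_isDaggerFrobenius _).2,
      hα.splitAdj_selfAdjoint]
    intro c
    refine covariant_ext fun w => ?_
    rw [frobStar_split, frobStar_split]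
    exact congrArg (fun v => LinearMap.adjoint (c.1 v)) (h1 w).symm
  adj_refl := hα.isMagic_covariantCoef.mul_comp_map_comp_comul (fun _ _ => covariant_ext)
    (fun _ _ => rfl) (fun _ _ => rfl) (fun _ _ => rfl) Γ.adj_refl

/-- The quantum isomorphism given by evaluation of covariant maps. -/
def splitIso : QuantumIso hα.splitGraph Γ where
  H := K
  P := ofCoef (covariantCoef α)
  isQuantumIso := (isQuantumIso_iff (Γ := hα.splitGraph) (Γ' := Γ) _).2
    ⟨by
      have h := hα.isMagic_covariantCoef
      rw [← coef_ofCoef (covariantCoef α)] at h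
      exact h, fun w v => by
      have h := coef_ofCoef (covariantCoef α)
      exact (LinearMap.congr_fun (LinearMap.congr_fun h w) _).trans
        (LinearMap.congr_fun (LinearMap.congr_fun h (Γ.adj w)) v).symm⟩

/-- Covariance moves `S` to the left of `c(w)` as an action, after which the coisometry relation
collapses the sum. So `α` is conjugation by the evaluation map. -/
lemma sum_covariant (w v : Γ.V) (S : K →ₗ[ℂ] K) : ∑ j, (onb (covariant α) j).1 w * S *
    LinearMap.adjoint ((onb (covariant α) j).1 v) = α w v S := by
  have h2 : ∀ j, (onb (covariant α) j).1 w * S =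
      ∑ i, α w (onb Γ.V i) S * (onb (covariant α) j).1 (onb Γ.V i) :=
    fun j => ((onb (covariant α) j).2 w S).symm
  simp only [h2, Finset.sum_mul]
  rw [Finset.sum_comm]
  simp only [mul_assoc, ← Finset.mul_sum, hα.sum_mul_adjoint, mul_smul_comm, mul_one,
    sum_inner_smul_apply]

lemma sum_splitIso (w v : Γ.V) (S : hα.splitIso.H →ₗ[ℂ] hα.splitIso.H) :
    ∑ j, coef hα.splitIso.P w (onb hα.splitGraph.V j) * S *
      LinearMap.adjoint (coef hα.splitIso.P v (onb hα.splitGraph.V j)) = α w v S := by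
  have hc : coef hα.splitIso.P = covariantCoef α := coef_ofCoef (covariantCoef α)
  rw [hc]
  exact hα.sum_covariant w v S

end IsEndAction

end SplitGraph

/-! ### Every simple monoid is presented -/

section EndAction

variable {Γ : QuantumGraph.{u}} {K : Type u} [NormedAddCommGroup K] [InnerProductSpace ℂ K]
  [FiniteDimensional ℂ K] [Nontrivial K] {X : MonoidData Γ}

/-- The action of the coefficients of `X` on `End K` along `L`. -/
def endAction (X : MonoidData Γ) (L : X.H ≃ₗ[ℂ] (K →ₗ[ℂ] K)) :
    Γ.V →ₗ⋆[ℂ] Γ.V →ₗ[ℂ] ((K →ₗ[ℂ] K) →ₗ[ℂ] (K →ₗ[ℂ] K)) :=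
  LinearMap.mk₂'ₛₗ (starRingEnd ℂ) (RingHom.id ℂ)
    (fun w v => L.toLinearMap ∘ₗ coef X.P w v ∘ₗ L.symm.toLinearMap)
    (fun _ _ _ => by ext1; simp) (fun _ _ _ => by ext1; simp)
    (fun _ _ _ => by ext1; simp) (fun _ _ _ => by ext1; simp)

lemma endAction_apply (L : X.H ≃ₗ[ℂ] (K →ₗ[ℂ] K)) (w v : Γ.V) (S : K →ₗ[ℂ] K) :
    endAction X L w v S = L (coef X.P w v (L.symm S)) := rfl

lemma MonoidData.IsDaggerFrobeniusMonoid.coef_one (hX : X.IsDaggerFrobeniusMonoid) (w v : Γ.V) :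
    coef X.P w v X.one = ⟪w, v⟫_ℂ • X.one := by
  rw [coef_apply, hX.intertwines_one, slice_tmul]

lemma MonoidData.IsDaggerFrobeniusMonoid.inner_one_coef (hX : X.IsDaggerFrobeniusMonoid)
    (w v : Γ.V) (a : X.H) : ⟪X.one, coef X.P w v a⟫_ℂ = ⟪w, v⟫_ℂ * ⟪X.one, a⟫_ℂ := by
  rw [← LinearMap.adjoint_inner_left, ← hX.isQuantumIso.coef_star, hX.coef_one, inner_smul_left,
    Γ.frobenius.inner_frobStar_frobStar Γ.symmetric, inner_conj_symm]

lemma MonoidData.IsDaggerFrobeniusMonoid.coef_mul (hX : X.IsDaggerFrobeniusMonoid)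
    (w v : Γ.V) (a b : X.H) : coef X.P w v (X.mul (a ⊗ₜ b)) =
      ∑ j, X.mul (coef X.P w (onb Γ.V j) a ⊗ₜ coef X.P (onb Γ.V j) v b) :=
  (intertwines_crossComp_iff _ _ _ _).1 hX.intertwines_mul w v a b

/-- Equivariance of the multiplication and of the counit make the pairing `⟪1, a b⟫ = ⟪a*, b⟫`
invariant. This determines the adjoint coefficients on `(coef w eⱼ a)*`, and unitarity then solves
for the involution. -/
lemma MonoidData.IsDaggerFrobeniusMonoid.frobStar_coef (hX : X.IsDaggerFrobeniusMonoid)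
    (w v : Γ.V) (a : X.H) : frobStar X.mul X.one (coef X.P w v a) =
      coef X.P v w (frobStar X.mul X.one a) := by
  have h1 : ∀ u, ∑ j, LinearMap.adjoint (coef X.P (onb Γ.V j) u)
      (frobStar X.mul X.one (coef X.P w (onb Γ.V j) a)) =
        ⟪u, w⟫_ℂ • frobStar X.mul X.one a := fun u => by
    refine ext_inner_right ℂ fun b => ?_
    simp only [sum_inner, LinearMap.adjoint_inner_left, inner_smul_left, inner_conj_symm,
      inner_frobStar]
    rw [← hX.inner_one_coef, hX.coef_mul, inner_sum]
  calc _ = ∑ u, coef X.P v (onb Γ.V u) (∑ j, LinearMap.adjoint (coef X.P (onb Γ.V j) (onb Γ.V u))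
        (frobStar X.mul X.one (coef X.P w (onb Γ.V j) a))) := by
        simp only [map_sum]
        rw [Finset.sum_comm]
        have h2 : ∀ j b, ∑ u, coef X.P v (onb Γ.V u)
            (LinearMap.adjoint (coef X.P (onb Γ.V j) (onb Γ.V u)) b) = ⟪v, onb Γ.V j⟫_ℂ • b := by
          intro j b
          have := congrArg (fun T => T b) (hX.isQuantumIso.isMagic.mul_adjoint_self v (onb Γ.V j))
          simpa [LinearMap.sum_apply] using this
        simp only [h2]
        have h3 := congrArg (fun T => frobStar X.mul X.one (T a)) (sum_coef_right (coef X.P) w v)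
        simpa [LinearMap.sum_apply] using h3.symm
    _ = _ := by
        simp only [h1, map_smul]
        have h3 := congrArg (fun T => T (frobStar X.mul X.one a)) (sum_coef_right (coef X.P) v w)
        simpa [LinearMap.sum_apply] using h3

lemma isEndAction_endAction (hX : X.IsDaggerFrobeniusMonoid) {L : X.H ≃ₗ[ℂ] (K →ₗ[ℂ] K)}
    (hL : IsMatrixRep X.mul X.one L) : IsEndAction (endAction X L) where
  apply_mul w v S T := by
    have h1 : L.symm (S * T) = X.mul (L.symm S ⊗ₜ L.symm T) := L.injective (by simp [hL.map_mul])
    simp only [endAction_apply, h1, hX.coef_mul, map_sum, hL.map_mul]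
  apply_one w v := by
    have h1 : L.symm 1 = X.one := L.injective (by simp [hL.map_one])
    simp only [endAction_apply, h1, hX.coef_one, map_smul, hL.map_one]
  apply_adjoint w v S := by
    have h1 : L.symm (LinearMap.adjoint S) = frobStar X.mul X.one (L.symm S) :=
      L.injective (by simp [hL.map_frobStar])
    simp only [endAction_apply, h1, ← hX.frobStar_coef, hL.map_frobStar]
  map_one w S := by
    simp [endAction_apply, hX.isQuantumIso.isMagic.map_one]
  map_mul w x y S := by
    simp [endAction_apply, hX.isQuantumIso.isMagic.map_mul, LinearMap.sum_apply]
  map_adj w v S := by simp [endAction_apply, hX.isQuantumIso.coef_adj]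
  sum_star v v' S := by
    have h1 := IsMagic.sum_star_mul Γ.frobenius Γ.frobenius Γ.symmetric
      hX.isQuantumIso.isMagic.map_mul hX.isQuantumIso.isMagic.counit v v'
    have h2 := congrArg (fun T => L (T (L.symm S))) h1
    simpa [LinearMap.sum_apply, endAction_apply] using h2

/-- Every simple dagger Frobenius monoid is presented by a quantum isomorphism. -/
theorem exists_presents (hX : X.IsSimple) : ∃ (Γ' : QuantumGraph.{u}) (P : QuantumIso Γ' Γ)
    (_ : Nontrivial P.H) (L : X.H ≃ₗ[ℂ] (P.H →ₗ[ℂ] P.H)), Presents X P L := by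
  obtain ⟨K, _, _, _, hK, f, hf⟩ := hX.simple
  obtain ⟨L, hL, -⟩ := (isStarIso_endMul_iff hX.isDaggerFrobeniusMonoid.frobenius f).1 hf
  have hα := isEndAction_endAction hX.isDaggerFrobeniusMonoid hL
  refine ⟨hα.splitGraph, hα.splitIso, hK, L, hL, fun w v a => ?_⟩
  refine Eq.trans ?_ (hα.sum_splitIso w v (L a)).symm
  rw [endAction_apply, L.symm_apply_apply]
  rfl

end EndAction

/-! ### One-dimensional quotients are graph isomorphisms -/

section Character

variable {Γ' Γ'' : QuantumGraph.{u}} {H : Type u} [NormedAddCommGroup H] [InnerProductSpace ℂ H]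
  [FiniteDimensional ℂ H]

/-- A one-dimensional quotient of a quantum isomorphism is an isomorphism of quantum graphs. -/
theorem IsQuantumIso.iso_of_character {W : H ⊗[ℂ] Γ''.V →ₗ[ℂ] Γ'.V ⊗[ℂ] H}
    (hW : IsQuantumIso Γ'' Γ' W) (χ : Γ'.V → Γ''.V → ℂ) (τ : H →ₗ[ℂ] ℂ) (hτ : τ ≠ 0)
    (hχ : ∀ x y h, τ (coef W x y h) = χ x y * τ h) : Γ''.Iso Γ' := by
  obtain ⟨t, ht⟩ := exists_eq_innerSL (LinearMap.toContinuousLinearMap τ)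
  have ht' : ∀ h, τ h = ⟪t, h⟫_ℂ := fun h => DFunLike.congr_fun ht h
  have ht0 : t ≠ 0 := by
    rintro rfl
    exact hτ (LinearMap.ext fun h => by simp [ht'])
  have htt : ⟪t, t⟫_ℂ ≠ 0 := fun h => ht0 (inner_self_eq_zero.1 h)
  have hadj : ∀ x y, LinearMap.adjoint (coef W x y) t = (starRingEnd ℂ) (χ x y) • t := by
    intro x y
    refine ext_inner_right ℂ fun h => ?_
    rw [LinearMap.adjoint_inner_left, ← ht', hχ, inner_smul_left, Complex.conj_conj, ht']
  -- The Riesz vector `t` of `τ` is a common eigenvector of the adjoint coefficients, and by the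
  -- star relation every coefficient is such an adjoint.
  have happ' : ∀ x y, coef W x y t = (starRingEnd ℂ) (χ (frobStar Γ'.mul Γ'.one x)
      (frobStar Γ''.mul Γ''.one y)) • t := by
    intro x y
    rw [← hadj, ← hW.coef_star, Γ'.frobenius.frobStar_frobStar, Γ''.frobenius.frobStar_frobStar]
  -- Applying `τ` to the eigenvector equation identifies the eigenvalue, as `τ t = ⟪t, t⟫ ≠ 0`. Thus
  -- `t` spans an invariant line on which the relations for `W` become scalar.
  have happ : ∀ x y, coef W x y t = χ x y • t := by
    intro x y
    have h1 := hχ x y t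
    rw [happ', map_smul, ht', smul_eq_mul] at h1
    rw [happ', mul_right_cancel₀ htt h1]
  -- The map with matrix `χ`, read off as `⟪t, coef W x y t⟫ / ⟪t, t⟫`; this also shows that `χ` is
  -- sesquilinear.
  let φ : Γ''.V →ₗ[ℂ] Γ'.V := (⟪t, t⟫_ℂ)⁻¹ • ∑ i, LinearMap.smulRight
    (innerₛₗ ℂ t ∘ₗ LinearMap.applyₗ t ∘ₗ coef W (onb Γ'.V i)) (onb Γ'.V i)
  have hφ : ∀ x y, ⟪x, φ y⟫_ℂ = χ x y := by
    intro x y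
    have h1 := congrArg (fun T => ⟪t, T t⟫_ℂ) (sum_coef_left (coef W) x y)
    simp only [LinearMap.sum_apply, LinearMap.smul_apply, inner_sum, inner_smul_right, happ] at h1
    simp only [φ, LinearMap.smul_apply, LinearMap.sum_apply, LinearMap.smulRight_apply,
      LinearMap.comp_apply, LinearMap.applyₗ_apply_apply, innerₛₗ_apply_apply, inner_smul_right,
      inner_sum, happ]
    rw [Finset.sum_congr rfl fun i _ => mul_comm _ _, h1, mul_comm (χ x y),
      inv_mul_cancel_left₀ htt]
  have hc : ∀ x y, coef W x y t = ⟪x, φ y⟫_ℂ • t := fun x y => by rw [happ, hφ]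
  have hca : ∀ x y, LinearMap.adjoint (coef W x y) t = ⟪φ y, x⟫_ℂ • t := fun x y => by
    rw [hadj, ← hφ, inner_conj_symm]
  have hinj : ∀ {r r' : ℂ}, r • t = r' • t → r = r' := fun h => smul_left_injective ℂ ht0 h
  have hU1 : ∀ y y', ⟪φ y, φ y'⟫_ℂ = ⟪y, y'⟫_ℂ := fun y y' => by
    have h1 := congrArg (fun T => T t) (hW.isMagic.adjoint_mul_self y y')
    simp only [LinearMap.sum_apply, Module.End.mul_apply, hc, map_smul, hca, smul_smul,
      LinearMap.smul_apply, Module.End.one_apply, ← Finset.sum_smul] at h1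
    rw [← hinj h1, ← (onb Γ'.V).sum_inner_mul_inner]
    exact Finset.sum_congr rfl fun i _ => mul_comm _ _
  have hsurj : Function.Surjective φ := by
    rw [← LinearMap.range_eq_top, ← Submodule.orthogonal_eq_bot_iff, Submodule.eq_bot_iff]
    intro w hw
    have h1 := congrArg (fun T => T t) (hW.isMagic.mul_adjoint_self w w)
    have h2 : ∀ y, ⟪w, φ y⟫_ℂ = 0 := fun y =>
      inner_eq_zero_symm.1 ((Submodule.mem_orthogonal _ _).1 hw _ ⟨y, rfl⟩)
    simp only [LinearMap.sum_apply, Module.End.mul_apply, hca, map_smul, hc, h2, zero_smul,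
      smul_zero, Finset.sum_const_zero, LinearMap.smul_apply, Module.End.one_apply] at h1
    exact inner_self_eq_zero.1 ((smul_eq_zero.1 h1.symm).resolve_right ht0)
  refine iso_iff.2 ⟨LinearIsometryEquiv.ofSurjective (φ.isometryOfInner hU1) hsurj,
    fun y y' => ?_, ?_, fun y => ?_⟩
  · refine ext_inner_left ℂ fun x => hinj ?_
    refine (hc x _).symm.trans ?_
    rw [hW.isMagic.map_mul]
    simp only [LinearMap.sum_apply, LinearMap.smul_apply, Module.End.mul_apply, hc, map_smul,
      smul_smul, ← Finset.sum_smul]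
    congr 1
    change _ = ⟪x, Γ'.mul (φ y ⊗ₜ φ y')⟫_ℂ
    conv_rhs => rw [← (onb Γ'.V).sum_repr' (φ y), ← (onb Γ'.V).sum_repr' (φ y')]
    simp only [TensorProduct.sum_tmul, TensorProduct.tmul_sum, map_sum, inner_sum,
      ← TensorProduct.smul_tmul', TensorProduct.tmul_smul, map_smul, inner_smul_right, Finset.mul_sum]
    refine Eq.trans (Finset.sum_congr rfl fun s _ => Finset.sum_congr rfl fun t _ => ?_)
      Finset.sum_comm
    ring
  · refine ext_inner_left ℂ fun x => hinj ?_
    refine (hc x _).symm.trans ?_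
    rw [hW.isMagic.map_one]
    rfl
  · refine ext_inner_left ℂ fun x => hinj ?_
    refine (hc x _).symm.trans ?_
    have h1 : ⟪Γ'.adj x, φ y⟫_ℂ = ⟪x, Γ'.adj (φ y)⟫_ℂ := by
      rw [← LinearMap.adjoint_inner_left Γ'.adj, Γ'.adj_selfAdjoint]
    rw [hW.coef_adj, hc, h1]
    rfl

end Character

/-! ### Schur's lemma for invertible bimodules -/

section Schur

variable {A B H K M N : Type*} [NormedAddCommGroup H] [InnerProductSpace ℂ H]
  [FiniteDimensional ℂ H] [NormedAddCommGroup K] [InnerProductSpace ℂ K] [FiniteDimensional ℂ K]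
  [NormedAddCommGroup A] [InnerProductSpace ℂ A] [FiniteDimensional ℂ A]
  [NormedAddCommGroup B] [InnerProductSpace ℂ B] [FiniteDimensional ℂ B]
  [NormedAddCommGroup M] [InnerProductSpace ℂ M] [FiniteDimensional ℂ M]
  [NormedAddCommGroup N] [InnerProductSpace ℂ N] [FiniteDimensional ℂ N]
  {mA : A ⊗[ℂ] A →ₗ[ℂ] A} {eA : A} {mB : B ⊗[ℂ] B →ₗ[ℂ] B} {eB : B}
  {L : A ≃ₗ[ℂ] (H →ₗ[ℂ] H)} {R : B ≃ₗ[ℂ] (K →ₗ[ℂ] K)}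
  {ρ : A ⊗[ℂ] (M ⊗[ℂ] B) →ₗ[ℂ] M} {σ : B ⊗[ℂ] (N ⊗[ℂ] A) →ₗ[ℂ] N}

lemma sum_ketBra (K : Type*) [NormedAddCommGroup K] [InnerProductSpace ℂ K]
    [FiniteDimensional ℂ K] : ∑ i, ketBra (onb K i) (onb K i) = (1 : K →ₗ[ℂ] K) := by
  ext k
  simp only [LinearMap.sum_apply, ketBra_apply, (onb K).sum_repr', Module.End.one_apply]

lemma IsMatrixRep.frobStar_one (hL : IsMatrixRep mA eA L) : frobStar mA eA eA = eA :=
  L.injective (by rw [hL.map_frobStar, hL.map_one, adjoint_one])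

/-- A nonzero left `B`-module contains a copy of `K`. Pairing the second factor with vectors of that
copy extracts the matrix entries of the second leg of the cup; summed over an orthonormal basis of
`K` they form a trace, which contracts the cup to the unit and leaves `m`. -/
lemma relIdem_faithful (hR : IsMatrixRep mB eB R) (hL : IsMatrixRep mA eA L)
    (hρ : IsDaggerBimodule mA eA mB eB ρ) (hσ : IsDaggerBimodule mB eB mA eA σ) [Nontrivial N] [Nontrivial K]
    {m : M} (hm : ∀ n, relIdem (frobCup mB eB) (rightAct eA ρ) (leftAct eA σ) (m ⊗ₜ n) = 0) :
    m = 0 := by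
  have hK : (Module.finrank ℂ K : ℂ) ≠ 0 := finrank_ne_zero
  have hA := hL.isDaggerFrobenius
  have hB := hR.isDaggerFrobenius
  let l : (K →ₗ[ℂ] K) → N → N := fun S n => σ (R.symm S ⊗ₜ (n ⊗ₜ eA))
  have l_mul : ∀ S S' n, l (S * S') n = l S (l S' n) := fun S S' n => by
    have h1 : R.symm (S * S') = mB (R.symm S ⊗ₜ R.symm S') := R.injective (by simp [hR.map_mul])
    have := hσ.mul_act (R.symm S) (R.symm S') n eA eA
    rw [hA.one_mul] at this
    simp only [l, h1, this]
  have l_adj : ∀ S n n', ⟪l (LinearMap.adjoint S) n, n'⟫_ℂ = ⟪n, l S n'⟫_ℂ := fun S n n' => by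
    have h1 : R.symm (LinearMap.adjoint S) = frobStar mB eB (R.symm S) :=
      R.injective (by simp [hR.map_frobStar])
    have := (dagger_iff hL.isSymm σ).1 hσ.dagger (R.symm S) n' eA n
    rw [hL.frobStar_one] at this
    simp only [l, h1, this]
  obtain ⟨n, hn⟩ := exists_ne (0 : N)
  have hν : ∑ i, ⟪n, l (ketBra (onb K i) (onb K i)) n⟫_ℂ = ⟪n, n⟫_ℂ := by
    have h1 : l 1 n = n := by
      have h1 : R.symm 1 = eB := R.injective (by simp [hR.map_one])
      simp only [l, h1, hσ.one_act]
    have h2 := congrArg (fun z => ⟪n, z⟫_ℂ) h1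
    rw [← sum_ketBra K] at h2
    simp only [l, map_sum, TensorProduct.sum_tmul, inner_sum] at h2
    exact h2
  -- The rank-one projections sum to the identity, so one of them does not kill `n`; the vectors `l
  -- (ketBra k eᵢ) n` then form a copy of `K` in `N`.
  obtain ⟨i, -, hi⟩ := Finset.exists_ne_zero_of_sum_ne_zero
    (hν.trans_ne (inner_self_ne_zero.2 hn))
  have h1 : ∀ m' k, ∑ s, ⟪m', ρ (eA ⊗ₜ (m ⊗ₜ onb B s))⟫_ℂ *
      ⟪k, R (frobStar mB eB (onb B s)) k⟫_ℂ = 0 := by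
    intro m' k
    have h2 := congrArg (fun z => ⟪m' ⊗ₜ[ℂ] l (ketBra k (onb K i)) n, z⟫_ℂ)
      (hm (l (ketBra k (onb K i)) n))
    simp only [relIdem_tmul hB, inner_sum, TensorProduct.inner_tmul, inner_zero_right] at h2
    have h3 : ∀ s, ⟪l (ketBra k (onb K i)) n, leftAct eA σ (frobStar mB eB (onb B s))
        (l (ketBra k (onb K i)) n)⟫_ℂ = ⟪k, R (frobStar mB eB (onb B s)) k⟫_ℂ *
          ⟪n, l (ketBra (onb K i) (onb K i)) n⟫_ℂ := by
      intro s
      have h4 : leftAct eA σ (frobStar mB eB (onb B s)) (l (ketBra k (onb K i)) n) =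
          l (R (frobStar mB eB (onb B s))) (l (ketBra k (onb K i)) n) := by
        simp only [l, R.symm_apply_apply, leftAct_apply]
      have h5 : ketBra (onb K i) k * (R (frobStar mB eB (onb B s)) * ketBra k (onb K i)) =
          ⟪k, R (frobStar mB eB (onb B s)) k⟫_ℂ • ketBra (onb K i) (onb K i) := by
        ext z
        simp only [Module.End.mul_apply, ketBra_apply, map_smul, inner_smul_right,
          LinearMap.smul_apply, smul_smul, mul_comm]
      have h6 := l_adj (ketBra (onb K i) k) n
        (l (R (frobStar mB eB (onb B s))) (l (ketBra k (onb K i)) n))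
      rw [adjoint_ketBra] at h6
      rw [h4, h6, ← l_mul, ← l_mul, mul_assoc, h5]
      simp only [l, map_smul, ← TensorProduct.smul_tmul', inner_smul_right]
    simp only [h3, ← mul_assoc, ← Finset.sum_mul, rightAct_apply] at h2
    exact (mul_eq_zero.1 h2).resolve_right hi
  refine ext_inner_left ℂ fun m' => ?_
  have h2 : ∀ s, ∑ j, ⟪onb K j, R (frobStar mB eB (onb B s)) (onb K j)⟫_ℂ =
      (Module.finrank ℂ K : ℂ)⁻¹ * ⟪onb B s, eB⟫_ℂ := by
    intro s
    rw [hR.inner_eq, hR.map_one, mul_one, inv_mul_cancel_left₀ hK,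
      LinearMap.trace_eq_sum_inner _ (onb K), hR.map_frobStar]
  have h3 : ∑ s, ⟪m', ρ (eA ⊗ₜ (m ⊗ₜ onb B s))⟫_ℂ *
      ((Module.finrank ℂ K : ℂ)⁻¹ * ⟪onb B s, eB⟫_ℂ) = 0 := by
    simp only [← h2, Finset.mul_sum]
    rw [Finset.sum_comm]
    exact Finset.sum_eq_zero fun j _ => h1 m' _
  have h4 := sum_inner_smul_right
    (innerₛₗ ℂ m' ∘ₗ ρ ∘ₗ TensorProduct.mk ℂ A (M ⊗[ℂ] B) eA ∘ₗ TensorProduct.mk ℂ M B m) eB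
  simp only [LinearMap.comp_apply, TensorProduct.mk_apply, innerₛₗ_apply_apply, hρ.one_act,
    smul_eq_mul] at h4
  rw [inner_zero_right, ← h4, ← mul_right_inj' (inv_ne_zero hK), mul_zero, ← h3, Finset.mul_sum]
  exact Finset.sum_congr rfl fun s _ => by ring

variable {κ : M ⊗[ℂ] N →ₗ[ℂ] A}

lemma nontrivial_of_comp_adjoint [Nontrivial A] (hκ : κ ∘ₗ LinearMap.adjoint κ = LinearMap.id) :
    Nontrivial M ∧ Nontrivial N := by
  obtain ⟨a, ha⟩ := exists_ne (0 : A)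
  have hne : κ ≠ 0 := by
    rintro rfl
    exact ha (by simpa using (LinearMap.congr_fun hκ a).symm)
  constructor
  · by_contra h
    rw [not_nontrivial_iff_subsingleton] at h
    exact hne (TensorProduct.ext' fun x y => by simp [Subsingleton.elim x 0])
  · by_contra h
    rw [not_nontrivial_iff_subsingleton] at h
    exact hne (TensorProduct.ext' fun x y => by simp [Subsingleton.elim y 0])

/-- Schur's lemma for a bimodule with an inverse. -/
theorem exists_smul_of_bimodule_map (hL : IsMatrixRep mA eA L) (hR : IsMatrixRep mB eB R)
    (hρ : IsDaggerBimodule mA eA mB eB ρ) (hσ : IsDaggerBimodule mB eB mA eA σ) [Nontrivial N] [Nontrivial K]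
    (hκ : κ ∘ₗ LinearMap.adjoint κ = LinearMap.id)
    (hκ' : LinearMap.adjoint κ ∘ₗ κ =
      relIdem (frobCup mB eB) (rightAct eA ρ) (leftAct eA σ))
    (hact : ∀ a c, κ ∘ₗ TensorProduct.map (leftAct eB ρ a) (rightAct eB σ c) ∘ₗ
      LinearMap.adjoint κ = mA ∘ₗ (TensorProduct.mk ℂ A A).flip c ∘ₗ mA ∘ₗ TensorProduct.mk ℂ A A a)
    {G : M →ₗ[ℂ] M} (hG : ∀ a m b, G (ρ (a ⊗ₜ (m ⊗ₜ b))) = ρ (a ⊗ₜ (G m ⊗ₜ b))) :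
    ∃ r : ℂ, ∀ m, G m = r • m := by
  have hA := hL.isDaggerFrobenius
  have hB := hR.isDaggerFrobenius
  set p := relIdem (frobCup mB eB) (rightAct eA ρ) (leftAct eA σ) with hp
  let Λ : A → A → (M ⊗[ℂ] N →ₗ[ℂ] M ⊗[ℂ] N) := fun a c =>
    TensorProduct.map (leftAct eB ρ a) (rightAct eB σ c)
  let G₁ : M ⊗[ℂ] N →ₗ[ℂ] M ⊗[ℂ] N := TensorProduct.map G LinearMap.id
  have hpΛ : ∀ a c, p ∘ₗ Λ a c = Λ a c ∘ₗ p := fun a c => by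
    refine TensorProduct.ext' fun x y => ?_
    simp only [LinearMap.comp_apply, Λ, TensorProduct.map_tmul, hp, relIdem_tmul hB, map_sum,
      rightAct_apply, leftAct_apply]
    refine Finset.sum_congr rfl fun s _ => ?_
    rw [← hρ.mul_act, ← hρ.mul_act, ← hσ.mul_act, ← hσ.mul_act]
    simp only [hA.one_mul, hA.mul_one, hB.one_mul, hB.mul_one]
  have hpG : p ∘ₗ G₁ = G₁ ∘ₗ p := by
    refine TensorProduct.ext' fun x y => ?_
    simp only [LinearMap.comp_apply, G₁, TensorProduct.map_tmul, hp, relIdem_tmul hB, map_sum,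
      rightAct_apply, leftAct_apply, hG, LinearMap.id_apply]
  have hGΛ : ∀ a c, G₁ ∘ₗ Λ a c = Λ a c ∘ₗ G₁ := fun a c => by
    refine TensorProduct.ext' fun x y => ?_
    simp only [LinearMap.comp_apply, G₁, Λ, TensorProduct.map_tmul, leftAct_apply, hG,
      LinearMap.id_apply]
  have hκp : ∀ z, κ (p z) = κ z := fun z => by
    rw [← hκ']
    exact LinearMap.congr_fun hκ (κ z)
  have hκκ : ∀ z, LinearMap.adjoint κ (κ z) = p z := fun z => LinearMap.congr_fun hκ' z
  have hκκ' : ∀ z, κ (LinearMap.adjoint κ z) = z := fun z => LinearMap.congr_fun hκ z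
  have cpΛ : ∀ a c z, p (Λ a c z) = Λ a c (p z) := fun a c z => LinearMap.congr_fun (hpΛ a c) z
  have cpG : ∀ z, p (G₁ z) = G₁ (p z) := fun z => LinearMap.congr_fun hpG z
  have cGΛ : ∀ a c z, G₁ (Λ a c z) = Λ a c (G₁ z) := fun a c z => LinearMap.congr_fun (hGΛ a c) z
  have cact : ∀ a c z, κ (Λ a c (LinearMap.adjoint κ z)) = mA (mA (a ⊗ₜ z) ⊗ₜ c) :=
    fun a c z => LinearMap.congr_fun (hact a c) z
  have cκΛ : ∀ a c z, κ (Λ a c z) = mA (mA (a ⊗ₜ κ z) ⊗ₜ c) := fun a c z => by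
    rw [← cact, hκκ, ← cpΛ, hκp]
  -- Since `G ⊗ 1` commutes with the idempotent `p` and with the outer actions, it descends to a
  -- bimodule endomorphism of `A`. Such a map is multiplication by `g(1)`, a central element of `A ≅
  -- End H`.
  let g : A →ₗ[ℂ] A := κ ∘ₗ G₁ ∘ₗ LinearMap.adjoint κ
  have hg : ∀ z, g (κ z) = κ (G₁ z) := fun z => by
    change κ (G₁ (LinearMap.adjoint κ (κ z))) = _
    rw [hκκ, ← cpG, hκp]
  have hgm : ∀ a z c, g (mA (mA (a ⊗ₜ z) ⊗ₜ c)) = mA (mA (a ⊗ₜ g z) ⊗ₜ c) := fun a z c => by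
    rw [← cact, hg, cGΛ, cκΛ]
    rfl
  have hl : ∀ a, g a = mA (a ⊗ₜ g eA) := fun a => by
    have := hgm a eA eA
    rwa [hA.mul_one, hA.mul_one, hA.mul_one] at this
  have hr : ∀ a, g a = mA (g eA ⊗ₜ a) := fun a => by
    have := hgm eA eA a
    rwa [hA.one_mul, hA.one_mul, hA.one_mul] at this
  have hmem := (Algebra.IsCentral.center_eq_bot ℂ (Module.End ℂ H)).le
    (Subalgebra.mem_center_iff.2 fun S : H →ₗ[ℂ] H => (by
      have := congrArg L ((hl (L.symm S)).symm.trans (hr (L.symm S)))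
      rwa [hL.map_mul, hL.map_mul, L.apply_symm_apply] at this : S * L (g eA) = L (g eA) * S))
  obtain ⟨r, hr0⟩ := Algebra.mem_bot.1 hmem
  have hge : g eA = r • eA := L.injective (by rw [← hr0, map_smul, hL.map_one]; rfl)
  -- The vectors `(G m - r m) ⊗ n` vanish in the relative tensor product for every `n`, so
  -- faithfulness gives `G m = r m`.
  refine ⟨r, fun m => sub_eq_zero.1 (relIdem_faithful hR hL hρ hσ fun n => ?_)⟩
  have h1 : κ ((G m - r • m) ⊗ₜ n) = 0 := by
    have h2 := hg (m ⊗ₜ n)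
    rw [hr, hge, ← TensorProduct.smul_tmul', map_smul, hA.one_mul] at h2
    rw [TensorProduct.sub_tmul, map_sub, ← TensorProduct.smul_tmul', map_smul, h2]
    exact sub_self _
  rw [← hp, ← hκκ, h1, map_zero]

end Schur

/-! ### Morita equivalent monoids come from isomorphic graphs -/

section Morita

variable {Γ Γ' Γ'' : QuantumGraph.{u}} {X Y : MonoidData Γ} {P : QuantumIso Γ' Γ}
  {Q : QuantumIso Γ'' Γ} {L : X.H ≃ₗ[ℂ] (P.H →ₗ[ℂ] P.H)} {R : Y.H ≃ₗ[ℂ] (Q.H →ₗ[ℂ] Q.H)}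

lemma Presents.adjoint_mul (h : Presents X P L) (v : Γ.V) (x : Γ'.V) (a : X.H) :
    ∑ k, LinearMap.adjoint (coef P.P (onb Γ.V k) x) * L (coef X.P (onb Γ.V k) v a) =
      L a * LinearMap.adjoint (coef P.P v x) := by
  simp only [h.conj, Finset.mul_sum]
  rw [Finset.sum_comm]
  simp only [← mul_assoc, ← Finset.sum_mul, P.isQuantumIso.isMagic.adjoint_mul_self]
  simp only [smul_mul_assoc, one_mul, ← mul_smul_comm, ← Finset.mul_sum]
  have h1 := congrArg LinearMap.adjoint (sum_coef_right (coef P.P) v x)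
  simp only [map_sum, QG.adjoint_smul, inner_conj_symm] at h1
  rw [← h1]

/-- The endomorphism of a bimodule `M` with coefficient `(x, y)` obtained from `P̄ ∘ M ∘ Q`. -/
def sandwich (P : QuantumIso Γ' Γ) (Q : QuantumIso Γ'' Γ) (L : X.H ≃ₗ[ℂ] (P.H →ₗ[ℂ] P.H))
    (R : Y.H ≃ₗ[ℂ] (Q.H →ₗ[ℂ] Q.H)) (M : DaggerBimodule X Y) (x : Γ'.V) (y : Γ''.V) :
    M.obj.H →ₗ[ℂ] M.obj.H :=
  ∑ k, ∑ l, M.act ∘ₗ TensorProduct.mk ℂ X.H (M.obj.H ⊗[ℂ] Y.H)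
      (L.symm (LinearMap.adjoint (coef P.P (onb Γ.V k) x))) ∘ₗ
    (TensorProduct.mk ℂ M.obj.H Y.H).flip (R.symm (coef Q.P (onb Γ.V l) y)) ∘ₗ
      coef M.obj.P (onb Γ.V k) (onb Γ.V l)

lemma sandwich_apply (M : DaggerBimodule X Y) (x : Γ'.V) (y : Γ''.V) (m : M.obj.H) :
    sandwich P Q L R M x y m = ∑ k, ∑ l,
      M.act (L.symm (LinearMap.adjoint (coef P.P (onb Γ.V k) x)) ⊗ₜ
        (coef M.obj.P (onb Γ.V k) (onb Γ.V l) m ⊗ₜ R.symm (coef Q.P (onb Γ.V l) y))) := by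
  simp [sandwich, LinearMap.sum_apply]

/-- Equivariance of the action spreads `a` and `b` into their coefficients, and `adjoint_mul` and
`conj_mul` reabsorb these on the far side of `P†` and `Q`. Schur's lemma can then be applied to the
sandwich. -/
lemma sandwich_act (hX : Presents X P L) (hY : Presents Y Q R) (M : DaggerBimodule X Y) (x : Γ'.V)
    (y : Γ''.V) (a : X.H) (m : M.obj.H) (b : Y.H) :
    sandwich P Q L R M x y (M.act (a ⊗ₜ (m ⊗ₜ b))) =
      M.act (a ⊗ₜ (sandwich P Q L R M x y m ⊗ₜ b)) := by
  have h1 : ∀ i, ∑ k, X.mul (L.symm (LinearMap.adjoint (coef P.P (onb Γ.V k) x)) ⊗ₜ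
      coef X.P (onb Γ.V k) (onb Γ.V i) a) =
        X.mul (a ⊗ₜ L.symm (LinearMap.adjoint (coef P.P (onb Γ.V i) x))) := fun i => by
    apply L.injective
    simp only [map_sum, hX.rep.map_mul, L.apply_symm_apply, hX.adjoint_mul]
  have h2 : ∀ j, ∑ l, Y.mul (coef Y.P (onb Γ.V j) (onb Γ.V l) b ⊗ₜ
      R.symm (coef Q.P (onb Γ.V l) y)) =
        Y.mul (R.symm (coef Q.P (onb Γ.V j) y) ⊗ₜ b) := fun j => by
    apply R.injective
    simp only [map_sum, hY.rep.map_mul, R.apply_symm_apply, hY.conj_mul]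
  have hM := (intertwines_crossComp₃_iff _ _ _ _).1 M.intertwines
  simp only [sandwich_apply, hM, TensorProduct.sum_tmul, TensorProduct.tmul_sum, map_sum,
    ← M.isDaggerBimodule.mul_act, ← h1, ← h2]
  rw [sum_comm_pairs]
  exact Finset.sum_congr rfl fun _ _ => Finset.sum_congr rfl fun _ _ => Finset.sum_comm

/-- The functional on `P̄ ∘ M ∘ Q` on which its coefficients act by scalars. -/
def sandwichFunctional (P : QuantumIso Γ' Γ) (Q : QuantumIso Γ'' Γ)
    (L : X.H ≃ₗ[ℂ] (P.H →ₗ[ℂ] P.H)) (R : Y.H ≃ₗ[ℂ] (Q.H →ₗ[ℂ] Q.H)) (M : DaggerBimodule X Y)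
    (h : P.H) (k : Q.H) (m : M.obj.H) :
    StrongDual ℂ P.H ⊗[ℂ] (M.obj.H ⊗[ℂ] Q.H) →ₗ[ℂ] ℂ :=
  innerₛₗ ℂ m ∘ₗ M.act ∘ₗ TensorProduct.map
    (L.symm.toLinearMap ∘ₗ
      { toFun := fun f : StrongDual ℂ P.H => (f : P.H →ₗ[ℂ] ℂ).smulRight h
        map_add' := fun f g => by ext; simp [add_smul]
        map_smul' := fun r f => by ext; simp [mul_smul] })
    (TensorProduct.map LinearMap.id (R.symm.toLinearMap ∘ₗ
      { toFun := fun q : Q.H => ketBra q k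
        map_add' := fun _ _ => by ext; simp
        map_smul' := fun r _ => by ext; exact smul_comm _ r _ }))

lemma sandwichFunctional_tmul (M : DaggerBimodule X Y) (h : P.H) (k q : Q.H) (m n : M.obj.H)
    (f : StrongDual ℂ P.H) : sandwichFunctional P Q L R M h k m (f ⊗ₜ (n ⊗ₜ q)) =
      ⟪m, M.act (L.symm ((f : P.H →ₗ[ℂ] ℂ).smulRight h) ⊗ₜ (n ⊗ₜ R.symm (ketBra q k)))⟫_ℂ := rfl

/-- The coefficients acting on `H*` and on the space of `Q` are absorbed by the rank-one operators
as products, and the bimodule law moves these products inside, next to the coefficient of `M`. What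
appears is the sandwich, which acts by `r`. -/
lemma sandwichFunctional_coef (hX : Presents X P L) (hY : Presents Y Q R) (M : DaggerBimodule X Y)
    (h : P.H) (k : Q.H) (m : M.obj.H) {x : Γ'.V} {y : Γ''.V} {r : ℂ}
    (hr : ∀ n, sandwich P Q L R M x y n = r • n)
    (z : StrongDual ℂ P.H ⊗[ℂ] (M.obj.H ⊗[ℂ] Q.H)) :
    sandwichFunctional P Q L R M h k m
      (coef (crossComp (crossDual P.P) (crossComp M.obj.P Q.P)) x y z) =
        r * sandwichFunctional P Q L R M h k m z := by
  induction z using TensorProduct.induction_on with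
  | zero => simp
  | add z z' hz hz' => simp only [map_add, hz, hz', mul_add]
  | tmul f z =>
    induction z using TensorProduct.induction_on with
    | zero => simp
    | add z z' hz hz' => simp only [TensorProduct.tmul_add, map_add, hz, hz', mul_add]
    | tmul n q =>
      have h1 : ∀ j, L.symm (((conjEnd (coef P.P (onb Γ.V j) x) f : StrongDual ℂ P.H) :
          P.H →ₗ[ℂ] ℂ).smulRight h) = X.mul (L.symm ((f : P.H →ₗ[ℂ] ℂ).smulRight h) ⊗ₜ
            L.symm (LinearMap.adjoint (coef P.P (onb Γ.V j) x))) := fun j => by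
        apply L.injective
        rw [hX.rep.map_mul]
        simp only [L.apply_symm_apply]
        ext1 w
        rfl
      have h2 : ∀ j, R.symm (ketBra (coef Q.P (onb Γ.V j) y q) k) =
          Y.mul (R.symm (coef Q.P (onb Γ.V j) y) ⊗ₜ R.symm (ketBra q k)) := fun j => by
        apply R.injective
        rw [hY.rep.map_mul]
        simp only [R.apply_symm_apply]
        ext1 w
        simp
      have h3 : M.act (L.symm ((f : P.H →ₗ[ℂ] ℂ).smulRight h) ⊗ₜ
          (sandwich P Q L R M x y n ⊗ₜ R.symm (ketBra q k))) = r • M.act (L.symm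
            ((f : P.H →ₗ[ℂ] ℂ).smulRight h) ⊗ₜ (n ⊗ₜ R.symm (ketBra q k))) := by
        rw [hr, ← TensorProduct.smul_tmul', TensorProduct.tmul_smul, map_smul]
      have h4 := congrArg (fun n => ⟪m, n⟫_ℂ) h3
      simp only [inner_smul_right] at h4
      rw [sandwichFunctional_tmul, ← h4]
      simp only [coef_crossComp_tmul, coef_crossDual, TensorProduct.tmul_sum, map_sum,
        sandwichFunctional_tmul, h1, h2, sandwich_apply, TensorProduct.sum_tmul, inner_sum,
        M.isDaggerBimodule.mul_act]

/-- If all functionals vanished, every `|eᵢ⟩⟨eᵢ| · m · |eⱼ⟩⟨eⱼ|` would have norm zero, although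
these vectors sum to `m`. -/
lemma exists_sandwichFunctional_ne_zero (hX : Presents X P L) (hY : Presents Y Q R)
    (M : DaggerBimodule X Y) [Nontrivial M.obj.H] :
    ∃ h k m, sandwichFunctional P Q L R M h k m ≠ 0 := by
  obtain ⟨m, hm⟩ := exists_ne (0 : M.obj.H)
  by_contra! hall
  have h0 : ∀ i j, M.act (L.symm (ketBra (onb P.H i) (onb P.H i)) ⊗ₜ
      (m ⊗ₜ R.symm (ketBra (onb Q.H j) (onb Q.H j)))) = 0 := fun i j => by
    have h1 := LinearMap.congr_fun (hall (onb P.H i) (onb Q.H j) (M.act (L.symm (ketBra (onb P.H i)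
      (onb P.H i)) ⊗ₜ (m ⊗ₜ R.symm (ketBra (onb Q.H j) (onb Q.H j))))))
      (innerSL ℂ (onb P.H i) ⊗ₜ (m ⊗ₜ onb Q.H j))
    rw [sandwichFunctional_tmul] at h1
    exact inner_self_eq_zero.1 h1
  have h1 : L.symm 1 = X.one := L.injective (by simp [hX.rep.map_one])
  have h2 : R.symm 1 = Y.one := R.injective (by simp [hY.rep.map_one])
  apply hm
  rw [← M.isDaggerBimodule.one_act m, ← h1, ← h2, ← sum_ketBra P.H, ← sum_ketBra Q.H]
  simp only [map_sum, TensorProduct.sum_tmul, TensorProduct.tmul_sum, h0, Finset.sum_const_zero]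

/-- Graphs presenting Morita equivalent monoids are isomorphic. -/
theorem iso_of_moritaEquivalent (hX : Presents X P L) (hY : Presents Y Q R) [Nontrivial P.H]
    [Nontrivial Q.H] (h : X.MoritaEquivalent Y) : Γ''.Iso Γ' := by
  obtain ⟨M, N, ⟨T, i, hi, U, -, hU, hU', hact⟩, -⟩ := h
  -- Combines the splitting and the unitary into a single coisometry onto `X` with `κ† κ` the
  -- relative tensor idempotent. The second trivialisation `N ⊗ M ≅ Y` is not needed.
  let κ : M.obj.H ⊗[ℂ] N.obj.H →ₗ[ℂ] X.H := U ∘ₗ LinearMap.adjoint i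
  have hadj : LinearMap.adjoint κ = i ∘ₗ LinearMap.adjoint U := by
    rw [LinearMap.adjoint_comp, LinearMap.adjoint_adjoint]
  have hκ : κ ∘ₗ LinearMap.adjoint κ = LinearMap.id := by
    rw [hadj]
    calc _ = U ∘ₗ (LinearMap.adjoint i ∘ₗ i) ∘ₗ LinearMap.adjoint U := rfl
      _ = _ := by rw [hi.splitting.adjoint_comp, LinearMap.id_comp, hU']
  have hκ' : LinearMap.adjoint κ ∘ₗ κ = relIdem (frobCup Y.mul Y.one)
      (rightAct X.one M.act) (leftAct X.one N.act) := by
    rw [hadj]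
    calc _ = i ∘ₗ (LinearMap.adjoint U ∘ₗ U) ∘ₗ LinearMap.adjoint i := rfl
      _ = _ := by rw [hU, LinearMap.id_comp, hi.splitting.comp_adjoint]
  have hκact : ∀ a c, κ ∘ₗ TensorProduct.map (leftAct Y.one M.act a) (rightAct Y.one N.act c) ∘ₗ
      LinearMap.adjoint κ = X.mul ∘ₗ (TensorProduct.mk ℂ X.H X.H).flip c ∘ₗ X.mul ∘ₗ
        TensorProduct.mk ℂ X.H X.H a := fun a c => by
    rw [hadj]
    ext z
    refine (hact a c (LinearMap.adjoint U z)).trans ?_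
    rw [show U (LinearMap.adjoint U z) = z from LinearMap.congr_fun hU' z]
    rfl
  have : Nontrivial X.H := L.toEquiv.nontrivial
  obtain ⟨hM, hN⟩ := nontrivial_of_comp_adjoint hκ
  choose χ hχ using fun x y => exists_smul_of_bimodule_map hX.rep hY.rep M.isDaggerBimodule
    N.isDaggerBimodule hκ hκ' hκact (sandwich_act hX hY M x y)
  obtain ⟨h, k, m, hne⟩ := exists_sandwichFunctional_ne_zero hX hY M
  -- The composite `P̄ ∘ M ∘ Q` is a quantum isomorphism `Γ'' → Γ'` on which the functional is a
  -- character.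
  exact ((Q.isQuantumIso.crossComp M.obj.isQuantumIso).crossComp
    P.isQuantumIso.crossDual).iso_of_character χ _ hne fun x y z =>
      sandwichFunctional_coef hX hY M h k m (hχ x y) z

end Morita

/-! ### Morita equivalence as isomorphism of presenting graphs -/

section Classification

variable {Γ Γ' Γ'' : QuantumGraph.{u}}

lemma moritaEquivalent_iff_iso {X Y : MonoidData Γ} {P : QuantumIso Γ' Γ} {Q : QuantumIso Γ'' Γ}
    {L : X.H ≃ₗ[ℂ] (P.H →ₗ[ℂ] P.H)} {R : Y.H ≃ₗ[ℂ] (Q.H →ₗ[ℂ] Q.H)} (hX : Presents X P L)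
    (hY : Presents Y Q R) [Nontrivial P.H] [Nontrivial Q.H] (hXs : X.IsSimple) (hYs : Y.IsSimple) :
    X.MoritaEquivalent Y ↔ Γ'.Iso Γ'' :=
  ⟨fun h => iso_equivalence.symm (iso_of_moritaEquivalent hX hY h),
    moritaEquivalent_of_iso hX hY hXs.isDaggerFrobeniusMonoid.isQuantumIso
      hYs.isDaggerFrobeniusMonoid.isQuantumIso⟩

lemma graphRel_equivalence (Γ : QuantumGraph.{u}) : Equivalence (graphRel Γ) where
  refl _ := iso_equivalence.refl _
  symm h := iso_equivalence.symm h
  trans h h' := iso_equivalence.trans h h'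

/-- Choosing a presenting graph for each monoid makes Morita equivalence the pullback of graph
isomorphism, so bimodules never have to be composed to prove transitivity. -/
lemma moritaRel_equivalence (Γ : QuantumGraph.{u}) : Equivalence (moritaRel Γ) := by
  choose G P hP L hL using fun X : SimpleFrobeniusMonoid Γ => exists_presents X.2
  have h : ∀ X Y, moritaRel Γ X Y ↔ (G X).Iso (G Y) := fun X Y =>
    moritaEquivalent_iff_iso (hL X) (hL Y) X.2 Y.2
  exact ⟨fun X => (h X X).2 (iso_equivalence.refl _),
    fun {X Y} hXY => (h Y X).2 (iso_equivalence.symm ((h X Y).1 hXY)),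
    fun {X Y Z} hXY hYZ => (h X Z).2 (iso_equivalence.trans ((h X Y).1 hXY) ((h Y Z).1 hYZ))⟩

end Classification

end QG

end

/-! ### The bijection -/

theorem mainTheorem1 (Γ : QG.QuantumGraph.{u}) :
    ∃ (hI : Equivalence (QG.graphRel Γ)) (hM : Equivalence (QG.moritaRel Γ))
      (Φ : Quotient ⟨QG.graphRel Γ, hI⟩ → Quotient ⟨QG.moritaRel Γ, hM⟩),
      Function.Bijective Φ ∧
      (∀ (Γ' : QG.QuantumGraph.{u}) (P : QG.QuantumIso Γ' Γ) (hP : Nontrivial P.H),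
        ∃ hX : P.monoid.IsSimple,
          Φ (Quotient.mk _ ⟨Γ', P, hP⟩) = Quotient.mk _ ⟨P.monoid, hX⟩) ∧
      (∀ X : QG.SimpleFrobeniusMonoid Γ,
        ∃ (Γ' : QG.QuantumGraph.{u}) (P : QG.QuantumIso Γ' Γ) (hP : Nontrivial P.H),
          X.1.StarIso P.monoid ∧
            Φ (Quotient.mk _ ⟨Γ', P, hP⟩) = Quotient.mk _ X) := by
  have key : ∀ {Γ' Γ'' : QG.QuantumGraph.{u}} {X Y : QG.SimpleFrobeniusMonoid Γ}
      {P : QG.QuantumIso Γ' Γ} {Q : QG.QuantumIso Γ'' Γ} (_ : Nontrivial P.H) (_ : Nontrivial Q.H)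
      {L : X.1.H ≃ₗ[ℂ] (P.H →ₗ[ℂ] P.H)} {R : Y.1.H ≃ₗ[ℂ] (Q.H →ₗ[ℂ] Q.H)},
      QG.Presents X.1 P L → QG.Presents Y.1 Q R → (QG.moritaRel Γ X Y ↔ Γ'.Iso Γ'') :=
    fun {_ _ X Y} _ _ _ _ _ _ hX hY => QG.moritaEquivalent_iff_iso hX hY X.2 Y.2
  -- `Φ` is built from an arbitrary quantum isomorphism for each graph; `hmk` below shows that the
  -- Morita class does not depend on the choice.
  choose P hP using fun G : QG.QuantumIsomorphicGraph Γ => G.2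
  let F : QG.QuantumIsomorphicGraph Γ → QG.SimpleFrobeniusMonoid Γ := fun G =>
    ⟨(P G).monoid, have := hP G; QG.monoid_isSimple (P G)⟩
  have hF : ∀ G, QG.Presents (F G).1 (P G) (have := hP G; QG.endRep (P G).H) := fun G =>
    have := hP G; QG.presents_monoid (P G)
  have hI := QG.graphRel_equivalence Γ
  have hM := QG.moritaRel_equivalence Γ
  have hmk : ∀ (G : QG.QuantumIsomorphicGraph Γ) (Y : QG.SimpleFrobeniusMonoid Γ)
      (Q : QG.QuantumIso G.1 Γ) (_ : Nontrivial Q.H) (R : Y.1.H ≃ₗ[ℂ] (Q.H →ₗ[ℂ] Q.H)),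
      QG.Presents Y.1 Q R → QG.moritaRel Γ (F G) Y := fun G Y Q hQ R hR =>
    (key (hP G) hQ (hF G) hR).2 (hI.refl G)
  refine ⟨hI, hM, Quotient.map F fun G G' h => (key (hP G) (hP G') (hF G) (hF G')).2 h, ⟨?_, ?_⟩,
    fun Γ' Q hQ => ⟨QG.monoid_isSimple Q, Quotient.sound (hmk _ _ Q hQ _ (QG.presents_monoid Q))⟩,
    fun X => ?_⟩
  · rintro ⟨G⟩ ⟨G'⟩ h
    exact Quotient.sound ((key (hP G) (hP G') (hF G) (hF G')).1 (Quotient.exact h))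
  · rintro ⟨X⟩
    obtain ⟨Γ', Q, hQ, R, hR⟩ := QG.exists_presents X.2
    exact ⟨Quotient.mk _ ⟨Γ', Q, hQ⟩, Quotient.sound (hmk _ _ Q hQ R hR)⟩
  · obtain ⟨Γ', Q, hQ, R, hR⟩ := QG.exists_presents X.2
    exact ⟨Γ', Q, hQ, (QG.starIso_monoid_iff X.2.isDaggerFrobeniusMonoid.frobenius Q).2 ⟨R, hR⟩,
      Quotient.sound (hmk _ _ Q hQ R hR)⟩
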